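/- **Setting.** Let $X$ be a Polish space with a $\sigma$-finite Borel measure $m_\diamond$ of full topological support, let $I=(0,T)$ with $0<T<\infty$, and let $\mathcal E_\diamond$ be a strongly local Dirichlet form on $\mathcal H=L^2(X,m_\diamond)$ with domain $\mathcal F$ and square field operator $\Gamma_\diamond$, so $\mathcal E_\diamond(u,v)=\int_X\Gamma_\diamond(u,v)\,dm_\diamond$. The space $\mathcal F$ is a Hilbert space with scalar product $\mathcal E_\diamond(u,v)+\int uv\,dm_\diamond$, and $\mathcal F\subset\mathcal H\subset\mathcal F^*$. Let $f$ be a bounded measurable function on $I\times X$ with $f_t\in\mathcal F$ for all $t\in I$ and $\Gamma_\diamond(f_t)\le C$ a.e. with $C$ independent of $t$, and put $m_t=e^{-f_t}m_\diamond$. For $t\in I$ let $\Gamma_t:\mathcal F\times\mathcal F\to L^1(X,m_\diamond)$ be symmetric, positive semidefinite and bilinear, with the diffusion property $\Gamma_t(\Psi(u_1,\dots,u_k),v)=\sum_{i}\partial_i\Psi(u_1,\dots,u_k)\,\Gamma_t(u_i,v)$ for all $u_1,\dots,u_k,v\in\mathcal F\cap L^\infty$ and $\Psi\in C^1(\mathbb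 R^k)$ with $\Psi(0)=0$, and with $\frac1{C'}\Gamma_\diamond(u)\le\Gamma_t(u)\le C'\,\Gamma_\diamond(u)$ a.e. for all $u\in\mathcal F$ and some $C'>0$ independent of $t$ and $u$; here $\Gamma(u)=\Gamma(u,u)$. Put $\mathcal E_t(u,v)=\int_X\Gamma_t(u,v)\,dm_t$ on $\mathrm{Dom}(\mathcal E)=\mathcal F$, $\mathcal E_t(u)=\mathcal E_t(u,u)$, with $\mathcal E_t(u)=\infty$ for $u\in\mathcal H\setminus\mathcal F$. Assume that, for some constant $L$ and all $s<t$ in $I$, $$|f_t(x)-f_s(x)|\le L\,|t-s|\quad\text{for all }x\in X,\qquad |\Gamma_t(u)-\Gamma_s(u)|\le 2L\int_s^t\Gamma_r(u)\,dr\ \text{ a.e., for all }u\in\mathcal F .$$ **Heat equation.** For $0\le s<\tau\le T$ let $\mathcal F_{(s,\tau)}=L^2((s,\tau)\to\mathcal F)\cap H^1((s,\tau)\to\mathcal F^*)\subset \mathcal C([s,\tau]\to\mathcal H)$. A solution to the heat equation on $(s,\tau)\times X$ is a function $u\in\mathcal F_{(s,\tau)}$ (identified with its continuous representative $[s,\tau]\to\mathcal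 H$) such that for all $w\in\mathcal F_{(s,\tau)}$ $$-\int_s^\tau\mathcal E_t(u_t,w_t)\,dt=\int_s^\tau\langle\partial_tu_t,\,w_te^{-f_t}\rangle_{\mathcal F^*,\mathcal F}\,dt .$$ **EVI flows.** Let $\|v\|_t=(\int|v|^2dm_t)^{1/2}$, and for $s,t\in I$ and $v\in\mathcal H$ put $$\|v\|_{s,t}=\inf_\gamma\Big(\int_0^1|\dot\gamma^a|^2_{s+a(t-s)}\,da\Big)^{1/2},$$ where the infimum runs over all absolutely continuous curves $\gamma:[0,1]\to\mathcal H$ with $\gamma^1-\gamma^0=v$, and $|\dot\gamma^a|_r$ is the metric speed with respect to $\|\cdot\|_r$. Put $\partial_s^+g(s)|_{s=t}=\limsup_{s\to t}\frac{g(t)-g(s)}{t-s}\in[-\infty,\infty]$. A dynamic forward EVI$(-L/2,\infty)$-flow for $\frac12\mathcal E$ on $(s_0,\tau)\subset I$ is a locally absolutely continuous curve $x:(s_0,\tau)\to\mathcal H$ such that for all $t\in(s_0,\tau)$ and all $w\in\mathrm{Dom}(\mathcal E)$ $$-\tfrac12\,\partial_s^+\|x_s-w\|_{s,t}^2\Big|_{s=t}+\tfrac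 L4\,\|x_t-w\|_t^2\ \ge\ \tfrac12\mathcal E_t(x_t)-\tfrac12\mathcal E_t(w).$$ It emanates in $h\in\mathcal H$ if $x_t\to h$ in $\mathcal H$ as $t\searrow s_0$. **Theorem.** For all $0\le s_0<\tau\le T$ the following hold. (i) Every solution $u$ to the heat equation on $(s_0,\tau)\times X$ is a dynamic forward EVI$(-L/2,\infty)$-flow for $\frac12\mathcal E$ on $(s_0,\tau)$, and $u_t\in\mathrm{Dom}(\mathcal E)$ for all $t\in(s_0,\tau)$. (ii) This property characterizes the heat flow: if $x$ is a dynamic forward EVI$(-L/2,\infty)$-flow for $\frac12\mathcal E$ on $(s_0,\tau)$ emanating in $h\in\mathcal H$, then $x$ is the restriction to $(s_0,\tau)$ of a solution to the heat equation on $(s_0,\tau)\times X$ with initial value $u_{s_0}=h$, and it coincides on $(s_0,\tau)$ with every such solution. (iii) For every solution $u$ to the heat equation on $(s_0,\tau)\times X$ and all $s<t$ in $[s_0,\tau]\cap(0,T)$, $$\|u_t\|_t\le e^{L(t-s)/2}\,\|u_s\|_s .$$ -/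

import Mathlib

open MeasureTheory Set Filter Topology
open scoped ENNReal ContDiff

noncomputable section

/-! ### Curves and dynamic EVI flows in time-dependent metric spaces

Throughout, `I = (0, T)` and `d t` is the distance at time `t ∈ I` on a fixed set `Y`. -/

namespace DynEVI

variable {Y : Type*}

/-- Absolute continuity of the curve `γ` on `[a, b]` with respect to the distance `d`. -/
def IsAbsContOn (d : Y → Y → ℝ) (γ : ℝ → Y) (a b : ℝ) : Prop :=
  ∃ g : ℝ → ℝ, IntegrableOn g (Icc a b) ∧
    ∀ p q : ℝ, a ≤ p → p ≤ q → q ≤ b → d (γ p) (γ q) ≤ ∫ r in p..q, g r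

/-- The metric speed of the curve `γ` at `a` with respect to the distance `d`
(for absolutely continuous curves the `limsup` is a limit at almost every `a`). -/
def metricSpeed (d : Y → Y → ℝ) (γ : ℝ → Y) (a : ℝ) : ℝ≥0∞ :=
  limsup (fun b => ENNReal.ofReal (d (γ b) (γ a) / |b - a|)) (𝓝[≠] a)

/-- The action `∫₀¹ |γ̇ᵃ|²_{s + a (t - s)} da`. -/
def action (d : ℝ → Y → Y → ℝ) (s t : ℝ) (γ : ℝ → Y) : ℝ≥0∞ :=
  ∫⁻ a in Ioo (0 : ℝ) 1, metricSpeed (d (s + a * (t - s))) γ a ^ 2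

/-- The absolutely continuous curves `γ : [0, 1] → Y` from `x` to `y`. -/
def curves (T : ℝ) (d : ℝ → Y → Y → ℝ) (x y : Y) : Set (ℝ → Y) :=
  {γ | (∀ r ∈ Ioo 0 T, IsAbsContOn (d r) γ 0 1) ∧ γ 0 = x ∧ γ 1 = y}

/-- The dynamic distance `d_{s,t}(x, y) = inf_γ (∫₀¹ |γ̇ᵃ|²_{s + a (t - s)} da)^{1/2}`. -/
def dynDist (T : ℝ) (d : ℝ → Y → Y → ℝ) (s t : ℝ) (x y : Y) : ℝ :=
  Real.sqrt (⨅ γ ∈ curves T d x y, action d s t γ).toReal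

/-- The upper derivative `∂⁺g(t) = limsup_{s → t} (g t - g s) / (t - s)`, with values in
`[-∞, ∞]`. -/
def upperDeriv (g : ℝ → ℝ) (t : ℝ) : EReal :=
  limsup (fun s => (((g t - g s) / (t - s) : ℝ) : EReal)) (𝓝[≠] t)

/-- Dynamic forward EVI`(K, ∞)`-gradient flows `(x_t)_{t ∈ (σ, τ)}` for the functional `V`:
(locally) absolutely continuous curves such that for all `t ∈ (σ, τ)` and all `z ∈ Dom(V_t)`
`-½ ∂_s⁺ d²_{s,t}(x_s, z)|_{s=t} - K/2 d_t²(x_t, z) ≥ V_t(x_t) - V_t(z)`. -/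
structure IsForwardEVI (T : ℝ) (d : ℝ → Y → Y → ℝ) (V : ℝ → Y → EReal) (K σ τ : ℝ)
    (x : ℝ → Y) : Prop where
  absCont : ∀ a b : ℝ, σ < a → a ≤ b → b < τ → ∀ r ∈ Ioo 0 T, IsAbsContOn (d r) x a b
  evi : ∀ t ∈ Ioo σ τ, ∀ z : Y, V t z ≠ ⊤ →
    V t (x t) - V t z ≤
      -(((1 / 2 : ℝ) : EReal) * upperDeriv (fun s => dynDist T d s t (x s) z ^ 2) t)
        - ((K / 2 * d t (x t) z ^ 2 : ℝ) : EReal)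

end DynEVI

/-! ### Dirichlet forms -/

/-- A (symmetric) Dirichlet form on `L²(X, m)`. -/
structure DirichletForm {X : Type*} [MeasurableSpace X] (m : Measure X) where
  /-- the form domain -/
  dom : Submodule ℝ (Lp ℝ 2 m)
  /-- the bilinear form -/
  form : dom →ₗ[ℝ] dom →ₗ[ℝ] ℝ
  dense_dom : Dense (dom : Set (Lp ℝ 2 m))
  symm : ∀ u v, form u v = form v u
  nonneg : ∀ u, 0 ≤ form u u
  closed : ∀ (u : ℕ → dom) (v : Lp ℝ 2 m),
    Tendsto (fun n => (u n : Lp ℝ 2 m)) atTop (𝓝 v) →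
    (∀ ε > 0, ∃ N, ∀ n ≥ N, ∀ k ≥ N, form (u n - u k) (u n - u k) < ε) →
    ∃ hv : v ∈ dom, Tendsto (fun n => form (u n - ⟨v, hv⟩) (u n - ⟨v, hv⟩)) atTop (𝓝 0)
  markov : ∀ (ξ : ℝ → ℝ) (hξ : LipschitzWith 1 ξ) (h0 : ξ 0 = 0) (u : dom),
    ∃ hu : hξ.compLp h0 (u : Lp ℝ 2 m) ∈ dom,
      form ⟨hξ.compLp h0 (u : Lp ℝ 2 m), hu⟩ ⟨hξ.compLp h0 (u : Lp ℝ 2 m), hu⟩ ≤ form u u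

namespace DirichletForm

variable {X : Type*} [MeasurableSpace X] {m : Measure X}

/-- Strong locality: `ℰ(u, v) = 0` whenever `(u + c) v = 0` a.e. for some constant `c`. -/
def StronglyLocal (E : DirichletForm m) : Prop :=
  ∀ (u v : E.dom) (c : ℝ),
    (∀ᵐ x ∂m, ((u : Lp ℝ 2 m) x + c) * (v : Lp ℝ 2 m) x = 0) → E.form u v = 0

/-- The form domain, as a Hilbert space with scalar product `ℰ(u, v) + ∫ u v dm`
(a type synonym of `E.dom`, which carries the scalar product of `L²`). -/
def Dom (E : DirichletForm m) : Type _ := E.dom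

instance (E : DirichletForm m) : AddCommGroup E.Dom := inferInstanceAs (AddCommGroup E.dom)
instance (E : DirichletForm m) : Module ℝ E.Dom := inferInstanceAs (Module ℝ E.dom)

/-- The inclusion of the form domain into `L²`, as a linear map. -/
def inclₗ (E : DirichletForm m) : E.Dom →ₗ[ℝ] Lp ℝ 2 m := E.dom.subtype

/-- The bilinear form on the form domain. -/
def formDom (E : DirichletForm m) : E.Dom →ₗ[ℝ] E.Dom →ₗ[ℝ] ℝ := E.form

instance core (E : DirichletForm m) : InnerProductSpace.Core ℝ E.Dom where
  inner u v := E.formDom u v + inner ℝ (E.inclₗ u) (E.inclₗ v)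
  conj_inner_symm u v := by
    simp only [conj_trivial]
    rw [real_inner_comm]
    exact congrArg (· + _) (E.symm v u)
  re_inner_nonneg u := by
    have h1 : 0 ≤ E.formDom u u := E.nonneg u
    have h2 : 0 ≤ inner ℝ (E.inclₗ u) (E.inclₗ u) := real_inner_self_nonneg
    simpa using add_nonneg h1 h2
  add_left u v w := by
    simp only [map_add, LinearMap.add_apply, inner_add_left]
    ring
  smul_left u v r := by
    simp only [map_smul, LinearMap.smul_apply, real_inner_smul_left, smul_eq_mul, conj_trivial]
    ring
  definite u hu := by
    have h1 : 0 ≤ E.formDom u u := E.nonneg u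
    have h2 : 0 ≤ inner ℝ (E.inclₗ u) (E.inclₗ u) := real_inner_self_nonneg
    have h3 : inner ℝ (E.inclₗ u) (E.inclₗ u) = 0 := by linarith
    exact Subtype.ext (inner_self_eq_zero.1 h3)

instance (E : DirichletForm m) : NormedAddCommGroup E.Dom :=
  (core E).toNormedAddCommGroup

instance (E : DirichletForm m) : InnerProductSpace ℝ E.Dom :=
  InnerProductSpace.ofCore (core E).toCore

theorem inner_dom (E : DirichletForm m) (u v : E.Dom) :
    inner ℝ u v = E.formDom u v + inner ℝ (E.inclₗ u) (E.inclₗ v) := rfl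

/-- The continuous embedding of the form domain into `L²`. -/
def incl (E : DirichletForm m) : E.Dom →L[ℝ] Lp ℝ 2 m :=
  E.inclₗ.mkContinuous 1 (fun u => by
    have h1 : 0 ≤ E.formDom u u := E.nonneg u
    have h2 := E.inner_dom u u
    rw [real_inner_self_eq_norm_sq, real_inner_self_eq_norm_sq] at h2
    rw [one_mul]
    exact (sq_le_sq₀ (norm_nonneg _) (norm_nonneg _)).1 (by linarith))

/-- The embedding `ℱ ⊂ L² ⊂ ℱ*`, sending `u` to the functional `v ↦ ∫ u v dm`. -/
def toDual (E : DirichletForm m) : E.Dom →L[ℝ] StrongDual ℝ E.Dom :=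
  ((ContinuousLinearMap.compL ℝ E.Dom (Lp ℝ 2 m) ℝ).flip E.incl).comp
    ((innerSL ℝ (E := Lp ℝ 2 m)).comp E.incl)

/-- The elements of the form domain that are bounded functions. -/
def BddDom (E : DirichletForm m) (u : E.Dom) : Prop := MemLp (E.incl u) ∞ m

/-- `Γ` is the square field operator of the form `E`: a symmetric, positive semidefinite bilinear
map `ℱ × ℱ → L¹(m)` with `ℰ(u, v) = ∫ Γ(u, v) dm` and
`2 ∫ w Γ(u, v) dm = ℰ(u w, v) + ℰ(v w, u) - ℰ(u v, w)` for bounded `u, v, w ∈ ℱ`. -/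
structure IsSquareField (E : DirichletForm m) (Γ : E.Dom →ₗ[ℝ] E.Dom →ₗ[ℝ] Lp ℝ 1 m) :
    Prop where
  symm : ∀ u v, Γ u v = Γ v u
  nonneg : ∀ u, ∀ᵐ x ∂m, 0 ≤ Γ u u x
  integral_eq : ∀ u v, ∫ x, Γ u v x ∂m = E.formDom u v
  square_field : ∀ u v w uv uw vw : E.Dom, E.BddDom u → E.BddDom v → E.BddDom w →
    (∀ᵐ x ∂m, E.incl uv x = E.incl u x * E.incl v x) →
    (∀ᵐ x ∂m, E.incl uw x = E.incl u x * E.incl w x) →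
    (∀ᵐ x ∂m, E.incl vw x = E.incl v x * E.incl w x) →
    2 * ∫ x, E.incl w x * Γ u v x ∂m = E.formDom uw v + E.formDom vw u - E.formDom uv w

/-- The diffusion property of a bilinear map `Γ : ℱ × ℱ → L¹(m)`: for bounded `u₁, …, u_k, v ∈ ℱ`
and `Ψ ∈ C¹(ℝᵏ)` with `Ψ(0) = 0` one has `Γ(Ψ(u), v) = ∑ᵢ ∂ᵢΨ(u) Γ(uᵢ, v)`. -/
def IsDiffusion (E : DirichletForm m) (Γ : E.Dom →ₗ[ℝ] E.Dom →ₗ[ℝ] Lp ℝ 1 m) : Prop :=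
  ∀ (k : ℕ) (u : Fin k → E.Dom) (v w : E.Dom) (Ψ : (Fin k → ℝ) → ℝ),
    (∀ i, E.BddDom (u i)) → E.BddDom v → ContDiff ℝ 1 Ψ → Ψ 0 = 0 →
    (∀ᵐ x ∂m, E.incl w x = Ψ (fun i => E.incl (u i) x)) →
    ∀ᵐ x ∂m, Γ w v x =
      ∑ i, fderiv ℝ Ψ (fun j => E.incl (u j) x) (Pi.single i 1) * Γ (u i) v x

/-- `u ∈ ℱ_{(s,τ)} = L²((s,τ) → ℱ) ∩ H¹((s,τ) → ℱ*)`, with weak time derivative `u'`. -/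
structure MemParabolic (E : DirichletForm m) (s τ : ℝ) (u : ℝ → E.Dom)
    (u' : ℝ → StrongDual ℝ E.Dom) : Prop where
  memLp : MemLp u 2 (volume.restrict (Ioo s τ))
  memLp_deriv : MemLp u' 2 (volume.restrict (Ioo s τ))
  weak_deriv : ∀ φ : ℝ → ℝ, ContDiff ℝ ∞ φ → HasCompactSupport φ → tsupport φ ⊆ Ioo s τ →
    ∫ t in Ioo s τ, deriv φ t • E.toDual (u t) = -∫ t in Ioo s τ, φ t • u' t

end DirichletForm

/-! ### Time-dependent Dirichlet forms and the heat equation -/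

/-- A time-dependent Dirichlet form on `I = (0, T)`: a strongly local reference Dirichlet form on
`L²(X, m)` with square field operator `Γref`, weights `f t` defining the measures
`m_t = e^{-f_t} m`, and square field operators `Γ t` of diffusion type that are uniformly
comparable to `Γref`. -/
structure TimeDepForm {X : Type*} [MeasurableSpace X] (m : Measure X) (T : ℝ) where
  /-- the reference Dirichlet form -/
  ref : DirichletForm m
  ref_local : ref.StronglyLocal
  /-- the square field operator of the reference form -/
  Γref : ref.Dom →ₗ[ℝ] ref.Dom →ₗ[ℝ] Lp ℝ 1 m
  ref_squareField : ref.IsSquareField Γref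
  /-- the logarithmic weights -/
  f : ℝ → X → ℝ
  f_meas : Measurable fun p : Ioo (0 : ℝ) T × X => f p.1 p.2
  f_bdd : ∃ C, ∀ t ∈ Ioo 0 T, ∀ x, |f t x| ≤ C
  f_dom : ∃ C, ∀ t ∈ Ioo 0 T, ∃ F : ref.Dom,
    (∀ᵐ x ∂m, ref.incl F x = f t x) ∧ ∀ᵐ x ∂m, Γref F F x ≤ C
  /-- the square field operators at the times `t` -/
  Γ : ℝ → ref.Dom →ₗ[ℝ] ref.Dom →ₗ[ℝ] Lp ℝ 1 m
  Γ_symm : ∀ t ∈ Ioo 0 T, ∀ u v, Γ t u v = Γ t v u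
  Γ_nonneg : ∀ t ∈ Ioo 0 T, ∀ u, ∀ᵐ x ∂m, 0 ≤ Γ t u u x
  Γ_diffusion : ∀ t ∈ Ioo 0 T, ref.IsDiffusion (Γ t)
  Γ_comparable : ∃ C > 0, ∀ t ∈ Ioo 0 T, ∀ u, ∀ᵐ x ∂m,
    1 / C * Γref u u x ≤ Γ t u u x ∧ Γ t u u x ≤ C * Γref u u x

namespace TimeDepForm

variable {X : Type*} [MeasurableSpace X] {m : Measure X} {T : ℝ}

/-- The measure `m_t = e^{-f_t} m`. -/
def meas (S : TimeDepForm m T) (t : ℝ) : Measure X :=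
  m.withDensity fun x => ENNReal.ofReal (Real.exp (-S.f t x))

/-- The Dirichlet energy `ℰ_t(u, v) = ∫ Γ_t(u, v) dm_t` on the common domain `ℱ`. -/
def energy (S : TimeDepForm m T) (t : ℝ) (u v : S.ref.Dom) : ℝ :=
  ∫ x, S.Γ t u v x ∂(S.meas t)

/-- The norm `‖v‖_t = (∫ |v|² dm_t)^{1/2}` of `L²(X, m_t) = L²(X, m)`. -/
def normAt (S : TimeDepForm m T) (t : ℝ) (v : Lp ℝ 2 m) : ℝ :=
  Real.sqrt (∫ x, |v x| ^ 2 ∂(S.meas t))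

/-- The distance `d_t(v, w) = ‖v - w‖_t`. -/
def distAt (S : TimeDepForm m T) (t : ℝ) (v w : Lp ℝ 2 m) : ℝ := S.normAt t (v - w)

open Classical in
/-- One half of the Dirichlet energy as a functional on `L²`, equal to `∞` off the domain. -/
def halfEnergy (S : TimeDepForm m T) (t : ℝ) (v : Lp ℝ 2 m) : EReal :=
  if h : v ∈ S.ref.dom then ((1 / 2 * S.energy t ⟨v, h⟩ ⟨v, h⟩ : ℝ) : EReal) else ⊤

/-- `u` is a solution to the heat equation `∂_t u = A_t u` on `(s, τ) × X`: the continuous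
representative `[s, τ] → L²` of a function in `ℱ_{(s,τ)}` such that
`-∫ ℰ_t(u_t, w_t) dt = ∫ ⟨∂_t u_t, w_t e^{-f_t}⟩ dt` for all `w ∈ ℱ_{(s,τ)}`. In the code `V t` is
the function `w_t e^{-f_t}`, which lies in `ℱ` because `f_t` is bounded with bounded
`Γref(f_t)`. -/
def IsHeatSolution (S : TimeDepForm m T) (s τ : ℝ) (u : ℝ → Lp ℝ 2 m) : Prop :=
  ContinuousOn u (Icc s τ) ∧
  ∃ (U : ℝ → S.ref.Dom) (U' : ℝ → StrongDual ℝ S.ref.Dom),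
    S.ref.MemParabolic s τ U U' ∧
    (∀ᵐ t ∂(volume.restrict (Ioo s τ)), u t = S.ref.incl (U t)) ∧
    ∀ (W : ℝ → S.ref.Dom) (W' : ℝ → StrongDual ℝ S.ref.Dom) (V : ℝ → S.ref.Dom),
      S.ref.MemParabolic s τ W W' →
      (∀ᵐ t ∂(volume.restrict (Ioo s τ)), ∀ᵐ x ∂m,
        S.ref.incl (V t) x = S.ref.incl (W t) x * Real.exp (-S.f t x)) →
      -∫ t in Ioo s τ, S.energy t (U t) (W t) = ∫ t in Ioo s τ, U' t (V t)

/-- The weights are `L`-Lipschitz in time. -/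
def WeightLipschitz (S : TimeDepForm m T) (L : ℝ) : Prop :=
  ∀ s ∈ Ioo 0 T, ∀ t ∈ Ioo 0 T, ∀ x, |S.f t x - S.f s x| ≤ L * |t - s|

/-- The log-Lipschitz bound `|Γ_t(u) - Γ_s(u)| ≤ 2 L ∫_s^t Γ_r(u) dr` (an integral in `L¹(m)`). -/
def GammaLogLipschitz (S : TimeDepForm m T) (L : ℝ) : Prop :=
  ∀ u : S.ref.Dom, ∀ s ∈ Ioo 0 T, ∀ t ∈ Ioo 0 T, s < t →
    ∀ᵐ x ∂m, |S.Γ t u u x - S.Γ s u u x| ≤ 2 * L * (∫ r in s..t, S.Γ r u u : Lp ℝ 1 m) x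

end TimeDepForm

end

noncomputable section

open scoped RealInnerProductSpace

/-! ### Absolutely continuous curves -/

/-! The problem is moved to an abstract Hilbert setting, a `FormFlow`: a form domain `F` embedded in
`H`, symmetric energy forms `a t` on `F` and scalar products `b t` on `H`, all Lipschitz in time in
operator norm, with `b t ≤ exp (L |t - r|) b r`. Multiplication by `e^{-f_t}` and by `e^{f_t}` are
the bounded operators `N t` and `N' t` on `F`; they translate between the pairing of `F*` with `F`
and the scalar product `b t`. In this setting weak solutions of the heat equation and EVI flows are
both compared with strong solutions: curves that are locally absolutely continuous in `H` and
satisfy, for almost every `t` and all `v ∈ F`, that the derivative of `b t (x r) v` at `r = t` is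
`-a t (x t) v`.

Weak implies strong (`IsWeakSol.isStrongSol`, `IsWeakSol.exists_bound`). Put `Y t = ∫_t^{t+h} U`, so
that `Y' = U(t+h) - U(t)`. The equation integrated over `[t, t+h]` and tested with `Y'` gives `c
‖x(t+h) - x(t)‖² + (d/dt) a t (Y t) (Y t) ≤` errors of total size `O(h²)`. If integration starts at
a point where the primitive of `‖U‖²` is differentiable, the initial term is `O(h²)` too. Hence the
difference quotients of `x` are bounded in `L²`, which makes `x` absolutely continuous in `H`, and
`Y q / h` is bounded in `F`, which puts `x q` into `F` for every `q` by weak compactness.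

Strong implies EVI (`IsStrongSol.isForwardEVI`). The squared dynamic distance from time `s` to time
`t` equals `b t (x - y) (x - y)` up to a relative error `L |t - s| / 2` and terms of second order
(`IsDist.dynDist_sq_bounds`); this produces the constant `-L/2` of the EVI. What remains is the
increment of `b t (x r - w) (x r - w)` with the form frozen at time `t`. Its almost everywhere
derivative is close to `-2 a r (U r) (U r - w)`, and positivity together with weak continuity of the
curve in `F` bounds this near `t` by `a t w w - a t (x t) (x t)` plus a small error. Integration
gives the EVI at every time, not only almost every time.

EVI implies strong (`exists_isStrongSol_of_evi`). At almost every `t` the curve is pointwise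
Lipschitz, so the upper derivative is not `-∞` and the energy of `x t` is finite. Comparison with `w
= x t - η v`, division by `η` and small `η` give one half of the equation; `-v` gives the other
half.

A strong solution with an initial value is a weak solution up to both ends
(`IsStrongSol.exists_isWeakSol`): the energy inequality for `exp (-L t) b t (x t - w) (x t - w)`
makes the energy integrable and yields a limit at the final time. With `w = 0` it gives the growth
estimate, and, since strong solutions form a linear space, uniqueness. -/

/-- The curve `x` is absolutely continuous on `[p, q]`, with density `k`. -/
structure HasACDensity {E : Type*} [NormedAddCommGroup E] (x : ℝ → E) (k : ℝ → ℝ) (p q : ℝ) :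
    Prop where
  integrable : IntervalIntegrable k volume p q
  norm_sub_le : ∀ a b, p ≤ a → a ≤ b → b ≤ q → ‖x b - x a‖ ≤ ∫ r in a..b, k r

namespace HasACDensity

variable {E : Type*} [NormedAddCommGroup E] {x : ℝ → E} {k : ℝ → ℝ} {p q : ℝ}

theorem integrable_sub (h : HasACDensity x k p q) {a b : ℝ} (ha : p ≤ a) (hab : a ≤ b)
    (hb : b ≤ q) : IntervalIntegrable k volume a b :=
  h.integrable.mono_set (by
    rw [uIcc_of_le hab, uIcc_of_le (ha.trans (hab.trans hb))]; exact Icc_subset_Icc ha hb)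

theorem mono (h : HasACDensity x k p q) {a b : ℝ} (ha : p ≤ a) (hab : a ≤ b)
    (hb : b ≤ q) : HasACDensity x k a b :=
  ⟨h.integrable_sub ha hab hb, fun c d hc hcd hd =>
    h.norm_sub_le c d (ha.trans hc) hcd (hd.trans hb)⟩

theorem norm_sub_le_abs (h : HasACDensity x k p q) {a b : ℝ} (ha : a ∈ Icc p q)
    (hb : b ∈ Icc p q) : ‖x b - x a‖ ≤ |∫ r in a..b, k r| := by
  rcases le_total a b with hab | hab
  · exact (h.norm_sub_le a b ha.1 hab hb.2).trans (le_abs_self _)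
  · rw [norm_sub_rev, intervalIntegral.integral_symm, abs_neg]
    exact (h.norm_sub_le b a hb.1 hab ha.2).trans (le_abs_self _)

/-- Every sum of increments is dominated by the same sum for the primitive of `k`. For real curves
this opens the way to almost everywhere differentiability and to the fundamental theorem of
calculus. -/
theorem absolutelyContinuousOnInterval (h : HasACDensity x k p q) (hpq : p ≤ q) :
    AbsolutelyContinuousOnInterval x p q := by
  have h1 := h.integrable.absolutelyContinuousOnInterval_intervalIntegral (c := p) (by simp)
  refine squeeze_zero' (Eventually.of_forall fun E => Finset.sum_nonneg fun _ _ => dist_nonneg)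
    ?_ h1
  refine eventually_inf_principal.2 (Eventually.of_forall fun E hE => ?_)
  refine Finset.sum_le_sum fun i hi => ?_
  obtain ⟨ha, hb⟩ := hE.1 i hi
  rw [uIcc_of_le hpq] at ha hb
  rw [dist_eq_norm, norm_sub_rev, Real.dist_eq, abs_sub_comm,
    intervalIntegral.integral_interval_sub_left]
  · exact h.norm_sub_le_abs ha hb
  · exact h.integrable_sub le_rfl hb.1 hb.2
  · exact h.integrable_sub le_rfl ha.1 ha.2

theorem continuousOn (h : HasACDensity x k p q) (hpq : p ≤ q) : ContinuousOn x (Icc p q) := by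
  have := (h.absolutelyContinuousOnInterval hpq).continuousOn
  rwa [uIcc_of_le hpq] at this

/-- At almost every point the difference quotients are bounded in terms of the density. -/
theorem ae_norm_sub_le (h : HasACDensity x k p q) (hpq : p ≤ q) :
    ∀ᵐ t, t ∈ Ioo p q → ∀ ε > 0, ∀ᶠ r in 𝓝 t, ‖x r - x t‖ ≤ (k t + ε) * |r - t| := by
  filter_upwards [h.integrable.ae_hasDerivAt_integral] with t ht htpq ε hε
  rw [uIcc_of_le hpq] at ht
  have h1 := ht (Ioo_subset_Icc_self htpq) t (Ioo_subset_Icc_self htpq)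
  have h2 := (hasDerivAt_iff_isLittleO.1 h1).def hε
  filter_upwards [h2, Ioo_mem_nhds htpq.1 htpq.2] with r hr hrpq
  simp only [intervalIntegral.integral_same, sub_zero, smul_eq_mul, Real.norm_eq_abs] at hr
  rcases le_total t r with htr | htr
  · have h3 := h.norm_sub_le t r htpq.1.le htr hrpq.2.le
    rw [abs_of_nonneg (sub_nonneg.2 htr)] at hr ⊢
    linarith [abs_le.1 hr]
  · have h3 := h.norm_sub_le r t hrpq.1.le htr htpq.2.le
    rw [intervalIntegral.integral_symm, norm_sub_rev] at h3
    rw [abs_of_nonpos (sub_nonpos.2 htr)] at hr ⊢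
    linarith [abs_le.1 hr]

theorem sub {y : ℝ → E} {l : ℝ → ℝ} (h : HasACDensity x k p q) (h' : HasACDensity y l p q) :
    HasACDensity (fun t => x t - y t) (fun t => k t + l t) p q := by
  refine ⟨h.integrable.add h'.integrable, fun a b ha hab hb => ?_⟩
  rw [intervalIntegral.integral_add (h.integrable_sub ha hab hb) (h'.integrable_sub ha hab hb)]
  calc ‖x b - y b - (x a - y a)‖ = ‖(x b - x a) - (y b - y a)‖ := by congr 1; abel
    _ ≤ _ := (_root_.norm_sub_le _ _).trans
      (add_le_add (h.norm_sub_le a b ha hab hb) (h'.norm_sub_le a b ha hab hb))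

/-- A Lipschitz-type criterion. -/
theorem of_norm_sub_le {E' : Type*} [NormedAddCommGroup E'] {y : ℝ → E'} {C D : ℝ}
    (h : HasACDensity x k p q) (hC : 0 ≤ C)
    (hy : ∀ a b, p ≤ a → a ≤ b → b ≤ q → ‖y b - y a‖ ≤ C * ‖x b - x a‖ + D * (b - a)) :
    HasACDensity y (fun t => C * k t + D) p q := by
  refine ⟨(h.integrable.const_mul C).add intervalIntegrable_const, fun a b ha hab hb => ?_⟩
  rw [intervalIntegral.integral_add ((h.integrable_sub ha hab hb).const_mul C)
    intervalIntegrable_const, intervalIntegral.integral_const_mul, intervalIntegral.integral_const,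
    smul_eq_mul, mul_comm (b - a)]
  exact (hy a b ha hab hb).trans
    (add_le_add (mul_le_mul_of_nonneg_left (h.norm_sub_le a b ha hab hb) hC) le_rfl)

theorem deriv_le_of_eventually {g : ℝ → ℝ} {t G : ℝ} (h : DifferentiableAt ℝ g t)
    (hd : ∀ ε > 0, ∀ᶠ r in 𝓝[>] t, g r - g t ≤ (G + ε) * (r - t)) : deriv g t ≤ G := by
  refine le_of_forall_pos_le_add fun ε hε => ?_
  have h1 := (hasDerivAt_iff_tendsto_slope.1 h.hasDerivAt).mono_left
    (nhdsWithin_mono t (fun r (hr : t < r) => hr.ne') : 𝓝[>] t ≤ 𝓝[≠] t)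
  refine le_of_tendsto h1 ?_
  filter_upwards [hd ε hε, self_mem_nhdsWithin] with r hr htr
  rw [slope_def_field, div_le_iff₀ (sub_pos.2 htr)]
  exact hr

theorem ae_deriv_le {g k G : ℝ → ℝ} {p q : ℝ} (h : HasACDensity g k p q) (hpq : p ≤ q)
    (hd : ∀ᵐ t, t ∈ Ioo p q → ∀ ε > 0, ∀ᶠ r in 𝓝[>] t, g r - g t ≤ (G t + ε) * (r - t)) :
    ∀ᵐ t, t ∈ Ioc p q → deriv g t ≤ G t := by
  have h1 : ∀ᵐ t : ℝ, t ≠ q := by simp [ae_iff, measure_singleton]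
  filter_upwards [hd, (h.absolutelyContinuousOnInterval hpq).ae_differentiableAt, h1] with
    t h1 h2 h3 ht
  refine deriv_le_of_eventually (h2 ?_) (h1 ⟨ht.1, lt_of_le_of_ne ht.2 h3⟩)
  rw [uIcc_of_le hpq]; exact Ioc_subset_Icc_self ht

/-- An absolutely continuous function grows at most by the integral of a bound for its right
derivative. -/
theorem sub_le_integral {g k G : ℝ → ℝ} {p q : ℝ} (h : HasACDensity g k p q) (hpq : p ≤ q)
    (hG : IntervalIntegrable G volume p q)
    (hd : ∀ᵐ t, t ∈ Ioo p q → ∀ ε > 0, ∀ᶠ r in 𝓝[>] t, g r - g t ≤ (G t + ε) * (r - t)) :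
    g q - g p ≤ ∫ t in p..q, G t := by
  have hac := h.absolutelyContinuousOnInterval hpq
  rw [← hac.integral_deriv_eq_sub]
  refine intervalIntegral.integral_mono_ae_restrict hpq hac.intervalIntegrable_deriv hG ?_
  rw [← restrict_Ioc_eq_restrict_Icc]
  exact (ae_restrict_iff' measurableSet_Ioc).2 (h.ae_deriv_le hpq hd)

/-- A one-sided bound for the right derivative of an absolutely continuous function by a constant
minus a nonnegative function forces that function to be integrable. -/
theorem integrable_and_add_integral_le {g k G : ℝ → ℝ} {p q C : ℝ} (h : HasACDensity g k p q)
    (hpq : p ≤ q) (hG : AEStronglyMeasurable G (volume.restrict (Ioc p q)))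
    (hG0 : ∀ᵐ t, t ∈ Ioc p q → 0 ≤ G t)
    (hd : ∀ᵐ t, t ∈ Ioo p q → ∀ ε > 0, ∀ᶠ r in 𝓝[>] t, g r - g t ≤ (C - G t + ε) * (r - t)) :
    IntervalIntegrable G volume p q ∧ g q + ∫ t in p..q, G t ≤ g p + C * (q - p) := by
  have hac := h.absolutelyContinuousOnInterval hpq
  have h1 := h.ae_deriv_le (G := fun t => C - G t) hpq hd
  -- Almost everywhere `0 ≤ G ≤ C - g'`, and `g'` is integrable because `g` is absolutely
  -- continuous.
  have h2 : IntervalIntegrable G volume p q := by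
    rw [intervalIntegrable_iff_integrableOn_Ioc_of_le hpq]
    have h3 : IntervalIntegrable (fun t => C - deriv g t) volume p q :=
      intervalIntegrable_const.sub hac.intervalIntegrable_deriv
    refine Integrable.mono (h3.1) hG ?_
    rw [ae_restrict_iff' measurableSet_Ioc]
    filter_upwards [h1, hG0] with t h1 h2 ht
    rw [Real.norm_of_nonneg (h2 ht)]
    exact le_trans (by linarith [h1 ht]) (le_abs_self _)
  refine ⟨h2, ?_⟩
  have h3 := h.sub_le_integral hpq (G := fun t => C - G t) (intervalIntegrable_const.sub h2) hd
  rw [intervalIntegral.integral_sub intervalIntegrable_const h2,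
    intervalIntegral.integral_const, smul_eq_mul] at h3
  linarith

/-- The fundamental theorem of calculus for real absolutely continuous functions. -/
theorem integral_eq_sub {g k G : ℝ → ℝ} {p q : ℝ} (h : HasACDensity g k p q) (hpq : p ≤ q)
    (hd : ∀ᵐ t, t ∈ Ioo p q → HasDerivAt g (G t) t) :
    ∫ t in p..q, G t = g q - g p := by
  have hac := h.absolutelyContinuousOnInterval hpq
  rw [← hac.integral_deriv_eq_sub]
  have h1 : ∀ᵐ t : ℝ, t ≠ q := by simp [ae_iff, measure_singleton]
  refine intervalIntegral.integral_congr_ae ?_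
  filter_upwards [hd, h1] with t ht h1 htpq
  rw [uIoc_of_le hpq] at htpq
  exact (ht ⟨htpq.1, lt_of_le_of_ne htpq.2 h1⟩).deriv.symm

end HasACDensity

/-! ### Weak derivatives of continuous curves -/

/-- A smooth step from `0` to `1` on `[r, r + ε]`. -/
def smoothStep (r ε x : ℝ) : ℝ := Real.smoothTransition ((x - r) / ε)

section smoothStep

variable {r ε x : ℝ}

theorem contDiff_smoothStep : ContDiff ℝ ∞ (smoothStep r ε) :=
  (Real.smoothTransition.contDiff (n := ⊤)).comp (by fun_prop)

theorem smoothStep_of_le (hε : 0 < ε) (h : x ≤ r) : smoothStep r ε x = 0 :=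
  Real.smoothTransition.zero_of_nonpos (div_nonpos_of_nonpos_of_nonneg (by linarith) hε.le)

theorem smoothStep_of_ge (hε : 0 < ε) (h : r + ε ≤ x) : smoothStep r ε x = 1 :=
  Real.smoothTransition.one_of_one_le ((one_le_div hε).2 (by linarith))

theorem smoothStep_nonneg : 0 ≤ smoothStep r ε x := Real.smoothTransition.nonneg _

theorem smoothStep_le_one : smoothStep r ε x ≤ 1 := Real.smoothTransition.le_one _

theorem deriv_smoothStep_nonneg (hε : 0 < ε) : 0 ≤ deriv (smoothStep r ε) x := by
  refine Monotone.deriv_nonneg (fun a b hab => Real.smoothTransition.monotone ?_)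
  gcongr

theorem deriv_smoothStep_of_notMem (hε : 0 < ε) (h : x ∉ Icc r (r + ε)) :
    deriv (smoothStep r ε) x = 0 := by
  rw [mem_Icc, not_and_or, not_le, not_le] at h
  rcases h with h | h
  · have : smoothStep r ε =ᶠ[𝓝 x] fun _ => 0 := by
      filter_upwards [Iio_mem_nhds h] with y hy using smoothStep_of_le hε (le_of_lt hy)
    rw [this.deriv_eq]; simp
  · have : smoothStep r ε =ᶠ[𝓝 x] fun _ => 1 := by
      filter_upwards [Ioi_mem_nhds h] with y hy using smoothStep_of_ge hε (le_of_lt hy)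
    rw [this.deriv_eq]; simp

theorem continuous_deriv_smoothStep : Continuous (deriv (smoothStep r ε)) :=
  (contDiff_smoothStep.continuous_deriv (by simp))

theorem integral_deriv_smoothStep (hε : 0 < ε) :
    ∫ x in r..r + ε, deriv (smoothStep r ε) x = 1 := by
  rw [intervalIntegral.integral_deriv_eq_sub
    (fun x _ => (contDiff_smoothStep.differentiable (by simp)).differentiableAt)
    (continuous_deriv_smoothStep.intervalIntegrable _ _), smoothStep_of_ge hε le_rfl,
    smoothStep_of_le hε le_rfl, sub_zero]

theorem tendsto_smoothStep (x : ℝ) :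
    Tendsto (fun ε => smoothStep r ε x) (𝓝[>] 0) (𝓝 ((Ioi r).indicator 1 x)) := by
  refine tendsto_const_nhds.congr' ?_
  by_cases h : r < x
  · filter_upwards [Ioo_mem_nhdsGT (sub_pos.2 h)] with ε hε
    rw [indicator_of_mem (mem_Ioi.2 h), smoothStep_of_ge hε.1 (by linarith [hε.2]), Pi.one_apply]
  · filter_upwards [self_mem_nhdsWithin] with ε hε
    rw [indicator_of_notMem (by simpa using h), smoothStep_of_le hε (not_lt.1 h)]

theorem setIntegral_deriv_smoothStep {E : Type*} [NormedAddCommGroup E] [NormedSpace ℝ E]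
    {s τ : ℝ} {D : ℝ → E} (hε : 0 < ε) (hr : s < r) (hr' : r + ε < τ) :
    ∫ x in Ioo s τ, deriv (smoothStep r ε) x • D x
      = ∫ x in r..r + ε, deriv (smoothStep r ε) x • D x := by
  rw [intervalIntegral.integral_of_le (by linarith), ← integral_Icc_eq_integral_Ioc]
  refine setIntegral_eq_of_subset_of_forall_sdiff_eq_zero measurableSet_Ioo
    (Icc_subset_Ioo hr hr') fun x hx => ?_
  rw [deriv_smoothStep_of_notMem hε hx.2, zero_smul]

/-- The derivatives of the steps are nonnegative, have integral `1` and live on `[r, r + ε]`: an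
approximate identity at `r`. -/
theorem tendsto_setIntegral_deriv_smoothStep {E : Type*} [NormedAddCommGroup E] [NormedSpace ℝ E]
    [CompleteSpace E] {s τ : ℝ} {D : ℝ → E} (hD : ContinuousOn D (Ioo s τ)) (hr : r ∈ Ioo s τ) :
    Tendsto (fun ε => ∫ x in Ioo s τ, deriv (smoothStep r ε) x • D x) (𝓝[>] 0) (𝓝 (D r)) := by
  rw [Metric.tendsto_nhds]
  intro η hη
  have h1 : ∀ᶠ x in 𝓝 r, ‖D x - D r‖ < η / 2 := by
    have := Metric.tendsto_nhds.1 (hD.continuousAt (Ioo_mem_nhds hr.1 hr.2)) (η / 2) (by linarith)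
    simpa [dist_eq_norm] using this
  obtain ⟨δ, hδ, h2⟩ := Metric.eventually_nhds_iff.1 h1
  filter_upwards [Ioo_mem_nhdsGT (lt_min hδ (sub_pos.2 hr.2))] with ε hε
  have hε1 := hε.2.trans_le (min_le_left _ _)
  have hε2 := hε.2.trans_le (min_le_right _ _)
  have hrε : r ≤ r + ε := by linarith [hε.1]
  rw [setIntegral_deriv_smoothStep hε.1 hr.1 (by linarith), dist_eq_norm]
  have h3 : ∫ x in r..r + ε, deriv (smoothStep r ε) x • D r = D r := by
    rw [intervalIntegral.integral_smul_const, integral_deriv_smoothStep hε.1, one_smul]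
  have hc : ContinuousOn D (uIcc r (r + ε)) := by
    rw [uIcc_of_le hrε]
    exact hD.mono (Icc_subset_Ioo hr.1 (by linarith))
  have h4 : (∫ x in r..r + ε, deriv (smoothStep r ε) x • D x) - D r
      = ∫ x in r..r + ε, deriv (smoothStep r ε) x • (D x - D r) := by
    conv_lhs => rw [← h3]
    rw [← intervalIntegral.integral_sub]
    · simp only [smul_sub]
    · exact (continuous_deriv_smoothStep.continuousOn.smul hc).intervalIntegrable
    · exact (continuous_deriv_smoothStep.continuousOn.smul continuousOn_const).intervalIntegrable
  rw [h4]
  have h5 : ‖∫ x in r..r + ε, deriv (smoothStep r ε) x • (D x - D r)‖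
      ≤ ∫ x in r..r + ε, deriv (smoothStep r ε) x * (η / 2) := by
    refine intervalIntegral.norm_integral_le_of_norm_le hrε (Eventually.of_forall fun x hx => ?_)
      ((continuous_deriv_smoothStep.mul continuous_const).intervalIntegrable _ _)
    rw [norm_smul, Real.norm_of_nonneg (deriv_smoothStep_nonneg hε.1)]
    refine mul_le_mul_of_nonneg_left (h2 ?_).le (deriv_smoothStep_nonneg hε.1)
    rw [Real.dist_eq, abs_of_pos (by linarith [hx.1])]
    linarith [hx.2]
  rw [intervalIntegral.integral_mul_const, integral_deriv_smoothStep hε.1, one_mul] at h5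
  linarith

end smoothStep

/-- A continuous curve in a Banach space with an integrable weak derivative is the integral of that
derivative. -/
theorem sub_eq_integral_of_weak_deriv {E : Type*} [NormedAddCommGroup E] [NormedSpace ℝ E]
    [CompleteSpace E] {s τ : ℝ} {D D' : ℝ → E} (hD : ContinuousOn D (Ioo s τ))
    (hDi : IntegrableOn D (Ioo s τ)) (hD' : IntegrableOn D' (Ioo s τ))
    (hw : ∀ φ : ℝ → ℝ, ContDiff ℝ ∞ φ → HasCompactSupport φ → tsupport φ ⊆ Ioo s τ →
      ∫ t in Ioo s τ, deriv φ t • D t = -∫ t in Ioo s τ, φ t • D' t)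
    {r t : ℝ} (hr : s < r) (hrt : r ≤ t) (ht : t < τ) : D t - D r = ∫ u in r..t, D' u := by
  -- The test function is a step up at `r` minus a step up at `t`, a smooth version of the indicator
  -- of `(r, t]`. On one side its derivative picks out `D r - D t`, on the other side the limit is
  -- `-∫ D'` over `(r, t]`.
  have h1 := (tendsto_setIntegral_deriv_smoothStep hD ⟨hr, hrt.trans_lt ht⟩).sub
    (tendsto_setIntegral_deriv_smoothStep hD ⟨hr.trans_le hrt, ht⟩)
  have h2 : Tendsto (fun ε => -∫ x in Ioo s τ, (smoothStep r ε x - smoothStep t ε x) • D' x)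
      (𝓝[>] 0) (𝓝 (-∫ u in r..t, D' u)) := by
    refine Tendsto.neg ?_
    have h3 : ∫ u in r..t, D' u
        = ∫ x in Ioo s τ, ((Ioi r).indicator 1 x - (Ioi t).indicator 1 x : ℝ) • D' x := by
      rw [intervalIntegral.integral_of_le hrt]
      have : (fun x => ((Ioi r).indicator 1 x - (Ioi t).indicator 1 x : ℝ) • D' x)
          = (Ioc r t).indicator D' := by
        ext x
        by_cases h1 : r < x
        · by_cases h2 : t < x
          · simp [h1, h2]
          · simp [h1, h2, not_lt.1 h2]
        · have h2 : ¬ t < x := fun h => h1 (hrt.trans_lt h)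
          simp [h1, h2]
      have hsub : Ioc r t ⊆ Ioo s τ := fun x hx => ⟨hr.trans hx.1, hx.2.trans_lt ht⟩
      rw [this, setIntegral_indicator measurableSet_Ioc, inter_eq_right.2 hsub]
    rw [h3]
    refine tendsto_integral_filter_of_dominated_convergence (fun x => ‖D' x‖) ?_ ?_ hD'.norm ?_
    · refine Eventually.of_forall fun ε => ?_
      exact ((contDiff_smoothStep.continuous.sub
        contDiff_smoothStep.continuous).aestronglyMeasurable).smul hD'.1
    · refine Eventually.of_forall fun ε => Eventually.of_forall fun x => ?_
      rw [norm_smul]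
      refine mul_le_of_le_one_left (norm_nonneg _) ?_
      rw [Real.norm_eq_abs, abs_le]
      constructor <;> linarith [smoothStep_nonneg (r := r) (ε := ε) (x := x),
        smoothStep_nonneg (r := t) (ε := ε) (x := x),
        smoothStep_le_one (r := r) (ε := ε) (x := x), smoothStep_le_one (r := t) (ε := ε) (x := x)]
    · exact Eventually.of_forall fun x =>
        ((tendsto_smoothStep x).sub (tendsto_smoothStep x)).smul_const _
  have h3 := tendsto_nhds_unique_of_eventuallyEq h1 h2 ?_
  · rw [← neg_sub, h3, neg_neg]
  filter_upwards [Ioo_mem_nhdsGT (sub_pos.2 ht)] with ε hε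
  have hs : ∀ x, x ∉ Icc r (t + ε) → smoothStep r ε x - smoothStep t ε x = 0 := by
    intro x hx
    rw [mem_Icc, not_and_or, not_le, not_le] at hx
    rcases hx with h | h
    · rw [smoothStep_of_le hε.1 h.le, smoothStep_of_le hε.1 (by linarith), sub_zero]
    · rw [smoothStep_of_ge hε.1 h.le, smoothStep_of_ge hε.1 (by linarith), sub_self]
  rw [← hw (fun x => smoothStep r ε x - smoothStep t ε x)
    (contDiff_smoothStep.sub contDiff_smoothStep) (HasCompactSupport.intro isCompact_Icc hs)]
  · rw [← integral_sub]
    · refine integral_congr_ae (Eventually.of_forall fun x => ?_)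
      have hd : deriv (fun x => smoothStep r ε x - smoothStep t ε x) x
          = deriv (smoothStep r ε) x - deriv (smoothStep t ε) x :=
        deriv_fun_sub (contDiff_smoothStep.differentiable (by simp)).differentiableAt
          (contDiff_smoothStep.differentiable (by simp)).differentiableAt
      simp only [hd, sub_smul]
    · exact hDi.continuousOn_smul_of_subset continuous_deriv_smoothStep.continuousOn isCompact_Icc
        measurableSet_Ioo Ioo_subset_Icc_self
    · exact hDi.continuousOn_smul_of_subset continuous_deriv_smoothStep.continuousOn isCompact_Icc
        measurableSet_Ioo Ioo_subset_Icc_self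
  · refine (closure_minimal (fun x hx => ?_) isClosed_Icc).trans
      (Icc_subset_Ioo hr (by linarith [hε.2] : t + ε < τ))
    by_contra hx'
    exact hx (hs x hx')

/-! ### Weak convergence and measurability in Hilbert spaces -/

section Weak

variable {F H : Type*} [NormedAddCommGroup F] [InnerProductSpace ℝ F] [CompleteSpace F]
  [NormedAddCommGroup H] [InnerProductSpace ℝ H] [CompleteSpace H]

/-- Bounded sequences in a Hilbert space converge weakly along a given ultrafilter. -/
theorem exists_weak_limit {u : ℕ → F} {R : ℝ} (hu : ∀ n, ‖u n‖ ≤ R) :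
    ∃ v, ‖v‖ ≤ R ∧ ∀ w, Tendsto (fun n => ⟪u n, w⟫) (hyperfilter ℕ) (𝓝 ⟪v, w⟫) := by
  let U : ℕ → WeakDual ℝ F := fun n =>
    StrongDual.toWeakDual (InnerProductSpace.toDual ℝ F (u n))
  have hc := WeakDual.isCompact_closedBall (0 : StrongDual ℝ F) R
  have hU : ∀ n, U n ∈ WeakDual.toStrongDual ⁻¹' Metric.closedBall (0 : StrongDual ℝ F) R := by
    intro n
    simpa [U] using hu n
  -- Banach–Alaoglu in the dual, transported by the Riesz isomorphism. Convergence along an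
  -- ultrafilter replaces the extraction of a subsequence.
  obtain ⟨φ, hφ, h1⟩ := hc.ultrafilter_le_nhds ((hyperfilter ℕ).map U)
    (le_principal_iff.2 (Ultrafilter.mem_coe.2 (Ultrafilter.mem_map.2
      (Eventually.of_forall hU : ∀ᶠ n in (hyperfilter ℕ : Filter ℕ), _))))
  refine ⟨(InnerProductSpace.toDual ℝ F).symm (WeakDual.toStrongDual φ), ?_, fun w => ?_⟩
  · simpa using hφ
  · have h2 : Tendsto (fun ψ : WeakDual ℝ F => ψ w) (𝓝 φ) (𝓝 (φ w)) :=
      (WeakDual.eval_continuous w).tendsto φ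
    have h3 : Tendsto U (hyperfilter ℕ) (𝓝 φ) := h1
    rw [InnerProductSpace.toDual_symm_apply]
    exact h2.comp h3

variable {ι : F →L[ℝ] H}

/-- The orthogonal complement of the range of the adjoint is the kernel of `ι`. Weak convergence and
measurability in `F` can therefore be tested on vectors `ι* h`, that is, in `H`. -/
theorem denseRange_adjoint (hι : Function.Injective ι) :
    DenseRange (ContinuousLinearMap.adjoint ι) := by
  have h : (ContinuousLinearMap.adjoint ι).rangeᗮ = ⊥ := by
    rw [ContinuousLinearMap.orthogonal_range, ContinuousLinearMap.adjoint_adjoint]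
    exact LinearMap.ker_eq_bot.2 hι
  have := (Submodule.topologicalClosure_eq_top_iff).2 h
  intro x
  have hx : x ∈ ((ContinuousLinearMap.adjoint ι).range).topologicalClosure := by rw [this]; trivial
  exact hx

/-- Balls of `F` are closed in `H`. -/
theorem exists_of_tendsto_of_norm_le {u : ℕ → F} {R : ℝ} {h : H} (hu : ∀ n, ‖u n‖ ≤ R)
    (hh : Tendsto (fun n => ι (u n)) atTop (𝓝 h)) : ∃ v, ι v = h ∧ ‖v‖ ≤ R := by
  obtain ⟨v, hv, h1⟩ := exists_weak_limit hu
  refine ⟨v, ext_inner_right ℝ fun w => ?_, hv⟩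
  have h2 := h1 (ContinuousLinearMap.adjoint ι w)
  simp only [ContinuousLinearMap.adjoint_inner_right] at h2
  exact tendsto_nhds_unique h2 ((hh.inner tendsto_const_nhds).mono_left Nat.hyperfilter_le_atTop)

/-- A bounded family in `F` that converges in `H` to an element of `F` converges weakly in `F`. -/
theorem tendsto_apply_of_norm_le {α : Type*} {l : Filter α} {u : α → F} {v : F} {R : ℝ}
    (hι : Function.Injective ι) (hu : ∀ᶠ i in l, ‖u i‖ ≤ R)
    (hh : Tendsto (fun i => ι (u i)) l (𝓝 (ι v))) (φ : StrongDual ℝ F) :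
    Tendsto (fun i => φ (u i)) l (𝓝 (φ v)) := by
  obtain ⟨w, rfl⟩ := (InnerProductSpace.toDual ℝ F).surjective φ
  simp only [InnerProductSpace.toDual_apply_apply]
  rw [Metric.tendsto_nhds]
  intro ε hε
  -- Split `w` into `ι* w'`, whose pairing converges by convergence in `H`, and a remainder small
  -- enough to absorb the norm bound.
  obtain ⟨w', hw'⟩ := (denseRange_adjoint hι).exists_dist_lt w
    (show 0 < ε / 2 / (|R| + ‖v‖ + 1) by positivity)
  have h1 : Tendsto (fun i => ⟪ContinuousLinearMap.adjoint ι w', u i⟫) l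
      (𝓝 ⟪ContinuousLinearMap.adjoint ι w', v⟫) := by
    simp only [ContinuousLinearMap.adjoint_inner_left]
    exact tendsto_const_nhds.inner hh
  filter_upwards [hu, Metric.tendsto_nhds.1 h1 (ε / 2) (by positivity)] with i hi h2
  rw [Real.dist_eq] at h2 ⊢
  have h3 : ⟪w, u i⟫ - ⟪w, v⟫ = ⟪w - ContinuousLinearMap.adjoint ι w', u i - v⟫
      + (⟪ContinuousLinearMap.adjoint ι w', u i⟫ - ⟪ContinuousLinearMap.adjoint ι w', v⟫) := by
    simp only [inner_sub_left, inner_sub_right]; ring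
  have h4 : |⟪w - ContinuousLinearMap.adjoint ι w', u i - v⟫| ≤ ε / 2 := by
    refine (abs_real_inner_le_norm _ _).trans ?_
    rw [dist_eq_norm] at hw'
    have h5 : ‖u i - v‖ ≤ |R| + ‖v‖ + 1 := by
      linarith [norm_sub_le (u i) v, le_abs_self R]
    calc _ ≤ ε / 2 / (|R| + ‖v‖ + 1) * (|R| + ‖v‖ + 1) := by gcongr
      _ = ε / 2 := by field_simp
  rw [h3]
  linarith [abs_add_le ⟪w - ContinuousLinearMap.adjoint ι w', u i - v⟫
    (⟪ContinuousLinearMap.adjoint ι w', u i⟫ - ⟪ContinuousLinearMap.adjoint ι w', v⟫)]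

theorem secondCountableTopology_of_injective [SecondCountableTopology H]
    (hι : Function.Injective ι) : SecondCountableTopology F := by
  have : TopologicalSpace.SeparableSpace F :=
    (denseRange_adjoint hι).separableSpace (ContinuousLinearMap.adjoint ι).continuous
  exact UniformSpace.secondCountable_of_separable F

variable {α : Type*} [MeasurableSpace α] {μ : Measure α} [SecondCountableTopology F]

/-- Weakly measurable functions with values in a separable Hilbert space are strongly measurable. -/
theorem aestronglyMeasurable_of_inner {y : α → F}
    (hy : ∀ v, AEMeasurable (fun t => ⟪y t, v⟫) μ) : AEStronglyMeasurable y μ := by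
  borelize F
  let e := TopologicalSpace.denseSeq F
  let Φ : F → ℕ → ℝ := fun v n => ⟪v, e n⟫
  have hc : Continuous Φ := continuous_pi fun n => by fun_prop
  have hi : Function.Injective Φ := by
    intro v w hvw
    refine ext_inner_right ℝ fun z => ?_
    have h1 : Continuous fun z => ⟪v, z⟫ := by fun_prop
    have h2 : Continuous fun z => ⟪w, z⟫ := by fun_prop
    exact congrFun ((TopologicalSpace.denseRange_denseSeq F).equalizer h1 h2
      (funext fun n => congrFun hvw n)) z
  -- Lusin–Souslin: `F` is Polish, and pairing with a dense sequence is a continuous injection into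
  -- a space of sequences.
  have hm : MeasurableEmbedding Φ := hc.measurableEmbedding hi
  exact (hm.aemeasurable_comp_iff.1 (aemeasurable_pi_lambda _ fun n => hy (e n))).aestronglyMeasurable

theorem aestronglyMeasurable_dual_of_apply {y : α → StrongDual ℝ F}
    (hy : ∀ v, AEMeasurable (fun t => y t v) μ) : AEStronglyMeasurable y μ := by
  have h1 : AEStronglyMeasurable (fun t => (InnerProductSpace.toDual ℝ F).symm (y t)) μ :=
    aestronglyMeasurable_of_inner fun v => by
      simpa only [InnerProductSpace.toDual_symm_apply] using hy v
  simpa using (InnerProductSpace.toDual ℝ F).continuous.comp_aestronglyMeasurable h1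

theorem aestronglyMeasurable_of_comp (hι : Function.Injective ι) {y : α → F}
    (hy : ∀ h, AEMeasurable (fun t => ⟪ι (y t), h⟫) μ) : AEStronglyMeasurable y μ := by
  refine aestronglyMeasurable_of_inner fun v => ?_
  obtain ⟨w, hw⟩ := mem_closure_iff_seq_limit.1 ((denseRange_adjoint hι) v)
  choose z hz using hw.1
  refine aemeasurable_of_tendsto_metrizable_ae atTop
    (f := fun n t => ⟪y t, w n⟫) (fun n => ?_) (Eventually.of_forall fun t =>
      tendsto_const_nhds.inner hw.2)
  simp only [← hz n, ContinuousLinearMap.adjoint_inner_right]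
  exact hy (z n)

end Weak

/-! ### Nonautonomous symmetric forms -/

/-- A family of symmetric forms `a t` on `F` and of scalar products `b t` on `H`, indexed by
`t ∈ (0, T)` and Lipschitz in time, together with operators `N t` on `F` that represent the scalar
product `b t` by the one of `H`. -/
structure FormFlow (F H : Type*) [NormedAddCommGroup F] [InnerProductSpace ℝ F]
    [NormedAddCommGroup H] [InnerProductSpace ℝ H] (T L : ℝ) where
  /-- the embedding -/
  ι : F →L[ℝ] H
  ι_inj : Function.Injective ι
  /-- the energy forms -/
  a : ℝ → F →L[ℝ] F →L[ℝ] ℝ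
  /-- the scalar products -/
  b : ℝ → H →L[ℝ] H →L[ℝ] ℝ
  /-- the representing operators -/
  N : ℝ → F →L[ℝ] F
  /-- their inverses -/
  N' : ℝ → F →L[ℝ] F
  /-- the coercivity constant -/
  c : ℝ
  /-- the bound for all norms -/
  K : ℝ
  c_pos : 0 < c
  K_nonneg : 0 ≤ K
  L_nonneg : 0 ≤ L
  a_symm : ∀ t ∈ Ioo 0 T, ∀ u v, a t u v = a t v u
  a_nonneg : ∀ t ∈ Ioo 0 T, ∀ u, 0 ≤ a t u u
  a_coercive : ∀ t ∈ Ioo 0 T, ∀ u, c * ‖u‖ ^ 2 ≤ a t u u + ‖ι u‖ ^ 2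
  norm_a_le : ∀ t ∈ Ioo 0 T, ‖a t‖ ≤ K
  norm_a_sub_le : ∀ t ∈ Ioo 0 T, ∀ r ∈ Ioo 0 T, ‖a t - a r‖ ≤ K * |t - r|
  b_symm : ∀ t ∈ Ioo 0 T, ∀ u v, b t u v = b t v u
  b_coercive : ∀ t ∈ Ioo 0 T, ∀ v, c * ‖v‖ ^ 2 ≤ b t v v
  norm_b_le : ∀ t ∈ Ioo 0 T, ‖b t‖ ≤ K
  norm_b_sub_le : ∀ t ∈ Ioo 0 T, ∀ r ∈ Ioo 0 T, ‖b t - b r‖ ≤ K * |t - r|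
  b_le_exp : ∀ t ∈ Ioo 0 T, ∀ r ∈ Ioo 0 T, ∀ v, b t v v ≤ Real.exp (L * |t - r|) * b r v v
  b_apply_ι : ∀ t ∈ Ioo 0 T, ∀ h w, b t h (ι w) = ⟪h, ι (N t w)⟫
  b_apply_ι' : ∀ t ∈ Ioo 0 T, ∀ h w, b t h (ι (N' t w)) = ⟪h, ι w⟫
  norm_N_le : ∀ t ∈ Ioo 0 T, ‖N t‖ ≤ K
  norm_N'_le : ∀ t ∈ Ioo 0 T, ‖N' t‖ ≤ K

namespace FormFlow

variable {F H : Type*} [NormedAddCommGroup F] [InnerProductSpace ℝ F]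
    [NormedAddCommGroup H] [InnerProductSpace ℝ H] {T L : ℝ} (E : FormFlow F H T L)

section Basic

variable {E} {t r : ℝ}

theorem abs_a_le (ht : t ∈ Ioo 0 T) (u v : F) : |E.a t u v| ≤ E.K * ‖u‖ * ‖v‖ :=
  ((E.a t).le_opNorm₂ u v).trans (by gcongr; exact E.norm_a_le t ht)

theorem abs_b_le (ht : t ∈ Ioo 0 T) (u v : H) : |E.b t u v| ≤ E.K * ‖u‖ * ‖v‖ :=
  ((E.b t).le_opNorm₂ u v).trans (by gcongr; exact E.norm_b_le t ht)

theorem abs_a_sub_le (ht : t ∈ Ioo 0 T) (hr : r ∈ Ioo 0 T) (u v : F) :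
    |E.a t u v - E.a r u v| ≤ E.K * |t - r| * ‖u‖ * ‖v‖ :=
  ((E.a t - E.a r).le_opNorm₂ u v).trans (by gcongr; exact E.norm_a_sub_le t ht r hr)

theorem abs_b_sub_le (ht : t ∈ Ioo 0 T) (hr : r ∈ Ioo 0 T) (u v : H) :
    |E.b t u v - E.b r u v| ≤ E.K * |t - r| * ‖u‖ * ‖v‖ :=
  ((E.b t - E.b r).le_opNorm₂ u v).trans (by gcongr; exact E.norm_b_sub_le t ht r hr)

theorem b_nonneg (ht : t ∈ Ioo 0 T) (v : H) : 0 ≤ E.b t v v :=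
  le_trans (by have := E.c_pos; positivity) (E.b_coercive t ht v)

theorem b_self_sub (ht : t ∈ Ioo 0 T) (u v : H) :
    E.b t u u - E.b t v v = 2 * E.b t (u - v) v + E.b t (u - v) (u - v) := by
  have := E.b_symm t ht u v
  simp only [map_sub, sub_apply]
  linarith

theorem abs_b_self_sub_le (ht : t ∈ Ioo 0 T) {u v : H} {R : ℝ} (hu : ‖u‖ ≤ R) (hv : ‖v‖ ≤ R) :
    |E.b t u u - E.b t v v| ≤ 2 * E.K * R * ‖u - v‖ := by
  have h1 : E.b t u u - E.b t v v = E.b t (u - v) u + E.b t v (u - v) := by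
    simp only [map_sub, sub_apply]; ring
  have hK := E.K_nonneg
  have hR : 0 ≤ R := (norm_nonneg _).trans hu
  rw [h1]
  calc _ ≤ |E.b t (u - v) u| + |E.b t v (u - v)| := abs_add_le _ _
    _ ≤ E.K * ‖u - v‖ * ‖u‖ + E.K * ‖v‖ * ‖u - v‖ :=
      add_le_add (abs_b_le ht _ _) (abs_b_le ht _ _)
    _ ≤ E.K * ‖u - v‖ * R + E.K * R * ‖u - v‖ := by gcongr
    _ = _ := by ring

/-- Convexity of the energy, i.e. `0 ≤ a t (u - w) (u - w)`. The left side is the derivative of the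
squared distance to `w` along the flow. -/
theorem a_self_sub_le (ht : t ∈ Ioo 0 T) (u w : F) :
    -2 * E.a t u (u - w) ≤ E.a t w w - E.a t u u := by
  have h1 := E.a_nonneg t ht (u - w)
  have := E.a_symm t ht u w
  simp only [map_sub, sub_apply] at h1 ⊢
  linarith

theorem continuousOn_a : ContinuousOn E.a (Ioo 0 T) := by
  have : LipschitzOnWith E.K.toNNReal E.a (Ioo 0 T) :=
    LipschitzOnWith.of_dist_le_mul fun t ht r hr => by
      rw [dist_eq_norm, Real.dist_eq, Real.coe_toNNReal _ E.K_nonneg]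
      exact E.norm_a_sub_le t ht r hr
  exact this.continuousOn

theorem continuousOn_b : ContinuousOn E.b (Ioo 0 T) := by
  have : LipschitzOnWith E.K.toNNReal E.b (Ioo 0 T) :=
    LipschitzOnWith.of_dist_le_mul fun t ht r hr => by
      rw [dist_eq_norm, Real.dist_eq, Real.coe_toNNReal _ E.K_nonneg]
      exact E.norm_b_sub_le t ht r hr
  exact this.continuousOn

theorem aestronglyMeasurable_a {S : Set ℝ} (hS : MeasurableSet S) (hST : S ⊆ Ioo 0 T)
    {u v : ℝ → F} (hu : AEStronglyMeasurable u (volume.restrict S))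
    (hv : AEStronglyMeasurable v (volume.restrict S)) :
    AEStronglyMeasurable (fun t => E.a t (u t) (v t)) (volume.restrict S) := by
  have : TopologicalSpace.PseudoMetrizableSpace (F →L[ℝ] F →L[ℝ] ℝ) :=
    let i : PseudoMetricSpace (F →L[ℝ] F →L[ℝ] ℝ) := inferInstance
    @PseudoEMetricSpace.pseudoMetrizableSpace _ i.toPseudoEMetricSpace
  have h1 : AEStronglyMeasurable E.a (volume.restrict S) :=
    (continuousOn_a.mono hST).aestronglyMeasurable hS
  exact isBoundedBilinearMap_apply.continuous.comp_aestronglyMeasurable₂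
    (isBoundedBilinearMap_apply.continuous.comp_aestronglyMeasurable₂ h1 hu) hv

end Basic

/-- `x` is a strong solution of `∂_t x = A_t x` on `(s, τ)`: it is locally absolutely continuous in
`H`, and for almost every `t` its value is the element `U t` of `F` and its derivative represents
`-a t (U t)` with respect to the scalar product `b t`. -/
structure IsStrongSol (x : ℝ → H) (U : ℝ → F) (s τ : ℝ) : Prop where
  hasACDensity : ∀ p q, s < p → p ≤ q → q < τ → ∃ k, HasACDensity x k p q
  tendsto : ∀ᵐ t, t ∈ Ioo s τ → E.ι (U t) = x t ∧
    ∀ v, Tendsto (fun r => E.b t (x r - x t) (E.ι v) / (r - t)) (𝓝[≠] t) (𝓝 (-E.a t (U t) v))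

namespace IsStrongSol

variable {E} {x y : ℝ → H} {U V : ℝ → F} {s τ : ℝ}

theorem sub (hx : E.IsStrongSol x U s τ) (hy : E.IsStrongSol y V s τ) :
    E.IsStrongSol (fun t => x t - y t) (fun t => U t - V t) s τ := by
  refine ⟨fun p q hp hpq hq => ?_, ?_⟩
  · obtain ⟨k, hk⟩ := hx.hasACDensity p q hp hpq hq
    obtain ⟨l, hl⟩ := hy.hasACDensity p q hp hpq hq
    exact ⟨_, hk.sub hl⟩
  · filter_upwards [hx.tendsto, hy.tendsto] with t h1 h2 ht
    refine ⟨by rw [map_sub, (h1 ht).1, (h2 ht).1], fun v => ?_⟩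
    have h3 := ((h1 ht).2 v).sub ((h2 ht).2 v)
    rw [map_sub, sub_apply, neg_sub']
    refine h3.congr fun r => ?_
    have h4 : x r - y r - (x t - y t) = (x r - x t) - (y r - y t) := by abel
    rw [← sub_div, h4]
    simp only [map_sub, sub_apply]

theorem continuousOn (hx : E.IsStrongSol x U s τ) : ContinuousOn x (Ioo s τ) := by
  intro t ht
  obtain ⟨p, hp⟩ := exists_between ht.1
  obtain ⟨q, hq⟩ := exists_between ht.2
  obtain ⟨k, hk⟩ := hx.hasACDensity p q hp.1 (hp.2.trans hq.1).le hq.2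
  exact ((hk.continuousOn (hp.2.trans hq.1).le).continuousAt
    (Icc_mem_nhds hp.2 hq.1)).continuousWithinAt

variable [CompleteSpace F] [CompleteSpace H] [SecondCountableTopology F]

/-- No measurability of `U` is assumed in the definition; it is inherited from the continuous curve
`x`, which equals `ι U` almost everywhere. -/
theorem aestronglyMeasurable (hx : E.IsStrongSol x U s τ) :
    AEStronglyMeasurable U (volume.restrict (Ioo s τ)) := by
  refine aestronglyMeasurable_of_comp E.ι_inj fun h => ?_
  have h1 : AEMeasurable (fun t => ⟪x t, h⟫) (volume.restrict (Ioo s τ)) :=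
    (hx.continuousOn.inner continuousOn_const).aemeasurable measurableSet_Ioo
  refine h1.congr ((ae_restrict_iff' measurableSet_Ioo).2 ?_)
  filter_upwards [hx.tendsto] with t ht hts
  rw [(ht hts).1]

/-- The energy inequality for the distance to a fixed element of `F`. -/
theorem energy_le (hx : E.IsStrongSol x U s τ) (hs : 0 ≤ s) (hτ : τ ≤ T) (w : F) {p q : ℝ}
    (hp : s < p) (hpq : p ≤ q) (hq : q < τ) :
    IntervalIntegrable (fun t => Real.exp (-(L * t)) * E.a t (U t) (U t)) volume p q ∧
    Real.exp (-(L * q)) * E.b q (x q - E.ι w) (x q - E.ι w)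
        + ∫ t in p..q, Real.exp (-(L * t)) * E.a t (U t) (U t)
      ≤ Real.exp (-(L * p)) * E.b p (x p - E.ι w) (x p - E.ι w) + E.K * ‖w‖ ^ 2 * (q - p) := by
  obtain ⟨k, hk⟩ := hx.hasACDensity p q hp hpq hq
  have hI : ∀ t ∈ Icc p q, t ∈ Ioo 0 T := fun t ht =>
    ⟨by linarith [ht.1], by linarith [ht.2]⟩
  have hL := E.L_nonneg
  have hK := E.K_nonneg
  set z := E.ι w with hz
  obtain ⟨R, hR : ∀ t ∈ Icc p q, ‖x t - z‖ ≤ R⟩ := isCompact_Icc.exists_bound_of_continuousOn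
    ((hk.continuousOn hpq).sub continuousOn_const : ContinuousOn (fun t => x t - z) (Icc p q))
  have hR0 : 0 ≤ R := (norm_nonneg _).trans (hR p ⟨le_rfl, hpq⟩)
  set g : ℝ → ℝ := fun t => Real.exp (-(L * t)) * E.b t (x t - z) (x t - z) with hg
  have hexp : ∀ t ∈ Icc p q, Real.exp (-(L * t)) ≤ 1 := fun t ht =>
    Real.exp_le_one_iff.2 (by have := (hI t ht).1; simp only [Left.neg_nonpos_iff]; positivity)
  -- The increment of `g` has three sources: the exponential factor, the form `b`, and the point
  -- `x`. The first two are Lipschitz in time, the third is governed by `k`.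
  have hac : HasACDensity g (fun t => (2 * E.K * R) * k t + (L * E.K * R ^ 2 + E.K * R ^ 2)) p q := by
    refine hk.of_norm_sub_le (by positivity) fun t r ht htr hr => ?_
    have ht' : t ∈ Icc p q := ⟨ht, htr.trans hr⟩
    have hr' : r ∈ Icc p q := ⟨ht.trans htr, hr⟩
    have e1 : Real.exp (-(L * t)) - Real.exp (-(L * r)) ≤ L * (r - t) := by
      have h1 : Real.exp (-(L * r)) = Real.exp (-(L * t)) * Real.exp (-(L * (r - t))) := by
        rw [← Real.exp_add]; ring_nf
      have h2 := Real.add_one_le_exp (-(L * (r - t)))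
      have h3 := hexp t ht'
      have h4 : 0 ≤ L * (r - t) := mul_nonneg hL (by linarith)
      have h5 := Real.exp_pos (-(L * t))
      rw [h1]
      nlinarith
    have e2 : Real.exp (-(L * r)) ≤ Real.exp (-(L * t)) := by
      apply Real.exp_le_exp.2; nlinarith
    have e3 : E.b r (x r - z) (x r - z) ≤ E.K * R ^ 2 := by
      refine (le_abs_self _).trans ((abs_b_le (hI r hr') _ _).trans ?_)
      rw [mul_assoc, sq]
      have := hR r hr'
      gcongr
    have e4 := abs_b_sub_le (E := E) (hI r hr') (hI t ht') (x r - z) (x r - z)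
    have e5 := abs_b_self_sub_le (E := E) (hI t ht') (hR r hr') (hR t ht')
    have e6 : g r - g t
        = -((Real.exp (-(L * t)) - Real.exp (-(L * r))) * E.b r (x r - z) (x r - z))
        + Real.exp (-(L * t)) * (E.b r (x r - z) (x r - z) - E.b t (x r - z) (x r - z))
        + Real.exp (-(L * t)) * (E.b t (x r - z) (x r - z) - E.b t (x t - z) (x t - z)) := by
      simp only [hg]; ring
    have e7 : x r - z - (x t - z) = x r - x t := by abel
    rw [e7] at e5
    rw [abs_of_nonneg (by linarith : 0 ≤ r - t)] at e4
    have e8 : E.K * (r - t) * ‖x r - z‖ * ‖x r - z‖ ≤ E.K * R ^ 2 * (r - t) := by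
      have := hR r hr'
      have h0 : 0 ≤ r - t := by linarith
      calc _ ≤ E.K * (r - t) * R * R := by gcongr
        _ = _ := by ring
    rw [e6]
    refine (norm_add_le _ _).trans ((add_le_add (norm_add_le _ _) le_rfl).trans ?_)
    rw [norm_neg, norm_mul, norm_mul, norm_mul, Real.norm_of_nonneg (sub_nonneg.2 e2),
      Real.norm_of_nonneg (b_nonneg (hI r hr') _), Real.norm_of_nonneg (Real.exp_pos _).le,
      Real.norm_eq_abs, Real.norm_eq_abs]
    have f1 : (Real.exp (-(L * t)) - Real.exp (-(L * r))) * E.b r (x r - z) (x r - z)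
        ≤ L * (r - t) * (E.K * R ^ 2) :=
      mul_le_mul e1 e3 (b_nonneg (hI r hr') _) (mul_nonneg hL (by linarith))
    have f2 := mul_le_mul (hexp t ht') (e4.trans e8) (abs_nonneg _) zero_le_one
    have f3 := mul_le_mul (hexp t ht') e5 (abs_nonneg _) zero_le_one
    linarith
  have hmeas : AEStronglyMeasurable (fun t => Real.exp (-(L * t)) * E.a t (U t) (U t))
      (volume.restrict (Ioc p q)) := by
    have hsub : Ioc p q ⊆ Ioo s τ := fun t ht => ⟨hp.trans ht.1, ht.2.trans_lt hq⟩
    have hU := hx.aestronglyMeasurable.mono_measure (Measure.restrict_mono hsub le_rfl)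
    refine AEStronglyMeasurable.mul (Continuous.aestronglyMeasurable (by fun_prop)) ?_
    exact aestronglyMeasurable_a measurableSet_Ioc (fun t ht => hI t (Ioc_subset_Icc_self ht)) hU hU
  refine hac.integrable_and_add_integral_le hpq hmeas ?_ ?_
  · exact Eventually.of_forall fun t ht =>
      mul_nonneg (Real.exp_pos _).le (E.a_nonneg t (hI t (Ioc_subset_Icc_self ht)) _)
  · filter_upwards [hx.tendsto, hk.ae_norm_sub_le hpq] with t h1 h2 ht ε hε
    obtain ⟨hU, h1⟩ := h1 ⟨hp.trans ht.1, ht.2.trans hq⟩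
    have htI := hI t (Ioo_subset_Icc_self ht)
    have h3 := (h2 ht 1 one_pos).filter_mono (nhdsWithin_le_nhds (s := Ioi t))
    -- The distance is differentiated in the direction `x t - ι w = ι (U t - w)`, which is an
    -- admissible test vector because `w` lies in `F`.
    have h4 := (h1 (U t - w)).mono_left
      (nhdsWithin_mono t (fun r (hr : t < r) => hr.ne') : 𝓝[>] t ≤ 𝓝[≠] t)
    have hlim : Tendsto (fun r => E.K * (k t + 1) ^ 2 * (r - t)) (𝓝[>] t) (𝓝 0) := by
      have : Tendsto (fun r => E.K * (k t + 1) ^ 2 * (r - t)) (𝓝 t)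
          (𝓝 (E.K * (k t + 1) ^ 2 * (t - t))) := by
        refine Continuous.tendsto ?_ t
        fun_prop
      rw [sub_self, mul_zero] at this
      exact this.mono_left nhdsWithin_le_nhds
    filter_upwards [h3, h4.eventually (gt_mem_nhds (lt_add_of_pos_right _ (by positivity :
      0 < ε / 4))), hlim.eventually (gt_mem_nhds (by positivity : 0 < ε / 2)),
      Ioo_mem_nhdsGT ht.2] with r h3 h4 h5 hr
    have hr0 : 0 < r - t := sub_pos.2 hr.1
    have hrI := hI r ⟨ht.1.le.trans hr.1.le, hr.2.le⟩
    rw [div_lt_iff₀ hr0] at h4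
    rw [abs_of_pos hr0] at h3
    -- The factor `exp (-L r)` exactly absorbs the growth of `b`, so the form may be frozen at time
    -- `t` when `r > t`. This is why only right derivatives are estimated.
    have g1 : g r ≤ Real.exp (-(L * t)) * E.b t (x r - z) (x r - z) := by
      have := E.b_le_exp r hrI t htI (x r - z)
      rw [abs_of_pos hr0] at this
      calc g r ≤ Real.exp (-(L * r)) * (Real.exp (L * (r - t)) * E.b t (x r - z) (x r - z)) :=
            mul_le_mul_of_nonneg_left this (Real.exp_pos _).le
        _ = _ := by rw [← mul_assoc, ← Real.exp_add]; ring_nf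
    have g2 := b_self_sub (E := E) htI (x r - z) (x t - z)
    have g2' := congrArg (E.b t (x r - x t)) (by rw [map_sub, hU, hz] : x t - z = E.ι (U t - w))
    have g3 : x r - z - (x t - z) = x r - x t := by abel
    rw [g3] at g2
    have g5 : E.b t (x r - x t) (x r - x t) ≤ E.K * (k t + 1) ^ 2 * (r - t) * (r - t) := by
      refine (le_abs_self _).trans ((abs_b_le htI _ _).trans ?_)
      calc E.K * ‖x r - x t‖ * ‖x r - x t‖
          ≤ E.K * ((k t + 1) * (r - t)) * ((k t + 1) * (r - t)) := by
            gcongr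
            exact mul_nonneg hK ((norm_nonneg _).trans h3)
        _ = _ := by ring
    have g6 : E.b t (x r - z) (x r - z) - E.b t (x t - z) (x t - z)
        ≤ (E.a t w w - E.a t (U t) (U t) + ε) * (r - t) := by
      have := a_self_sub_le (E := E) htI (U t) w
      rw [g2, g2']
      nlinarith
    have g7 : g r - g t ≤ Real.exp (-(L * t)) * (E.b t (x r - z) (x r - z)
        - E.b t (x t - z) (x t - z)) := by
      simp only [hg] at g1 ⊢
      linarith
    refine g7.trans ((mul_le_mul_of_nonneg_left g6 (Real.exp_pos _).le).trans ?_)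
    rw [← mul_assoc]
    refine mul_le_mul_of_nonneg_right ?_ hr0.le
    have g8 := hexp t (Ioo_subset_Icc_self ht)
    have g9 : E.a t w w ≤ E.K * ‖w‖ ^ 2 := by
      refine (le_abs_self _).trans ((abs_a_le htI _ _).trans_eq (by ring))
    have g10 : 0 ≤ E.K * ‖w‖ ^ 2 := by positivity
    have g11 := Real.exp_pos (-(L * t))
    nlinarith

end IsStrongSol
end FormFlow

/-! ### Weak solutions, and strong solutions as weak solutions up to the end points. -/

theorem exists_Icc_subset_of_isCompact {A : Set ℝ} {s τ : ℝ} (hsτ : s < τ) (hA : IsCompact A)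
    (h : A ⊆ Ioo s τ) : ∃ p q, s < p ∧ p < q ∧ q < τ ∧ A ⊆ Ioo p q := by
  obtain ⟨l, hl⟩ := exists_between hsτ
  -- The extra point `l` keeps the set nonempty, so that it has extremal points even if `A` is
  -- empty.
  have hB : IsCompact (insert l A) := hA.insert l
  have hBs : insert l A ⊆ Ioo s τ := insert_subset hl h
  obtain ⟨p, hp, hp'⟩ := hB.exists_isLeast (insert_nonempty _ _)
  obtain ⟨q, hq, hq'⟩ := hB.exists_isGreatest (insert_nonempty _ _)
  obtain ⟨p', hp1⟩ := exists_between (hBs hp).1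
  obtain ⟨q', hq1⟩ := exists_between (hBs hq).2
  have hpq : p ≤ q := hp' hq
  exact ⟨p', q', hp1.1, by linarith [hp1.2, hq1.1], hq1.2, fun t ht =>
    ⟨hp1.2.trans_le (hp' (mem_insert_of_mem _ ht)), (hq' (mem_insert_of_mem _ ht)).trans_lt hq1.1⟩⟩

namespace FormFlow

variable {F H : Type*} [NormedAddCommGroup F] [InnerProductSpace ℝ F]
    [NormedAddCommGroup H] [InnerProductSpace ℝ H] {T L : ℝ} (E : FormFlow F H T L)

/-- The embedding `H → F*`. -/
def toDual : H →L[ℝ] StrongDual ℝ F :=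
  ((ContinuousLinearMap.compL ℝ F H ℝ).flip E.ι).comp (innerSL ℝ (E := H))

theorem toDual_apply (h : H) (v : F) : E.toDual h v = ⟪h, E.ι v⟫ := rfl

/-- Weak solutions of the evolution equation on `(s, τ)`. -/
structure IsWeakSol (x : ℝ → H) (U : ℝ → F) (U' : ℝ → StrongDual ℝ F) (s τ : ℝ) : Prop where
  continuousOn : ContinuousOn x (Icc s τ)
  memLp : MemLp U 2 (volume.restrict (Ioo s τ))
  memLp_deriv : MemLp U' 2 (volume.restrict (Ioo s τ))
  weak_deriv : ∀ φ : ℝ → ℝ, ContDiff ℝ ∞ φ → HasCompactSupport φ → tsupport φ ⊆ Ioo s τ →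
    ∫ t in Ioo s τ, deriv φ t • E.toDual (E.ι (U t)) = -∫ t in Ioo s τ, φ t • U' t
  ae_eq : ∀ᵐ t, t ∈ Ioo s τ → E.ι (U t) = x t
  apply_N : ∀ᵐ t, t ∈ Ioo s τ → ∀ v, U' t (E.N t v) = -E.a t (U t) v

namespace IsStrongSol

variable {E} {x y : ℝ → H} {U V : ℝ → F} {s τ : ℝ}

/-- Strong solutions are differentiable in the dual of `F`. -/
theorem ae_hasDerivAt (hx : E.IsStrongSol x U s τ) (hs : 0 ≤ s) (hτ : τ ≤ T) :
    ∀ᵐ t, t ∈ Ioo s τ → ∀ v,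
      HasDerivAt (fun r => ⟪x r, E.ι v⟫) (-E.a t (U t) (E.N' t v)) t := by
  filter_upwards [hx.tendsto] with t ht hts v
  have htI : t ∈ Ioo 0 T := ⟨hs.trans_lt hts.1, hts.2.trans_le hτ⟩
  rw [hasDerivAt_iff_tendsto_slope]
  refine ((ht hts).2 (E.N' t v)).congr fun r => ?_
  rw [E.b_apply_ι' t htI, slope_def_field, inner_sub_left]

variable [CompleteSpace F] [CompleteSpace H] [SecondCountableTopology F]

/-- The energy inequality for `w = 0`, without the nonnegative energy term. Boundedness, uniqueness
and the growth estimate all rest on it. -/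
theorem b_self_le_exp_mul (hx : E.IsStrongSol x U s τ) (hs : 0 ≤ s) (hτ : τ ≤ T) {p q : ℝ}
    (hp : s < p) (hpq : p ≤ q) (hq : q < τ) :
    E.b q (x q) (x q) ≤ Real.exp (L * (q - p)) * E.b p (x p) (x p) := by
  have h1 := (hx.energy_le hs hτ 0 hp hpq hq).2
  have h2 : 0 ≤ ∫ t in p..q, Real.exp (-(L * t)) * E.a t (U t) (U t) :=
    intervalIntegral.integral_nonneg hpq fun t ht => mul_nonneg (Real.exp_pos _).le
      (E.a_nonneg t ⟨by linarith [ht.1], by linarith [ht.2]⟩ _)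
  simp only [map_zero, sub_zero, norm_zero] at h1
  have h3 : Real.exp (-(L * q)) * E.b q (x q) (x q) ≤ Real.exp (-(L * p)) * E.b p (x p) (x p) := by
    linarith
  have h4 := mul_le_mul_of_nonneg_left h3 (Real.exp_pos (L * q)).le
  rw [← mul_assoc, ← mul_assoc, ← Real.exp_add, ← Real.exp_add] at h4
  rw [← sub_eq_add_neg, ← sub_eq_add_neg, sub_self, Real.exp_zero, one_mul, ← mul_sub] at h4
  exact h4

theorem exists_norm_le (hx : E.IsStrongSol x U s τ) (hs : 0 ≤ s) (hτ : τ ≤ T) {h : H}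
    (hh : Tendsto x (𝓝[>] s) (𝓝 h)) : ∃ R, ∀ t ∈ Ioo s τ, ‖x t‖ ≤ R := by
  have hc := E.c_pos
  have hK := E.K_nonneg
  refine ⟨Real.sqrt (Real.exp (L * (τ - s)) * (E.K * (‖h‖ + 1) ^ 2) / E.c), fun t ht => ?_⟩
  have h1 := hh.norm.eventually (gt_mem_nhds (lt_add_one ‖h‖))
  obtain ⟨p, hp1, hp2⟩ := (h1.and (Ioo_mem_nhdsGT ht.1)).exists
  have hpI : p ∈ Ioo 0 T := ⟨hs.trans_lt hp2.1, by linarith [hp2.2, ht.2]⟩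
  have htI : t ∈ Ioo 0 T := ⟨hs.trans_lt ht.1, by linarith [ht.2]⟩
  have h2 := hx.b_self_le_exp_mul hs hτ hp2.1 hp2.2.le ht.2
  have h3 : E.b p (x p) (x p) ≤ E.K * (‖h‖ + 1) ^ 2 :=
    (le_abs_self _).trans ((abs_b_le (E := E) hpI _ _).trans (by rw [mul_assoc, sq]; gcongr))
  apply Real.le_sqrt_of_sq_le
  rw [le_div_iff₀ hc]
  calc ‖x t‖ ^ 2 * E.c ≤ E.b t (x t) (x t) := by rw [mul_comm]; exact E.b_coercive t htI _
    _ ≤ _ := h2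
    _ ≤ Real.exp (L * (τ - s)) * (E.K * (‖h‖ + 1) ^ 2) := by
      refine mul_le_mul (Real.exp_le_exp.2 (mul_le_mul_of_nonneg_left ?_ E.L_nonneg)) h3
        (b_nonneg hpI _) (Real.exp_pos _).le
      linarith [hp2.1, ht.2]

/-- Strong solutions with vanishing initial value vanish. -/
theorem eq_zero (hx : E.IsStrongSol x U s τ) (hs : 0 ≤ s) (hτ : τ ≤ T)
    (hh : Tendsto x (𝓝[>] s) (𝓝 0)) : ∀ t ∈ Ioo s τ, x t = 0 := by
  intro t ht
  have hc := E.c_pos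
  have hK := E.K_nonneg
  have htI : t ∈ Ioo 0 T := ⟨hs.trans_lt ht.1, by linarith [ht.2]⟩
  have h1 : Tendsto (fun p => Real.exp (L * (τ - s)) * (E.K * ‖x p‖ * ‖x p‖)) (𝓝[>] s)
      (𝓝 (Real.exp (L * (τ - s)) * (E.K * ‖(0 : H)‖ * ‖(0 : H)‖))) :=
    ((hh.norm.const_mul E.K).mul hh.norm).const_mul _
  have h2 : E.b t (x t) (x t) ≤ Real.exp (L * (τ - s)) * (E.K * ‖(0 : H)‖ * ‖(0 : H)‖) := by
    refine ge_of_tendsto h1 ?_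
    filter_upwards [Ioo_mem_nhdsGT ht.1] with p hp
    have hpI : p ∈ Ioo 0 T := ⟨hs.trans_lt hp.1, by linarith [hp.2, ht.2]⟩
    refine (hx.b_self_le_exp_mul hs hτ hp.1 hp.2.le ht.2).trans ?_
    refine mul_le_mul (Real.exp_le_exp.2 (mul_le_mul_of_nonneg_left ?_ E.L_nonneg))
      ((le_abs_self _).trans (abs_b_le hpI _ _)) (b_nonneg hpI _) (Real.exp_pos _).le
    linarith [hp.1, ht.2]
  have h3 := E.b_coercive t htI (x t)
  simp only [norm_zero, mul_zero] at h2
  have h4 : ‖x t‖ ^ 2 ≤ 0 := by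
    by_contra h; push Not at h; nlinarith
  exact norm_eq_zero.1 (pow_eq_zero_iff two_ne_zero |>.1 (le_antisymm h4 (sq_nonneg _)))

/-- The energy inequality for `w = 0` bounds the energy integral over compact subintervals by `K
R²`, where `R` bounds the curve up to both ends; exhausting `(s, τ)` and using coercivity gives
square integrability in `F`. -/
theorem memLp (hx : E.IsStrongSol x U s τ) (hs : 0 ≤ s) (hsτ : s < τ) (hτ : τ ≤ T) {h : H}
    (hh : Tendsto x (𝓝[>] s) (𝓝 h)) : MemLp U 2 (volume.restrict (Ioo s τ)) := by
  have hc := E.c_pos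
  have hK := E.K_nonneg
  have hL := E.L_nonneg
  obtain ⟨R, hR⟩ := hx.exists_norm_le hs hτ hh
  let G : ℝ → ℝ := fun t => Real.exp (-(L * t)) * E.a t (U t) (U t)
  -- The denominator `n + 3` keeps each margin at most a third of the interval, so the truncated
  -- interval is never empty.
  have hδ : ∀ n : ℕ, 0 < (τ - s) / (n + 3) ∧ (τ - s) / (n + 3) ≤ (τ - s) / 3 := fun n =>
    ⟨div_pos (sub_pos.2 hsτ) (by positivity),
      div_le_div_of_nonneg_left (sub_pos.2 hsτ).le (by norm_num) (by linarith [n.cast_nonneg (α := ℝ)])⟩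
  have hlim : Tendsto (fun n : ℕ => (τ - s) / ((n : ℝ) + 3)) atTop (𝓝 0) :=
    tendsto_const_nhds.div_atTop (tendsto_natCast_atTop_atTop.atTop_add tendsto_const_nhds)
  have hG : IntegrableOn G (Ioc s τ) := by
    refine integrableOn_Ioc_of_intervalIntegral_norm_bounded (l := atTop) (I := E.K * R ^ 2)
      (a := fun n : ℕ => s + (τ - s) / ((n : ℝ) + 3)) (b := fun n : ℕ => τ - (τ - s) / ((n : ℝ) + 3))
      ?_ ?_ ?_ (Eventually.of_forall ?_)
    · intro n
      have := hδ n
      rw [← intervalIntegrable_iff_integrableOn_Ioc_of_le (by linarith)]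
      exact (hx.energy_le hs hτ 0 (by linarith) (by linarith) (by linarith)).1
    · simpa using tendsto_const_nhds.add hlim
    · simpa using tendsto_const_nhds.sub hlim
    · intro n
      have h0 := hδ n
      have h1 := (hx.energy_le hs hτ 0 (p := s + (τ - s) / (n + 3)) (q := τ - (τ - s) / (n + 3))
        (by linarith) (by linarith) (by linarith)).2
      simp only [map_zero, sub_zero, norm_zero] at h1
      rw [← intervalIntegral.integral_of_le (by linarith)]
      have hpI : s + (τ - s) / (n + 3) ∈ Ioo 0 T := ⟨by linarith, by linarith⟩
      have hqI : τ - (τ - s) / (n + 3) ∈ Ioo 0 T := ⟨by linarith, by linarith⟩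
      have h2 := mul_nonneg (Real.exp_pos (-(L * (τ - (τ - s) / (n + 3))))).le
        (b_nonneg (E := E) hqI (x (τ - (τ - s) / (n + 3))))
      have h3 : ∫ t in (s + (τ - s) / (n + 3))..(τ - (τ - s) / (n + 3)), ‖G t‖
          = ∫ t in (s + (τ - s) / (n + 3))..(τ - (τ - s) / (n + 3)), G t := by
        refine intervalIntegral.integral_congr fun t ht => ?_
        rw [uIcc_of_le (by linarith)] at ht
        exact Real.norm_of_nonneg (mul_nonneg (Real.exp_pos _).le
          (E.a_nonneg t ⟨by linarith [ht.1], by linarith [ht.2]⟩ _))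
      rw [h3]
      have h4 : E.b (s + (τ - s) / (n + 3)) (x (s + (τ - s) / (n + 3)))
          (x (s + (τ - s) / (n + 3))) ≤ E.K * R ^ 2 := by
        have := hR (s + (τ - s) / (n + 3)) ⟨by linarith, by linarith⟩
        have hR0 : 0 ≤ R := (norm_nonneg _).trans this
        exact (le_abs_self _).trans ((abs_b_le (E := E) hpI _ _).trans (by rw [mul_assoc, sq]; gcongr))
      have h5 : Real.exp (-(L * (s + (τ - s) / (n + 3)))) ≤ 1 :=
        Real.exp_le_one_iff.2 (neg_nonpos.2 (mul_nonneg hL hpI.1.le))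
      have h6 := mul_le_mul h5 h4 (b_nonneg hpI _) zero_le_one
      simp only [G]
      linarith
  rw [memLp_two_iff_integrable_sq_norm hx.aestronglyMeasurable]
  have h1 : IntegrableOn (fun t => (Real.exp (L * T) * G t + R ^ 2) / E.c) (Ioo s τ) :=
    (((hG.mono_set Ioo_subset_Ioc_self).const_mul _).add (integrable_const _)).div_const _
  refine Integrable.mono h1 (hx.aestronglyMeasurable.norm.pow 2) ?_
  rw [ae_restrict_iff' measurableSet_Ioo]
  filter_upwards [hx.tendsto] with t ht hts
  have htI : t ∈ Ioo 0 T := ⟨hs.trans_lt hts.1, by linarith [hts.2]⟩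
  rw [Real.norm_of_nonneg (sq_nonneg _)]
  refine le_trans ?_ (le_abs_self _)
  rw [le_div_iff₀ hc]
  have h2 := E.a_coercive t htI (U t)
  rw [(ht hts).1] at h2
  have h3 := hR t hts
  have h4 : E.a t (U t) (U t) ≤ Real.exp (L * T) * G t := by
    simp only [G]
    rw [← mul_assoc, ← Real.exp_add]
    refine le_mul_of_one_le_left (E.a_nonneg t htI _) (Real.one_le_exp ?_)
    nlinarith [htI.2]
  have h5 : ‖x t‖ ^ 2 ≤ R ^ 2 := pow_le_pow_left₀ (norm_nonneg _) h3 2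
  linarith

/-- Strong solutions have a limit at the final time. -/
theorem exists_tendsto (hx : E.IsStrongSol x U s τ) (hs : 0 ≤ s) (hsτ : s < τ) (hτ : τ ≤ T)
    {h : H} (hh : Tendsto x (𝓝[>] s) (𝓝 h)) : ∃ h', Tendsto x (𝓝[<] τ) (𝓝 h') := by
  have hc := E.c_pos
  have hK := E.K_nonneg
  have hL := E.L_nonneg
  have hU := hx.memLp hs hsτ hτ hh
  have hUi : IntegrableOn (fun t => ‖U t‖ ^ 2) (Ioo s τ) :=
    (memLp_two_iff_integrable_sq_norm hU.1).1 hU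
  have hUii : IntervalIntegrable (fun t => ‖U t‖ ^ 2) volume s τ :=
    (intervalIntegrable_iff_integrableOn_Ioo_of_le hsτ.le).2 hUi
  have hcont := (hUii.absolutelyContinuousOnInterval_intervalIntegral (c := τ) (by simp)).continuousOn
  rw [uIcc_of_le hsτ.le] at hcont
  have key : ∀ ε > 0, ∃ p ∈ Ioo s τ, ∀ q ∈ Ioo p τ, ‖x q - x p‖ ≤ ε := by
    intro ε hε
    -- The energy inequality on `[p, q]` with the fixed vector `w = U p = x p` gives `c ‖x q - x p‖²
    -- ≤ exp (L T) K ‖U p‖² (q - p)`. So it suffices to find `p` near `τ` with `‖U p‖² (τ - p) ≤ 2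
    -- η`.
    set η := E.c * ε ^ 2 / (Real.exp (L * T) * (2 * E.K + 1)) with hη
    have hη0 : 0 < η := by positivity
    have h1 : Tendsto (fun t => ∫ r in τ..t, ‖U r‖ ^ 2) (𝓝[<] τ) (𝓝 0) := by
      have h2 := (hcont τ ⟨hsτ.le, le_rfl⟩).mono Ioo_subset_Icc_self
      rw [ContinuousWithinAt, nhdsWithin_Ioo_eq_nhdsLT hsτ, intervalIntegral.integral_same] at h2
      exact h2
    obtain ⟨t0, ht0, ht0s⟩ := ((h1.eventually (lt_mem_nhds (neg_lt_zero.2 hη0))).and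
      (Ioo_mem_nhdsLT hsτ)).exists
    rw [intervalIntegral.integral_symm, neg_lt_neg_iff] at ht0
    -- The point `p` is chosen in the left half `(t0, t1)`, where `‖U p‖²` is at most its mean; the
    -- halving gives `q - p ≤ 2 (t1 - t0)` for all `q < τ`.
    set t1 := (t0 + τ) / 2 with ht1
    have ht01 : t0 < t1 := by rw [ht1]; linarith [ht0s.2]
    have ht1τ : t1 < τ := by rw [ht1]; linarith [ht0s.2]
    have hsub : Ioo t0 t1 ⊆ Ioo s τ := Ioo_subset_Ioo ht0s.1.le ht1τ.le
    have hne : volume.restrict (Ioo t0 t1) ≠ 0 := by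
      rw [Ne, Measure.restrict_eq_zero, Real.volume_Ioo, ENNReal.ofReal_eq_zero]
      linarith
    have hgood : ∀ᵐ t ∂volume.restrict (Ioo t0 t1), t ∈ Ioo t0 t1 ∧ E.ι (U t) = x t := by
      rw [ae_restrict_iff' measurableSet_Ioo]
      filter_upwards [hx.tendsto] with t ht htt
      exact ⟨htt, (ht (hsub htt)).1⟩
    have : NeZero (volume.restrict (Ioo t0 t1)) := ⟨hne⟩
    obtain ⟨p, hp, hpU⟩ := exists_notMem_null_le_average hne (hUi.mono_set hsub) (ae_iff.1 hgood)
    simp only [mem_ofPred_eq, not_not] at hp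
    rw [setAverage_eq, smul_eq_mul, Measure.real, Real.volume_Ioo,
      ENNReal.toReal_ofReal (by linarith), inv_mul_eq_div, le_div_iff₀ (by linarith)] at hpU
    have hpη : ‖U p‖ ^ 2 * (t1 - t0) ≤ η := by
      refine hpU.trans (le_trans ?_ ht0.le)
      rw [intervalIntegral.integral_of_le ht0s.2.le, integral_Ioc_eq_integral_Ioo]
      exact setIntegral_mono_set (hUi.mono_set (Ioo_subset_Ioo_left ht0s.1.le))
        (Eventually.of_forall fun _ => sq_nonneg _)
        (LE.le.eventuallyLE (Ioo_subset_Ioo_right ht1τ.le))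
    refine ⟨p, hsub hp.1, fun q hq => ?_⟩
    have hp0 := hsub hp.1
    have hqI : q ∈ Ioo 0 T := ⟨by linarith [hq.1, hp0.1], by linarith [hq.2]⟩
    have e1 := (hx.energy_le hs hτ (U p) hp0.1 hq.1.le hq.2).2
    have e2 : 0 ≤ ∫ t in p..q, Real.exp (-(L * t)) * E.a t (U t) (U t) :=
      intervalIntegral.integral_nonneg hq.1.le fun t ht => mul_nonneg (Real.exp_pos _).le
        (E.a_nonneg t ⟨by linarith [ht.1, hp0.1], by linarith [ht.2, hq.2]⟩ _)
    rw [hp.2, sub_self, map_zero, mul_zero, zero_add] at e1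
    have e3 : E.K * ‖U p‖ ^ 2 * (q - p) ≤ 2 * E.K * η := by
      have : q - p ≤ 2 * (t1 - t0) := by linarith [hq.2, hp.1.1]
      calc E.K * ‖U p‖ ^ 2 * (q - p) ≤ E.K * ‖U p‖ ^ 2 * (2 * (t1 - t0)) := by gcongr
        _ = 2 * E.K * (‖U p‖ ^ 2 * (t1 - t0)) := by ring
        _ ≤ _ := by gcongr
    have e4 : E.b q (x q - x p) (x q - x p) ≤ Real.exp (L * T) * (2 * E.K * η) := by
      have e5 : E.b q (x q - x p) (x q - x p)
          = Real.exp (L * q) * (Real.exp (-(L * q)) * E.b q (x q - x p) (x q - x p)) := by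
        rw [← mul_assoc, ← Real.exp_add, add_neg_cancel, Real.exp_zero, one_mul]
      rw [e5]
      refine mul_le_mul (Real.exp_le_exp.2 (mul_le_mul_of_nonneg_left hqI.2.le hL)) (by linarith)
        (mul_nonneg (Real.exp_pos _).le (b_nonneg hqI _)) (Real.exp_pos _).le
    have e6 : Real.exp (L * T) * (2 * E.K * η) ≤ E.c * ε ^ 2 := by
      calc Real.exp (L * T) * (2 * E.K * η) ≤ Real.exp (L * T) * ((2 * E.K + 1) * η) := by
            gcongr; linarith
        _ = E.c * ε ^ 2 := by rw [hη]; field_simp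
    have e7 := (E.b_coercive q hqI (x q - x p)).trans (e4.trans e6)
    exact (sq_le_sq₀ (norm_nonneg _) hε.le).1 (le_of_mul_le_mul_left e7 hc)
  refine cauchy_map_iff_exists_tendsto.1 (Metric.cauchy_iff.2 ⟨inferInstance, fun ε hε => ?_⟩)
  obtain ⟨p, hp, hpq⟩ := key (ε / 3) (by positivity)
  refine ⟨x '' Ioo p τ, image_mem_map (Ioo_mem_nhdsLT hp.2), ?_⟩
  rintro _ ⟨q, hq, rfl⟩ _ ⟨r, hr, rfl⟩
  have h1 := hpq q hq
  have h2 := hpq r hr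
  rw [← dist_eq_norm] at h1 h2
  linarith [dist_triangle_right (x q) (x r) (x p)]

/-- Strong solutions with an initial value are weak solutions. -/
theorem exists_isWeakSol (hx : E.IsStrongSol x U s τ) (hs : 0 ≤ s) (hsτ : s < τ) (hτ : τ ≤ T)
    {h : H} (hh : Tendsto x (𝓝[>] s) (𝓝 h)) :
    ∃ y U', E.IsWeakSol y U U' s τ ∧ y s = h ∧ EqOn y x (Ioo s τ) := by
  have hK := E.K_nonneg
  obtain ⟨h', hh'⟩ := hx.exists_tendsto hs hsτ hτ hh
  have hU := hx.memLp hs hsτ hτ hh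
  have hI : ∀ t ∈ Ioo s τ, t ∈ Ioo 0 T := fun t ht => ⟨hs.trans_lt ht.1, ht.2.trans_le hτ⟩
  have hder := hx.ae_hasDerivAt hs hτ
  -- The derivative of `x` in `F*`: the strong equation is tested with `N' t v`, since `b t h (ι (N'
  -- t v)) = ⟪h, ι v⟫`.
  let U' : ℝ → StrongDual ℝ F := fun t => -(E.a t (U t)).comp (E.N' t)
  have hy : ∀ t ∈ Ioo s τ, extendFrom (Ioo s τ) x t = x t := fun t ht =>
    extendFrom_eq (subset_closure ht) ((hx.continuousOn t ht).tendsto)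
  -- Neither `N'` nor its product with `a` is known to be measurable in time. But `U' t v` is almost
  -- everywhere the derivative of a real function, and derivatives are measurable.
  have hU'm : AEStronglyMeasurable U' (volume.restrict (Ioo s τ)) := by
    refine aestronglyMeasurable_dual_of_apply fun v => ?_
    refine (measurable_deriv fun r => ⟪x r, E.ι v⟫).aemeasurable.congr ?_
    refine (ae_restrict_iff' measurableSet_Ioo).2 ?_
    filter_upwards [hder] with t ht hts
    simpa [U'] using (ht hts v).deriv
  have hU'L : MemLp U' 2 (volume.restrict (Ioo s τ)) := by
    refine hU.of_le_mul (c := E.K * E.K) hU'm ((ae_restrict_iff' measurableSet_Ioo).2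
      (Eventually.of_forall fun t ht => ?_))
    rw [norm_neg]
    refine (ContinuousLinearMap.opNorm_comp_le _ _).trans ?_
    have h1 := (E.a t).le_opNorm (U t)
    have h2 := E.norm_a_le t (hI t ht)
    have h3 := E.norm_N'_le t (hI t ht)
    calc ‖E.a t (U t)‖ * ‖E.N' t‖ ≤ (E.K * ‖U t‖) * E.K := by
          gcongr
          exact h1.trans (by gcongr)
      _ = _ := by ring
  refine ⟨extendFrom (Ioo s τ) x, U', ⟨continuousOn_Icc_extendFrom_Ioo hx.continuousOn hh hh', hU,
    hU'L, ?_, ?_, ?_⟩, ?_, hy⟩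
  · intro φ hφ hφc hφs
    have hU1 : IntegrableOn U (Ioo s τ) := hU.integrable one_le_two
    have hU'1 : IntegrableOn U' (Ioo s τ) := hU'L.integrable one_le_two
    have i1 : IntegrableOn (fun t => deriv φ t • E.toDual (E.ι (U t))) (Ioo s τ) :=
      IntegrableOn.continuousOn_smul_of_subset (hφ.continuous_deriv (by simp)).continuousOn
        ((E.toDual.comp E.ι).integrable_comp hU1) isCompact_Icc measurableSet_Ioo
        Ioo_subset_Icc_self
    have i2 : IntegrableOn (fun t => φ t • U' t) (Ioo s τ) :=
      IntegrableOn.continuousOn_smul_of_subset hφ.continuous.continuousOn hU'1 isCompact_Icc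
        measurableSet_Ioo Ioo_subset_Icc_self
    ext v
    rw [neg_apply, ContinuousLinearMap.integral_apply i1, ContinuousLinearMap.integral_apply i2,
      eq_neg_iff_add_eq_zero]
    have i3 := i1.apply_continuousLinearMap v
    have i4 := i2.apply_continuousLinearMap v
    rw [← integral_add i3 i4]
    obtain ⟨p, q, hp, hpq, hq, hsub⟩ := exists_Icc_subset_of_isCompact hsτ hφc hφs
    have hz : ∀ t ∉ Ioo p q, φ t = 0 ∧ deriv φ t = 0 := fun t ht => by
      have h1 : t ∉ tsupport φ := fun h => ht (hsub h)
      exact ⟨image_eq_zero_of_notMem_tsupport h1,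
        image_eq_zero_of_notMem_tsupport fun h => h1 (tsupport_deriv_subset h)⟩
    rw [setIntegral_eq_of_subset_of_forall_sdiff_eq_zero measurableSet_Ioo
      (Ioc_subset_Ioo_right hq |>.trans (Ioo_subset_Ioo_left hp.le) : Ioc p q ⊆ Ioo s τ)]
    swap
    · intro t ht
      have := hz t fun h => ht.2 (Ioo_subset_Ioc_self h)
      simp [this.1, this.2]
    rw [← intervalIntegral.integral_of_le hpq.le]
    obtain ⟨k, hk⟩ := hx.hasACDensity p q hp hpq.le hq
    obtain ⟨R, hR⟩ := isCompact_Icc.exists_bound_of_continuousOn (hk.continuousOn hpq.le)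
    obtain ⟨C, hC⟩ := hφc.exists_bound_of_continuous hφ.continuous
    obtain ⟨D, hD⟩ := hφ.lipschitzWith_of_hasCompactSupport hφc (by simp)
    have hC0 : 0 ≤ C := (norm_nonneg _).trans (hC 0)
    have hac : HasACDensity (fun t => φ t * ⟪x t, E.ι v⟫)
        (fun t => (C * ‖E.ι v‖) * k t + D * (R * ‖E.ι v‖)) p q := by
      refine hk.of_norm_sub_le (by positivity) fun c d hc hcd hd => ?_
      have h1 : φ d * ⟪x d, E.ι v⟫ - φ c * ⟪x c, E.ι v⟫
          = φ d * ⟪x d - x c, E.ι v⟫ + (φ d - φ c) * ⟪x c, E.ι v⟫ := by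
        rw [inner_sub_left]; ring
      have h2 := hD.dist_le_mul d c
      rw [dist_eq_norm, Real.dist_eq, abs_of_nonneg (sub_nonneg.2 hcd)] at h2
      rw [h1]
      refine (norm_add_le _ _).trans ?_
      rw [norm_mul, norm_mul]
      have h3 := norm_inner_le_norm (𝕜 := ℝ) (x d - x c) (E.ι v)
      have h4 := norm_inner_le_norm (𝕜 := ℝ) (x c) (E.ι v)
      have h5 := hR c ⟨hc, hcd.trans hd⟩
      have h6 := hC d
      have h7 : 0 ≤ d - c := sub_nonneg.2 hcd
      calc _ ≤ C * (‖x d - x c‖ * ‖E.ι v‖) + (D * (d - c)) * (R * ‖E.ι v‖) := by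
            gcongr
            exact h4.trans (by gcongr)
        _ = _ := by ring
    -- The two integrands add up to the derivative of `φ ⟪x, ι v⟫`, which vanishes at `p` and `q`.
    have hint := hac.integral_eq_sub hpq.le
      (G := fun t => deriv φ t * ⟪x t, E.ι v⟫ + φ t * (-E.a t (U t) (E.N' t v))) ?_
    · rw [(hz p (by simp)).1, (hz q (by simp)).1, zero_mul, zero_mul, sub_zero] at hint
      rw [← hint]
      refine intervalIntegral.integral_congr_ae ?_
      filter_upwards [hx.tendsto] with t ht htpq
      rw [uIoc_of_le hpq.le] at htpq
      have := (ht ⟨hp.trans htpq.1, htpq.2.trans_lt hq⟩).1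
      simp [U', toDual_apply, this]
    · filter_upwards [hder] with t ht htpq
      exact ((hφ.differentiable (by simp)).differentiableAt.hasDerivAt).mul
        (ht ⟨hp.trans htpq.1, htpq.2.trans hq⟩ v)
  · filter_upwards [hx.tendsto] with t ht hts
    rw [(ht hts).1, hy t hts]
  · refine Eventually.of_forall fun t ht v => ?_
    -- Both vectors have the same `b t` product with every `h`, and `b t` is coercive.
    have h1 : E.N' t (E.N t v) = v := by
      apply E.ι_inj
      have hb : ∀ h : H, E.b t h (E.ι (E.N' t (E.N t v)) - E.ι v) = 0 := fun h => by
        rw [map_sub, E.b_apply_ι' t (hI t ht), E.b_apply_ι t (hI t ht), sub_self]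
      have h2 := E.b_coercive t (hI t ht) (E.ι (E.N' t (E.N t v)) - E.ι v)
      rw [hb] at h2
      have h3 : ‖E.ι (E.N' t (E.N t v)) - E.ι v‖ ^ 2 ≤ 0 := by
        have := E.c_pos
        by_contra h; push Not at h; nlinarith
      exact sub_eq_zero.1 (norm_eq_zero.1
        (pow_eq_zero_iff two_ne_zero |>.1 (le_antisymm h3 (sq_nonneg _))))
    simp [U', h1]
  · exact eq_lim_at_left_extendFrom_Ioo hsτ hh

end IsStrongSol
end FormFlow

/-! ### Regularity of weak solutions by difference quotients. -/

namespace FormFlow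

variable {F H : Type*} [NormedAddCommGroup F] [InnerProductSpace ℝ F]
    [NormedAddCommGroup H] [InnerProductSpace ℝ H] {T L : ℝ} {E : FormFlow F H T L}

theorem abs_a_self_sub_le {t : ℝ} (ht : t ∈ Ioo 0 T) {u v : F} {R : ℝ} (hu : ‖u‖ ≤ R)
    (hv : ‖v‖ ≤ R) : |E.a t u u - E.a t v v| ≤ 2 * E.K * R * ‖u - v‖ := by
  have h1 : E.a t u u - E.a t v v = E.a t (u - v) u + E.a t v (u - v) := by
    simp only [map_sub, sub_apply]; ring
  have hK := E.K_nonneg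
  have hR : 0 ≤ R := (norm_nonneg _).trans hu
  rw [h1]
  calc _ ≤ |E.a t (u - v) u| + |E.a t v (u - v)| := abs_add_le _ _
    _ ≤ E.K * ‖u - v‖ * ‖u‖ + E.K * ‖v‖ * ‖u - v‖ :=
      add_le_add (abs_a_le ht _ _) (abs_a_le ht _ _)
    _ ≤ E.K * ‖u - v‖ * R + E.K * R * ‖u - v‖ := by gcongr
    _ = _ := by ring

namespace IsWeakSol

variable {x : ℝ → H} {U : ℝ → F} {U' : ℝ → StrongDual ℝ F} {s τ : ℝ}

theorem integrableOn (hw : E.IsWeakSol x U U' s τ) : IntegrableOn U (Ioo s τ) :=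
  hw.memLp.integrable one_le_two

theorem integrableOn_deriv (hw : E.IsWeakSol x U U' s τ) : IntegrableOn U' (Ioo s τ) :=
  hw.memLp_deriv.integrable one_le_two

theorem toDual_sub_eq (hw : E.IsWeakSol x U U' s τ) {r t : ℝ} (hr : s < r) (hrt : r ≤ t)
    (ht : t < τ) : E.toDual (x t) - E.toDual (x r) = ∫ u in r..t, U' u := by
  have hc : ContinuousOn (fun t => E.toDual (x t)) (Icc s τ) :=
    E.toDual.continuous.comp_continuousOn hw.continuousOn
  refine sub_eq_integral_of_weak_deriv (hc.mono Ioo_subset_Icc_self)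
    ((hc.integrableOn_Icc).mono_set Ioo_subset_Icc_self) hw.integrableOn_deriv ?_ hr hrt ht
  intro φ h1 h2 h3
  rw [← hw.weak_deriv φ h1 h2 h3]
  refine setIntegral_congr_ae measurableSet_Ioo ?_
  filter_upwards [hw.ae_eq] with t ht hts
  rw [ht hts]

theorem intervalIntegrable_sub {G : Type*} [NormedAddCommGroup G] {f : ℝ → G}
    (hf : IntegrableOn f (Ioo s τ)) {p q : ℝ} (hp : s ≤ p) (hpq : p ≤ q) (hq : q ≤ τ) :
    IntervalIntegrable f volume p q :=
  (intervalIntegrable_iff_integrableOn_Ioo_of_le hpq).2 (hf.mono_set (Ioo_subset_Ioo hp hq))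

theorem hasACDensity_toDual (hw : E.IsWeakSol x U U' s τ) {p q : ℝ} (hp : s < p) (hpq : p ≤ q)
    (hq : q < τ) : HasACDensity (fun t => E.toDual (x t)) (fun t => ‖U' t‖) p q := by
  refine ⟨(intervalIntegrable_sub hw.integrableOn_deriv hp.le hpq hq.le).norm,
    fun a b ha hab hb => ?_⟩
  rw [hw.toDual_sub_eq (hp.trans_le ha) hab (hb.trans_lt hq)]
  exact intervalIntegral.norm_integral_le_integral_norm hab

theorem ae_hasDerivAt (hw : E.IsWeakSol x U U' s τ) :
    ∀ᵐ t, t ∈ Ioo s τ → HasDerivAt (fun r => E.toDual (x r)) (U' t) t := by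
  rcases le_or_gt τ s with hsτ | hsτ
  · exact Eventually.of_forall fun t ht => absurd (ht.1.trans ht.2) (not_lt.2 hsτ)
  have h1 := (intervalIntegrable_sub hw.integrableOn_deriv le_rfl hsτ.le le_rfl).ae_hasDerivAt_integral
  filter_upwards [h1] with t ht hts
  rw [uIcc_of_le hsτ.le] at ht
  obtain ⟨c, hc1, hc2⟩ := exists_between hts.1
  have h2 := (ht (Ioo_subset_Icc_self hts) c ⟨hc1.le, (hc2.trans hts.2).le⟩).const_add
    (E.toDual (x c))
  refine h2.congr_of_eventuallyEq ?_
  filter_upwards [Ioo_mem_nhds hc2 hts.2] with r hr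
  rw [← hw.toDual_sub_eq hc1 hr.1.le hr.2]
  abel

/-- Since `b t h (ι v) = ⟪h, ι (N t v)⟫`, the derivative of `x` in `F*` paired with `N t v` is the
derivative required of a strong solution. -/
theorem ae_tendsto (hw : E.IsWeakSol x U U' s τ) (hs : 0 ≤ s) (hτ : τ ≤ T) :
    ∀ᵐ t, t ∈ Ioo s τ → E.ι (U t) = x t ∧
    ∀ v, Tendsto (fun r => E.b t (x r - x t) (E.ι v) / (r - t)) (𝓝[≠] t) (𝓝 (-E.a t (U t) v)) := by
  filter_upwards [hw.ae_hasDerivAt, hw.ae_eq, hw.apply_N] with t h1 h2 h3 ht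
  refine ⟨h2 ht, fun v => ?_⟩
  have htI : t ∈ Ioo 0 T := ⟨hs.trans_lt ht.1, ht.2.trans_le hτ⟩
  rw [← h3 ht v]
  have h4 := (h1 ht).clm_apply (hasDerivAt_const t (E.N t v))
  simp only [map_zero, add_zero] at h4
  refine (hasDerivAt_iff_tendsto_slope.1 h4).congr fun r => ?_
  rw [slope_def_field, E.b_apply_ι t htI, inner_sub_left, toDual_apply, toDual_apply]

theorem exists_norm_le (hw : E.IsWeakSol x U U' s τ) : ∃ R, 0 ≤ R ∧ ∀ t ∈ Icc s τ, ‖x t‖ ≤ R := by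
  obtain ⟨R, hR⟩ := isCompact_Icc.exists_bound_of_continuousOn hw.continuousOn
  exact ⟨|R|, abs_nonneg _, fun t ht => (hR t ht).trans (le_abs_self _)⟩

theorem integrableOn_a (hw : E.IsWeakSol x U U' s τ) (hs : 0 ≤ s) (hτ : τ ≤ T) (w : F) :
    IntegrableOn (fun t => E.a t (U t) w) (Ioo s τ) := by
  have hI : Ioo s τ ⊆ Ioo 0 T := Ioo_subset_Ioo hs hτ
  refine Integrable.mono' (hw.integrableOn.norm.const_mul (E.K * ‖w‖))
    (aestronglyMeasurable_a measurableSet_Ioo hI hw.memLp.1 aestronglyMeasurable_const) ?_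
  refine (ae_restrict_iff' measurableSet_Ioo).2 (Eventually.of_forall fun t ht => ?_)
  exact (abs_a_le (hI ht) _ _).trans_eq (by ring)

/-- The equation integrated in time against a fixed vector `w`. The last term pays for the motion of
`b`. -/
theorem b_sub_le (hw : E.IsWeakSol x U U' s τ) (hs : 0 ≤ s) (hτ : τ ≤ T) {R : ℝ}
    (hR : ∀ t ∈ Icc s τ, ‖x t‖ ≤ R) (w : F) {p q : ℝ} (hp : s < p) (hpq : p ≤ q) (hq : q < τ) :
    E.b q (x q) (E.ι w) - E.b p (x p) (E.ι w)
      ≤ -(∫ t in p..q, E.a t (U t) w) + E.K * R * ‖E.ι w‖ * (q - p) := by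
  have hK := E.K_nonneg
  have hI : ∀ t, p ≤ t → t ≤ q → t ∈ Ioo 0 T := fun t h1 h2 => ⟨by linarith, by linarith⟩
  have hR' : ∀ t, p ≤ t → t ≤ q → ‖x t‖ ≤ R := fun t h1 h2 => hR t ⟨by linarith, by linarith⟩
  have hai := intervalIntegrable_sub (hw.integrableOn_a hs hτ w) hp.le hpq hq.le
  have key : ∀ c d, p ≤ c → c ≤ q → p ≤ d → d ≤ q →
      (E.b d - E.b c) (x d) (E.ι w) ≤ E.K * R * ‖E.ι w‖ * |d - c| := by
    intro c d hc hc' hd hd'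
    refine (le_abs_self _).trans ((abs_b_sub_le (hI d hd hd') (hI c hc hc') _ _).trans ?_)
    calc _ ≤ E.K * |d - c| * R * ‖E.ι w‖ := by gcongr; exact hR' d hd hd'
      _ = _ := by ring
  -- At this stage `x` is absolutely continuous only in `F*`, with density `‖U'‖`; that suffices
  -- because `w` lies in `F`.
  have hac : HasACDensity (fun t => E.b t (x t) (E.ι w))
      (fun t => (E.K * ‖w‖) * ‖U' t‖ + E.K * R * ‖E.ι w‖) p q := by
    refine (hw.hasACDensity_toDual hp hpq hq).of_norm_sub_le (by positivity)
      fun c d hc hcd hd => ?_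
    have hcI := hI c hc (hcd.trans hd)
    have hdI := hI d (hc.trans hcd) hd
    have h1 : E.b d (x d) (E.ι w) - E.b c (x c) (E.ι w)
        = (E.toDual (x d) - E.toDual (x c)) (E.N c w)
          + (E.b d (x d) (E.ι w) - E.b c (x d) (E.ι w)) := by
      rw [sub_apply, toDual_apply, toDual_apply, ← E.b_apply_ι c hcI, ← E.b_apply_ι c hcI]; ring
    rw [h1]
    refine (norm_add_le _ _).trans (add_le_add ?_ ?_)
    · refine (ContinuousLinearMap.le_opNorm _ _).trans ?_
      have h2 : ‖E.N c w‖ ≤ E.K * ‖w‖ :=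
        ((E.N c).le_opNorm w).trans (by gcongr; exact E.norm_N_le c hcI)
      rw [mul_comm]
      gcongr
    · refine (abs_b_sub_le hdI hcI _ _).trans ?_
      rw [abs_of_nonneg (sub_nonneg.2 hcd)]
      have h0 : 0 ≤ d - c := sub_nonneg.2 hcd
      calc _ ≤ E.K * (d - c) * R * ‖E.ι w‖ := by gcongr; exact hR' d (hc.trans hcd) hd
        _ = _ := by ring
  have hneg : IntervalIntegrable (fun t => -E.a t (U t) w) volume p q := hai.neg
  have h1 := hac.sub_le_integral hpq
    (G := fun t => -E.a t (U t) w + E.K * R * ‖E.ι w‖) (hneg.add intervalIntegrable_const) ?_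
  · rw [intervalIntegral.integral_add hneg intervalIntegrable_const,
      intervalIntegral.integral_const, smul_eq_mul, intervalIntegral.integral_neg] at h1
    linarith
  · filter_upwards [hw.ae_tendsto hs hτ] with t ht htpq ε hε
    have h2 := ((ht ⟨hp.trans htpq.1, htpq.2.trans hq⟩).2 w).mono_left
      (nhdsWithin_mono t (fun r (hr : t < r) => hr.ne') : 𝓝[>] t ≤ 𝓝[≠] t)
    filter_upwards [h2.eventually (gt_mem_nhds (lt_add_of_pos_right _ hε)),
      Ioo_mem_nhdsGT htpq.2] with r h3 hr
    have hr0 : 0 < r - t := sub_pos.2 hr.1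
    rw [div_lt_iff₀ hr0] at h3
    have h4 := key t r htpq.1.le htpq.2.le (htpq.1.trans hr.1).le hr.2.le
    rw [abs_of_pos hr0] at h4
    simp only [sub_apply, map_sub] at h3 h4
    linarith

end IsWeakSol
end FormFlow

/-- Cauchy–Schwarz, obtained by integrating `(A / h - ‖f‖)² ≥ 0` with `A` the integral of `‖f‖`. -/
theorem sq_integral_norm_le {G : Type*} [NormedAddCommGroup G] {f : ℝ → G} {p h : ℝ} (hh : 0 < h)
    (h1 : IntervalIntegrable (fun t => ‖f t‖) volume p (p + h))
    (h2 : IntervalIntegrable (fun t => ‖f t‖ ^ 2) volume p (p + h)) :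
    (∫ t in p..p + h, ‖f t‖) ^ 2 ≤ h * ∫ t in p..p + h, ‖f t‖ ^ 2 := by
  set A := ∫ t in p..p + h, ‖f t‖ with hA
  have h3 : ∫ t in p..p + h, 2 * (A / h) * ‖f t‖ ≤ ∫ t in p..p + h, ((A / h) ^ 2 + ‖f t‖ ^ 2) := by
    refine intervalIntegral.integral_mono_on (by linarith) (h1.const_mul _)
      (intervalIntegrable_const.add h2) fun t _ => ?_
    nlinarith [sq_nonneg (A / h - ‖f t‖)]
  rw [intervalIntegral.integral_const_mul, intervalIntegral.integral_add intervalIntegrable_const h2,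
    intervalIntegral.integral_const, smul_eq_mul, ← hA, add_sub_cancel_left] at h3
  have h4 : 2 * (A / h) * A = 2 * (A ^ 2 / h) := by ring
  have h5 : h * (A / h) ^ 2 = A ^ 2 / h := by field_simp
  rw [h4, h5] at h3
  have h6 : A ^ 2 / h ≤ ∫ t in p..p + h, ‖f t‖ ^ 2 := by linarith
  rwa [div_le_iff₀' hh] at h6

namespace FormFlow

variable {F H : Type*} [NormedAddCommGroup F] [InnerProductSpace ℝ F]
    [NormedAddCommGroup H] [InnerProductSpace ℝ H] {T L : ℝ} {E : FormFlow F H T L}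

namespace IsWeakSol

variable {x : ℝ → H} {U : ℝ → F} {U' : ℝ → StrongDual ℝ F} {s τ : ℝ}

theorem integrableOn_sq (hw : E.IsWeakSol x U U' s τ) :
    IntegrableOn (fun t => ‖U t‖ ^ 2) (Ioo s τ) :=
  (memLp_two_iff_integrable_sq_norm hw.memLp.1).1 hw.memLp

/-- The basic estimate for the increments of a weak solution. -/
theorem norm_increment_le (hw : E.IsWeakSol x U U' s τ) (hs : 0 ≤ s) (hτ : τ ≤ T) {R : ℝ}
    (hR : ∀ t ∈ Icc s τ, ‖x t‖ ≤ R) [CompleteSpace F] {t h : ℝ} (hh : 0 < h)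
    (ht : s < t) (hth : t + h < τ) (h1 : E.ι (U t) = x t) (h2 : E.ι (U (t + h)) = x (t + h)) :
    E.c / 2 * ‖x (t + h) - x t‖ ^ 2 ≤ -E.a t (∫ r in t..t + h, U r) (U (t + h) - U t)
      + E.K / 2 * (h * ∫ r in t..t + h, ‖U r‖ ^ 2) + E.K * h ^ 2 * (‖U (t + h)‖ ^ 2 + ‖U t‖ ^ 2)
      + 2 * E.K ^ 2 * R ^ 2 / E.c * h ^ 2 := by
  have hK := E.K_nonneg
  have hc := E.c_pos
  have htI : t ∈ Ioo 0 T := ⟨by linarith, by linarith⟩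
  have hthI : t + h ∈ Ioo 0 T := ⟨by linarith, by linarith⟩
  set w := U (t + h) - U t with hw'
  set A := ∫ r in t..t + h, ‖U r‖ with hA
  have hιw : E.ι w = x (t + h) - x t := by rw [hw', map_sub, h1, h2]
  have hUi : IntervalIntegrable U volume t (t + h) :=
    intervalIntegrable_sub hw.integrableOn ht.le (by linarith) hth.le
  have hU2 := intervalIntegrable_sub hw.integrableOn_sq ht.le (by linarith : t ≤ t + h) hth.le
  have hai := intervalIntegrable_sub (hw.integrableOn_a hs hτ w) ht.le
    (by linarith : t ≤ t + h) hth.le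
  have hA2 : A ^ 2 ≤ h * ∫ r in t..t + h, ‖U r‖ ^ 2 := sq_integral_norm_le hh hUi.norm hU2
  have hA0 : 0 ≤ A := intervalIntegral.integral_nonneg (by linarith) fun _ _ => norm_nonneg _
  have e1 := hw.b_sub_le hs hτ hR w ht (by linarith : t ≤ t + h) hth
  rw [add_sub_cancel_left] at e1
  have e2 : E.a t (∫ r in t..t + h, U r) w = ∫ r in t..t + h, E.a t (U r) w := by
    have := ((E.a t).flip w).intervalIntegral_comp_comm hUi
    simpa using this.symm
  have hai' : IntervalIntegrable (fun r => E.a t (U r) w) volume t (t + h) := by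
    have : IntervalIntegrable (fun r => (E.a t).flip w (U r)) volume t (t + h) :=
      ⟨((E.a t).flip w).integrable_comp hUi.1, ((E.a t).flip w).integrable_comp hUi.2⟩
    exact this
  -- Freezing the form at time `t` lets the integral move inside `a t`, where it becomes the moving
  -- integral of `U`; the price is one factor `h` from the Lipschitz bound.
  have e3 : E.a t (∫ r in t..t + h, U r) w - ∫ r in t..t + h, E.a r (U r) w
      ≤ E.K * h * A * ‖w‖ := by
    rw [e2, ← intervalIntegral.integral_sub hai' hai]
    have : ∫ r in t..t + h, (E.a t (U r) w - E.a r (U r) w)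
        ≤ ∫ r in t..t + h, E.K * h * ‖w‖ * ‖U r‖ := by
      refine intervalIntegral.integral_mono_on (by linarith) (hai'.sub hai)
        (hUi.norm.const_mul _) fun r hr => ?_
      refine (le_abs_self _).trans ((abs_a_sub_le htI
        ⟨htI.1.trans_le hr.1, hr.2.trans_lt hthI.2⟩ _ _).trans ?_)
      have : |t - r| ≤ h := by rw [abs_le]; constructor <;> linarith [hr.1, hr.2]
      calc _ ≤ E.K * h * ‖U r‖ * ‖w‖ := by gcongr
        _ = _ := by ring
    rw [intervalIntegral.integral_const_mul] at this
    linarith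
  have e4 := E.b_coercive (t + h) hthI (x (t + h) - x t)
  have e5 : E.b (t + h) (x (t + h) - x t) (x (t + h) - x t)
      = (E.b (t + h) (x (t + h)) (E.ι w) - E.b t (x t) (E.ι w))
        + (E.b t (x t) (E.ι w) - E.b (t + h) (x t) (E.ι w)) := by
    rw [hιw, map_sub (E.b (t + h)), sub_apply]; ring
  have e6 : E.b t (x t) (E.ι w) - E.b (t + h) (x t) (E.ι w) ≤ E.K * R * ‖E.ι w‖ * h := by
    refine (le_abs_self _).trans ((abs_b_sub_le htI hthI _ _).trans ?_)
    have e7 : |t - (t + h)| = h := by rw [abs_sub_comm, add_sub_cancel_left, abs_of_pos hh]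
    rw [e7]
    calc _ ≤ E.K * h * R * ‖E.ι w‖ := by gcongr; exact hR t ⟨ht.le, by linarith⟩
      _ = _ := by ring
  -- Young's inequality: half of the coercivity of `b` absorbs both terms coming from its variation
  -- in time.
  have e8 : 2 * (E.K * R * ‖E.ι w‖ * h)
      ≤ E.c / 2 * ‖E.ι w‖ ^ 2 + 2 * E.K ^ 2 * R ^ 2 / E.c * h ^ 2 := by
    have : E.c / 2 * ‖E.ι w‖ ^ 2 + 2 * E.K ^ 2 * R ^ 2 / E.c * h ^ 2 - 2 * (E.K * R * ‖E.ι w‖ * h)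
        = E.c / 2 * (‖E.ι w‖ - 2 * E.K * R * h / E.c) ^ 2 := by field_simp; ring
    have h0 : 0 ≤ E.c / 2 * (‖E.ι w‖ - 2 * E.K * R * h / E.c) ^ 2 := by positivity
    linarith
  have e9 : E.K * h * A * ‖w‖ ≤ E.K / 2 * A ^ 2 + E.K / 2 * (h ^ 2 * ‖w‖ ^ 2) := by
    nlinarith [mul_nonneg hK (sq_nonneg (A - h * ‖w‖))]
  have e10 : ‖w‖ ^ 2 ≤ 2 * (‖U (t + h)‖ ^ 2 + ‖U t‖ ^ 2) := by
    have := norm_sub_le (U (t + h)) (U t)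
    nlinarith [sq_nonneg (‖U (t + h)‖ - ‖U t‖), norm_nonneg w]
  have e11 : E.K / 2 * (h ^ 2 * ‖w‖ ^ 2) ≤ E.K * h ^ 2 * (‖U (t + h)‖ ^ 2 + ‖U t‖ ^ 2) := by
    calc _ ≤ E.K / 2 * (h ^ 2 * (2 * (‖U (t + h)‖ ^ 2 + ‖U t‖ ^ 2))) := by gcongr
      _ = _ := by ring
  have e12 : E.K / 2 * A ^ 2 ≤ E.K / 2 * (h * ∫ r in t..t + h, ‖U r‖ ^ 2) := by gcongr
  rw [hιw] at e1 e5 e6 e8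
  linarith

/-- With `P` the primitive of `f`, the double integral telescopes to the integral of `P` over `[q, q
+ h]` minus that over `[p, p + h]`, and `P` lies between `0` and the total integral. -/
theorem integral_shift_sub_le {f : ℝ → ℝ} (hf0 : ∀ t, 0 ≤ f t) (hf : IntegrableOn f (Ioo s τ))
    {p q h : ℝ} (hh : 0 < h) (hp : s < p) (hpq : p ≤ q) (hq : q + h < τ) :
    IntervalIntegrable (fun t => ∫ r in t..t + h, f r) volume p q ∧
    ∫ t in p..q, (∫ r in t..t + h, f r) ≤ h * ∫ t in Ioo s τ, f t := by
  have hsτ : s < τ := by linarith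
  set P : ℝ → ℝ := fun t => ∫ r in s..t, f r with hP
  have hii : IntervalIntegrable f volume s τ := intervalIntegrable_sub hf le_rfl hsτ.le le_rfl
  have hPc : ContinuousOn P (Icc s τ) := by
    have := (hii.absolutelyContinuousOnInterval_intervalIntegral (c := s) (by simp)).continuousOn
    rwa [uIcc_of_le hsτ.le] at this
  have hPi : ∀ a b, s ≤ a → a ≤ b → b ≤ τ → IntervalIntegrable P volume a b := fun a b h1 h2 h3 =>
    (hPc.mono (by rw [uIcc_of_le h2]; exact Icc_subset_Icc h1 h3)).intervalIntegrable
  have hPd : ∀ t ∈ Icc p q, ∫ r in t..t + h, f r = P (t + h) - P t := fun t ht => by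
    rw [hP, intervalIntegral.integral_interval_sub_left]
    · exact intervalIntegrable_sub hf le_rfl (by linarith [ht.1]) (by linarith [ht.2])
    · exact intervalIntegrable_sub hf le_rfl (by linarith [ht.1]) (by linarith [ht.2])
  have hPsh : IntervalIntegrable (fun t => P (t + h)) volume p q := by
    have := (hPi (p + h) (q + h) (by linarith) (by linarith) hq.le).comp_add_right h
    simpa using this
  have hPpq := hPi p q hp.le hpq (by linarith)
  have hP0 : ∀ t ∈ Icc s τ, 0 ≤ P t ∧ P t ≤ ∫ t in Ioo s τ, f t := fun t ht => by
    refine ⟨intervalIntegral.integral_nonneg ht.1 fun r _ => hf0 r, ?_⟩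
    rw [hP]
    simp only
    rw [intervalIntegral.integral_of_le ht.1, integral_Ioc_eq_integral_Ioo]
    exact setIntegral_mono_set hf (Eventually.of_forall hf0)
      (LE.le.eventuallyLE (Ioo_subset_Ioo_right ht.2))
  constructor
  · refine (hPsh.sub hPpq).congr fun t ht => (hPd t ?_).symm
    rw [uIoc_of_le hpq] at ht
    exact Ioc_subset_Icc_self ht
  · have e1 : ∫ t in p..q, (∫ r in t..t + h, f r) = ∫ t in p..q, (P (t + h) - P t) := by
      refine intervalIntegral.integral_congr fun t ht => ?_
      rw [uIcc_of_le hpq] at ht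
      exact hPd t ht
    rw [e1, intervalIntegral.integral_sub hPsh hPpq, intervalIntegral.integral_comp_add_right]
    have i1 := hPi p (q + h) hp.le (by linarith) hq.le
    have i2 := hPi p (p + h) hp.le (by linarith) (by linarith)
    have i3 := hPi q (q + h) (by linarith) (by linarith) hq.le
    have i4 := hPi (p + h) (q + h) (by linarith) (by linarith) hq.le
    have e2 := intervalIntegral.integral_add_adjacent_intervals i2 i4
    have e3 := intervalIntegral.integral_add_adjacent_intervals hPpq i3
    have e4 : ∫ t in q..q + h, P t ≤ ∫ _ in q..q + h, ∫ t in Ioo s τ, f t :=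
      intervalIntegral.integral_mono_on (by linarith) i3 intervalIntegrable_const fun t ht =>
        (hP0 t ⟨by linarith [ht.1], by linarith [ht.2]⟩).2
    have e5 : 0 ≤ ∫ t in p..p + h, P t := intervalIntegral.integral_nonneg (by linarith)
      fun t ht => (hP0 t ⟨by linarith [ht.1], by linarith [ht.2]⟩).1
    rw [intervalIntegral.integral_const, smul_eq_mul, add_sub_cancel_left] at e4
    linarith

/-- The moving integrals `∫_t^{t+h} f` are absolutely continuous. -/
theorem hasACDensity_integral_shift {G : Type*} [NormedAddCommGroup G] [NormedSpace ℝ G]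
    {f : ℝ → G} (hf : IntegrableOn f (Ioo s τ)) {p q h : ℝ} (hh : 0 < h) (hp : s < p)
    (hpq : p ≤ q) (hq : q + h < τ) :
    HasACDensity (fun t => ∫ r in t..t + h, f r) (fun t => ‖f (t + h)‖ + ‖f t‖) p q := by
  have i1 : ∀ a b, s ≤ a → a ≤ b → b ≤ τ → IntervalIntegrable f volume a b :=
    fun a b => intervalIntegrable_sub hf
  have i2 : ∀ a b, p ≤ a → a ≤ b → b ≤ q →
      IntervalIntegrable (fun t => f (t + h)) volume a b := fun a b h1 h2 h3 => by
    have := (i1 (a + h) (b + h) (by linarith) (by linarith) (by linarith)).comp_add_right h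
    simpa using this
  refine ⟨(i2 p q le_rfl hpq le_rfl).norm.add (i1 p q hp.le hpq (by linarith)).norm,
    fun a b ha hab hb => ?_⟩
  have i3 := i1 a b (by linarith) hab (by linarith)
  rw [intervalIntegral.integral_add (i2 a b ha hab hb).norm i3.norm]
  have e1 := intervalIntegral.integral_interval_sub_interval_comm
    (i1 b (b + h) (by linarith) (by linarith) (by linarith))
    (i1 a (a + h) (by linarith) (by linarith) (by linarith)) i3.symm
  rw [intervalIntegral.integral_symm a b, intervalIntegral.integral_symm (a + h) (b + h)] at e1
  rw [e1, neg_sub_neg, ← intervalIntegral.integral_comp_add_right]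
  exact (norm_sub_le _ _).trans (add_le_add (intervalIntegral.norm_integral_le_integral_norm hab)
    (intervalIntegral.norm_integral_le_integral_norm hab))

theorem ae_hasDerivAt_integral_shift {G : Type*} [NormedAddCommGroup G] [NormedSpace ℝ G]
    [CompleteSpace G] {f : ℝ → G} (hf : IntegrableOn f (Ioo s τ)) {h : ℝ} (hh : 0 < h) :
    ∀ᵐ t, t ∈ Ioo s (τ - h) → HasDerivAt (fun t => ∫ r in t..t + h, f r) (f (t + h) - f t) t := by
  rcases le_or_gt τ s with hsτ | hsτ
  · exact Eventually.of_forall fun t ht => absurd (ht.1.trans ht.2) (by linarith)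
  have h1 := (intervalIntegrable_sub hf le_rfl hsτ.le le_rfl).ae_hasDerivAt_integral
  have h2 := (measurePreserving_add_right volume h).quasiMeasurePreserving.ae h1
  filter_upwards [h1, h2] with t h1 h2 ht
  rw [uIcc_of_le hsτ.le] at h1 h2
  have h3 := h1 ⟨ht.1.le, by linarith [ht.2]⟩ s ⟨le_rfl, hsτ.le⟩
  have h4 := h2 ⟨by linarith [ht.1], by linarith [ht.2]⟩ s ⟨le_rfl, hsτ.le⟩
  refine ((HasDerivAt.comp_add_const t h h4).sub h3).congr_of_eventuallyEq ?_
  filter_upwards [Ioo_mem_nhds ht.1 ht.2] with r hr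
  rw [Pi.sub_apply, intervalIntegral.integral_interval_sub_left]
  · exact intervalIntegrable_sub hf le_rfl (by linarith [hr.1]) (by linarith [hr.2])
  · exact intervalIntegrable_sub hf le_rfl (by linarith [hr.1]) (by linarith [hr.2])

/-- The energy estimate for the increments of a weak solution. -/
theorem integral_increment_le (hw : E.IsWeakSol x U U' s τ) (hs : 0 ≤ s) (hτ : τ ≤ T) {R : ℝ}
    (hR : ∀ t ∈ Icc s τ, ‖x t‖ ≤ R) [CompleteSpace F] {p q h : ℝ} (hh : 0 < h)
    (hp : s < p) (hpq : p ≤ q) (hq : q + h < τ) :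
    E.c * (∫ t in p..q, ‖x (t + h) - x t‖ ^ 2)
        + E.a q (∫ r in q..q + h, U r) (∫ r in q..q + h, U r)
      ≤ E.K * h * (∫ r in p..p + h, ‖U r‖ ^ 2)
        + h ^ 2 * (6 * E.K * (∫ r in Ioo s τ, ‖U r‖ ^ 2) + 4 * E.K ^ 2 * R ^ 2 / E.c * (τ - s)) := by
  have hK := E.K_nonneg
  have hc := E.c_pos
  have hI : ∀ t ∈ Ioo s τ, t ∈ Ioo 0 T := fun t ht => ⟨hs.trans_lt ht.1, ht.2.trans_le hτ⟩
  set Y : ℝ → F := fun t => ∫ r in t..t + h, U r with hY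
  set B : ℝ → ℝ := fun t => ∫ r in t..t + h, ‖U r‖ ^ 2 with hB
  set M := ∫ r in Ioo s τ, ‖U r‖ ^ 2 with hM
  set RY := ∫ r in Ioo s τ, ‖U r‖ with hRY
  have hsub : ∀ t ∈ Icc p q, t ∈ Ioo s τ := fun t ht => ⟨by linarith [ht.1], by linarith [ht.2]⟩
  have hYA : ∀ t ∈ Icc p q, ‖Y t‖ ≤ ∫ r in t..t + h, ‖U r‖ := fun t _ =>
    intervalIntegral.norm_integral_le_integral_norm (by linarith)
  have hYR : ∀ t ∈ Icc p q, ‖Y t‖ ≤ RY := fun t ht => by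
    refine (hYA t ht).trans ?_
    rw [intervalIntegral.integral_of_le (by linarith), integral_Ioc_eq_integral_Ioo]
    exact setIntegral_mono_set hw.integrableOn.norm (Eventually.of_forall fun _ => norm_nonneg _)
      (LE.le.eventuallyLE (Ioo_subset_Ioo (by linarith [ht.1]) (by linarith [ht.2])))
  have hRY0 : 0 ≤ RY := (norm_nonneg _).trans (hYR p ⟨le_rfl, hpq⟩)
  have hYB : ∀ t ∈ Icc p q, ‖Y t‖ ^ 2 ≤ h * B t := fun t ht => by
    have i1 : IntervalIntegrable U volume t (t + h) :=
      intervalIntegrable_sub hw.integrableOn (by linarith [ht.1]) (by linarith) (by linarith [ht.2])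
    exact (pow_le_pow_left₀ (norm_nonneg _) (hYA t ht) 2).trans (sq_integral_norm_le hh i1.norm
      (intervalIntegrable_sub hw.integrableOn_sq (by linarith [ht.1]) (by linarith)
        (by linarith [ht.2])))
  have hYac := hasACDensity_integral_shift hw.integrableOn hh hp hpq hq
  have hac : HasACDensity (fun t => E.a t (Y t) (Y t))
      (fun t => (2 * E.K * RY) * (‖U (t + h)‖ + ‖U t‖) + E.K * RY ^ 2) p q := by
    refine hYac.of_norm_sub_le (by positivity) fun c d hc hcd hd => ?_
    have hc' : c ∈ Icc p q := ⟨hc, hcd.trans hd⟩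
    have hd' : d ∈ Icc p q := ⟨hc.trans hcd, hd⟩
    have h1 : E.a d (Y d) (Y d) - E.a c (Y c) (Y c) = (E.a c (Y d) (Y d) - E.a c (Y c) (Y c))
        + (E.a d (Y d) (Y d) - E.a c (Y d) (Y d)) := by ring
    rw [h1]
    refine (norm_add_le _ _).trans (add_le_add
      (abs_a_self_sub_le (hI c (hsub c hc')) (hYR d hd') (hYR c hc')) ?_)
    refine (abs_a_sub_le (hI d (hsub d hd')) (hI c (hsub c hc')) _ _).trans ?_
    have h0 : 0 ≤ d - c := sub_nonneg.2 hcd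
    rw [abs_of_nonneg h0]
    have := hYR d hd'
    calc _ ≤ E.K * (d - c) * RY * RY := by gcongr
      _ = _ := by ring
  set δ : ℝ → ℝ := fun t => ‖x (t + h) - x t‖ ^ 2 with hδ
  have iδ : IntervalIntegrable δ volume p q := by
    refine ContinuousOn.intervalIntegrable ?_
    rw [uIcc_of_le hpq]
    have h1 : ContinuousOn (fun t => x (t + h)) (Icc p q) :=
      hw.continuousOn.comp (by fun_prop) fun t ht => ⟨by linarith [ht.1], by linarith [ht.2]⟩
    exact ((h1.sub (hw.continuousOn.mono fun t ht => Ioo_subset_Icc_self (hsub t ht))).norm).pow 2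
  obtain ⟨iB, hBM⟩ := integral_shift_sub_le (fun t => sq_nonneg ‖U t‖) hw.integrableOn_sq hh hp hpq hq
  have iU := intervalIntegrable_sub hw.integrableOn_sq hp.le hpq (by linarith : q ≤ τ)
  have iUh : IntervalIntegrable (fun t => ‖U (t + h)‖ ^ 2) volume p q := by
    have := (intervalIntegrable_sub hw.integrableOn_sq (by linarith : s ≤ p + h)
      (by linarith : p + h ≤ q + h) hq.le).comp_add_right h
    simpa using this
  have hUM : ∫ t in p..q, ‖U t‖ ^ 2 ≤ M := by
    rw [intervalIntegral.integral_of_le hpq, integral_Ioc_eq_integral_Ioo]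
    exact setIntegral_mono_set hw.integrableOn_sq (Eventually.of_forall fun _ => sq_nonneg _)
      (LE.le.eventuallyLE (Ioo_subset_Ioo hp.le (by linarith)))
  have hUhM : ∫ t in p..q, ‖U (t + h)‖ ^ 2 ≤ M := by
    rw [intervalIntegral.integral_comp_add_right (fun t => ‖U t‖ ^ 2),
      intervalIntegral.integral_of_le (by linarith), integral_Ioc_eq_integral_Ioo]
    exact setIntegral_mono_set hw.integrableOn_sq (Eventually.of_forall fun _ => sq_nonneg _)
      (LE.le.eventuallyLE (Ioo_subset_Ioo (by linarith) hq.le))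
  set C := 4 * E.K ^ 2 * R ^ 2 / E.c with hC
  have hC0 : 0 ≤ C := by positivity
  -- Since `Y' = U(t+h) - U(t)`, the derivative of `a t (Y t) (Y t)` is `2 a t (Y t) Y'` plus a term
  -- from the motion of `a`. Twice `norm_increment_le` bounds the first part, with a term `K h B`;
  -- the second is at most `K ‖Y‖² ≤ K h B`. Hence the coefficient `2 K h`.
  have key := hac.sub_le_integral hpq
    (G := fun t => ((-E.c * δ t + 2 * E.K * h * B t)
      + 2 * E.K * h ^ 2 * (‖U (t + h)‖ ^ 2 + ‖U t‖ ^ 2)) + C * h ^ 2)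
    ((((iδ.const_mul _).add (iB.const_mul _)).add ((iUh.add iU).const_mul _)).add
      intervalIntegrable_const) ?_
  · rw [intervalIntegral.integral_add
      (((iδ.const_mul _).add (iB.const_mul _)).add ((iUh.add iU).const_mul _))
      intervalIntegrable_const, intervalIntegral.integral_add
      ((iδ.const_mul _).add (iB.const_mul _)) ((iUh.add iU).const_mul _),
      intervalIntegral.integral_add (iδ.const_mul _) (iB.const_mul _),
      intervalIntegral.integral_const_mul, intervalIntegral.integral_const_mul,
      intervalIntegral.integral_const_mul, intervalIntegral.integral_add iUh iU,
      intervalIntegral.integral_const, smul_eq_mul] at key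
    have hp' : p ∈ Icc p q := ⟨le_rfl, hpq⟩
    have e1 : E.a p (Y p) (Y p) ≤ E.K * (h * B p) := by
      refine (le_abs_self _).trans ((abs_a_le (hI p (hsub p hp')) _ _).trans ?_)
      rw [mul_assoc, ← sq]
      exact mul_le_mul_of_nonneg_left (hYB p hp') hK
    have e2 : 2 * E.K * h * (∫ t in p..q, B t) ≤ 2 * E.K * h * (h * M) := by gcongr
    have e3 : 2 * E.K * h ^ 2 * ((∫ t in p..q, ‖U (t + h)‖ ^ 2) + ∫ t in p..q, ‖U t‖ ^ 2)
        ≤ 2 * E.K * h ^ 2 * (M + M) := by gcongr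
    have e4 : (q - p) * (C * h ^ 2) ≤ (τ - s) * (C * h ^ 2) :=
      mul_le_mul_of_nonneg_right (by linarith) (by positivity)
    simp only [hδ] at key
    linarith
  · have hshift := (measurePreserving_add_right volume h).quasiMeasurePreserving.ae hw.ae_eq
    filter_upwards [hw.ae_eq, hshift, ae_hasDerivAt_integral_shift hw.integrableOn hh] with
      t h1 h2 h3 ht ε hε
    have htpq := Ioo_subset_Icc_self ht
    have hts := hsub t htpq
    have hths : t + h ∈ Ioo s τ := ⟨by linarith [hts.1], by linarith [ht.2]⟩
    have htI := hI t hts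
    have e1 := hw.norm_increment_le hs hτ hR hh hts.1 hths.2 (h1 hts) (h2 hths)
    have h4 : HasDerivAt Y (U (t + h) - U t) t := h3 ⟨hts.1, by linarith [ht.2]⟩
    have h5 : HasDerivAt (fun r => E.a t (Y r) (Y r))
        (E.a t (U (t + h) - U t) (Y t) + E.a t (Y t) (U (t + h) - U t)) t :=
      ((E.a t).hasFDerivAt.comp_hasDerivAt t h4).clm_apply h4
    have h6 := (hasDerivAt_iff_tendsto_slope.1 h5).mono_left
      (nhdsWithin_mono t (fun r (hr : t < r) => hr.ne') : 𝓝[>] t ≤ 𝓝[≠] t)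
    have h7 : Tendsto (fun r => E.K * ‖Y r‖ ^ 2) (𝓝[>] t) (𝓝 (E.K * ‖Y t‖ ^ 2)) :=
      ((h4.continuousAt.tendsto.norm.pow 2).const_mul _).mono_left nhdsWithin_le_nhds
    filter_upwards [h6.eventually (gt_mem_nhds (lt_add_of_pos_right _ (half_pos hε))),
      h7.eventually (gt_mem_nhds (lt_add_of_pos_right _ (half_pos hε))),
      Ioo_mem_nhdsGT ht.2] with r h8 h9 hr
    have hr0 : 0 < r - t := sub_pos.2 hr.1
    rw [slope_def_field, div_lt_iff₀ hr0, E.a_symm t htI (U (t + h) - U t)] at h8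
    have hrI := hI r (hsub r ⟨htpq.1.trans hr.1.le, hr.2.le⟩)
    have h10 := (le_abs_self _).trans (abs_a_sub_le (E := E) hrI htI (Y r) (Y r))
    rw [abs_of_pos hr0] at h10
    have h11 : E.K * (r - t) * ‖Y r‖ * ‖Y r‖ ≤ (E.K * ‖Y t‖ ^ 2 + ε / 2) * (r - t) := by
      calc _ = E.K * ‖Y r‖ ^ 2 * (r - t) := by ring
        _ ≤ _ := by gcongr
    have h12 : E.K * ‖Y t‖ ^ 2 ≤ E.K * (h * B t) := mul_le_mul_of_nonneg_left (hYB t htpq) hK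
    have h13 : E.a r (Y r) (Y r) - E.a t (Y t) (Y t)
        ≤ (2 * E.a t (Y t) (U (t + h) - U t) + E.K * ‖Y t‖ ^ 2 + ε) * (r - t) := by linarith
    refine h13.trans (mul_le_mul_of_nonneg_right ?_ hr0.le)
    have h14 : C * h ^ 2 = 2 * (2 * E.K ^ 2 * R ^ 2 / E.c * h ^ 2) := by rw [hC]; ring
    simp only [hδ]
    linarith

end IsWeakSol
end FormFlow

theorem tendsto_inv_smul_integral {H : Type*} [NormedAddCommGroup H] [NormedSpace ℝ H]
    [CompleteSpace H] {x : ℝ → H} {s c τ : ℝ} (hx : ContinuousOn x (Ioo s τ)) (hc : c ∈ Ioo s τ) :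
    Tendsto (fun h => h⁻¹ • ∫ t in c..c + h, x t) (𝓝[>] 0) (𝓝 (x c)) := by
  have h1 : HasDerivAt (fun u => ∫ t in c..u, x t) (x c) c :=
    intervalIntegral.integral_hasDerivAt_right (by simp)
      (hx.stronglyMeasurableAtFilter isOpen_Ioo c hc) (hx.continuousAt (Ioo_mem_nhds hc.1 hc.2))
  simpa using h1.tendsto_slope_zero_right

/-- A continuous curve whose difference quotients are bounded in `L²` is absolutely continuous. -/
theorem exists_hasACDensity_of_integral_increment_le {H : Type*} [NormedAddCommGroup H]
    [NormedSpace ℝ H] [CompleteSpace H] {x : ℝ → H} {s p q τ C h₀ : ℝ} (hsp : s < p) (hpq : p ≤ q)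
    (hqτ : q < τ) (hx : ContinuousOn x (Ioo s τ)) (hh₀ : 0 < h₀)
    (hC : ∀ h, 0 < h → h < h₀ → q + h < τ → ∫ t in p..q, ‖x (t + h) - x t‖ ^ 2 ≤ C ^ 2 * h ^ 2) :
    ∃ k, HasACDensity x k p q := by
  set δ := min h₀ (τ - q) with hδ
  have hδ0 : 0 < δ := lt_min hh₀ (sub_pos.2 hqτ)
  let h : ℕ → ℝ := fun n => δ / (n + 2)
  have hh : ∀ n, 0 < h n ∧ h n < h₀ ∧ q + h n < τ := fun n => by
    have h1 : h n < δ := div_lt_self hδ0 (by linarith [n.cast_nonneg (α := ℝ)])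
    exact ⟨by positivity, h1.trans_le (min_le_left _ _), by linarith [min_le_right h₀ (τ - q)]⟩
  have hlim : Tendsto h atTop (𝓝[>] 0) := tendsto_nhdsWithin_iff.2
    ⟨tendsto_const_nhds.div_atTop (tendsto_natCast_atTop_atTop.atTop_add tendsto_const_nhds),
      Eventually.of_forall fun n => (hh n).1⟩
  let G : ℕ → ℝ → ℝ := fun n t => ‖x (t + h n) - x t‖ / h n
  let μ := (volume : Measure ℝ).restrict (Ioc p q)
  have hsh : ∀ n, ContinuousOn (fun t => x (t + h n)) (Icc p q) := fun n =>
    hx.comp (by fun_prop) fun t ht => ⟨by linarith [ht.1, (hh n).1], by linarith [ht.2, (hh n).2.2]⟩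
  have hxc : ContinuousOn x (Icc p q) := hx.mono (Icc_subset_Ioo hsp hqτ)
  have hGc : ∀ n, ContinuousOn (G n) (Icc p q) := fun n =>
    (((hsh n).sub hxc).norm).div_const _
  have hGm : ∀ n, MemLp (G n) 2 μ := fun n => by
    have hm : AEStronglyMeasurable (G n) μ :=
      ((hGc n).mono Ioc_subset_Icc_self).aestronglyMeasurable measurableSet_Ioc
    rw [memLp_two_iff_integrable_sq_norm hm]
    exact (((hGc n).norm.pow 2).integrableOn_Icc).mono_set Ioc_subset_Icc_self
  have hGn : ∀ n, ‖(hGm n).toLp (G n)‖ ≤ |C| := fun n => by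
    rw [← sq_le_sq₀ (norm_nonneg _) (abs_nonneg _), ← real_inner_self_eq_norm_sq, L2.inner_def]
    have h1 : ∫ t, ⟪(hGm n).toLp (G n) t, (hGm n).toLp (G n) t⟫ ∂μ
        = ∫ t in p..q, ‖x (t + h n) - x t‖ ^ 2 * ((h n) ^ 2)⁻¹ := by
      rw [intervalIntegral.integral_of_le hpq]
      refine integral_congr_ae ?_
      filter_upwards [(hGm n).coeFn_toLp] with t ht
      rw [ht]
      simp only [G]
      rw [real_inner_self_eq_norm_sq, norm_div, norm_norm, Real.norm_of_nonneg (hh n).1.le, div_pow,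
        div_eq_mul_inv]
    rw [h1, intervalIntegral.integral_mul_const, sq_abs, ← div_eq_mul_inv,
      div_le_iff₀ (by have := (hh n).1; positivity)]
    exact hC _ (hh n).1 (hh n).2.1 (hh n).2.2
  -- The density is a weak `L²` limit of the norms of the difference quotients. Testing with the
  -- indicator of `(a, b]` passes the bound to the limit, because averages of `x` near `b` minus
  -- averages near `a` are integrals of difference quotients over `[a, b]`.
  obtain ⟨g, -, hg⟩ := exists_weak_limit hGn
  have hgi : IntegrableOn g (Ioc p q) := (Lp.memLp g).integrable one_le_two
  refine ⟨g, (intervalIntegrable_iff_integrableOn_Ioc_of_le hpq).2 hgi, fun a b ha hab hb => ?_⟩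
  have hsub : Ioc a b ⊆ Ioc p q := Ioc_subset_Ioc ha hb
  have h1 : Tendsto (fun n => ∫ t in a..b, G n t) (hyperfilter ℕ) (𝓝 (∫ t in a..b, g t)) := by
    have hμ : μ (Ioc a b) ≠ ⊤ := (measure_lt_top _ _).ne
    have h2 := hg (indicatorConstLp 2 measurableSet_Ioc hμ (1 : ℝ))
    have h3 : ∀ f : Lp ℝ 2 μ, ⟪f, indicatorConstLp 2 measurableSet_Ioc hμ (1 : ℝ)⟫
        = ∫ t in a..b, f t := fun f => by
      rw [real_inner_comm, L2.inner_indicatorConstLp_one, intervalIntegral.integral_of_le hab,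
        Measure.restrict_restrict measurableSet_Ioc, inter_eq_left.2 hsub]
    simp only [h3] at h2
    refine h2.congr fun n => ?_
    rw [intervalIntegral.integral_of_le hab, intervalIntegral.integral_of_le hab]
    exact integral_congr_ae (ae_restrict_of_ae_restrict_of_subset hsub (hGm n).coeFn_toLp)
  have havg : ∀ c ∈ Icc p q, Tendsto (fun n => (h n)⁻¹ • ∫ t in c..c + h n, x t) atTop (𝓝 (x c)) := by
    exact fun c hc => (tendsto_inv_smul_integral hx
      ⟨hsp.trans_le hc.1, hc.2.trans_lt hqτ⟩).comp hlim
  refine le_of_tendsto_of_tendsto (((havg b ⟨ha.trans hab, hb⟩).sub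
    (havg a ⟨ha, hab.trans hb⟩)).norm.mono_left Nat.hyperfilter_le_atTop) h1
    (Eventually.of_forall fun n => ?_)
  have hn := (hh n)
  have i1 : ∀ c d, p ≤ c → c ≤ d → d < τ → IntervalIntegrable x volume c d := fun c d h1 h2 h3 =>
    (hx.mono (by rw [uIcc_of_le h2]; exact Icc_subset_Ioo (hsp.trans_le h1) h3)).intervalIntegrable
  have i2 : IntervalIntegrable (fun t => x (t + h n)) volume a b :=
    ((hsh n).mono (by rw [uIcc_of_le hab]; exact Icc_subset_Icc ha hb)).intervalIntegrable
  have i3 := i1 a b ha hab (by linarith)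
  have e1 := intervalIntegral.integral_interval_sub_interval_comm
    (i1 b (b + h n) (by linarith) (by linarith) (by linarith))
    (i1 a (a + h n) (by linarith) (by linarith) (by linarith)) i3.symm
  rw [intervalIntegral.integral_symm a b, intervalIntegral.integral_symm (a + h n) (b + h n),
    neg_sub_neg, ← intervalIntegral.integral_comp_add_right, ← intervalIntegral.integral_sub i2 i3]
    at e1
  simp only
  rw [← smul_sub, e1, norm_smul, norm_inv, Real.norm_of_nonneg hn.1.le, inv_mul_le_iff₀ hn.1,
    ← intervalIntegral.integral_const_mul]
  refine (intervalIntegral.norm_integral_le_integral_norm hab).trans (le_of_eq ?_)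
  refine intervalIntegral.integral_congr fun t _ => ?_
  have := hn.1.ne'
  simp only [G]
  field_simp

namespace FormFlow

variable {F H : Type*} [NormedAddCommGroup F] [InnerProductSpace ℝ F]
    [NormedAddCommGroup H] [InnerProductSpace ℝ H] {T L : ℝ} {E : FormFlow F H T L}

namespace IsWeakSol

variable {x : ℝ → H} {U : ℝ → F} {U' : ℝ → StrongDual ℝ F} {s τ : ℝ}

/-- The starting time `p` is a point where the primitive of `‖U‖²` is differentiable, so `∫_p^{p+h}
‖U‖² ≤ (‖U p‖² + 1) h` for small `h` and the whole right side of `integral_increment_le` is `O(h²)`.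
The summand `R²` in the constant comes from the `H`-norm in the coercivity of `a`. -/
theorem exists_integral_increment_le (hw : E.IsWeakSol x U U' s τ) (hs : 0 ≤ s) (hτ : τ ≤ T)
    [CompleteSpace F] [CompleteSpace H] {p₀ : ℝ} (hp₀ : s < p₀) (hp₀τ : p₀ < τ) :
    ∃ p C h₀, p ∈ Ioo s p₀ ∧ 0 ≤ C ∧ 0 < h₀ ∧ ∀ h q, 0 < h → h < h₀ → p ≤ q → q + h < τ →
      (∫ t in p..q, ‖x (t + h) - x t‖ ^ 2 ≤ C ^ 2 * h ^ 2) ∧ ‖∫ t in q..q + h, U t‖ ≤ C * h := by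
  have hK := E.K_nonneg
  have hc := E.c_pos
  have hsτ := hp₀.trans hp₀τ
  obtain ⟨R, hR0, hR⟩ := hw.exists_norm_le
  have hii := intervalIntegrable_sub hw.integrableOn_sq le_rfl hsτ.le le_rfl
  have hne : (volume.restrict (Ioo s p₀)) ≠ 0 := by
    rw [Ne, Measure.restrict_eq_zero, Real.volume_Ioo, ENNReal.ofReal_eq_zero]
    linarith
  have : (ae (volume.restrict (Ioo s p₀))).NeBot := ae_neBot.2 hne
  have hex := ((ae_restrict_of_ae (s := Ioo s p₀) hii.ae_hasDerivAt_integral).and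
    (ae_restrict_mem measurableSet_Ioo)).exists
  obtain ⟨p, hpd, hp⟩ := hex
  have hps : p ∈ uIcc s τ := by
    rw [uIcc_of_le hsτ.le]; exact ⟨hp.1.le, (hp.2.trans hp₀τ).le⟩
  have hpd := hpd hps p hps
  set M := ∫ r in Ioo s τ, ‖U r‖ ^ 2 with hM
  have hM0 : 0 ≤ M := integral_nonneg fun _ => sq_nonneg _
  set C₁ := E.K * (‖U p‖ ^ 2 + 1) + (6 * E.K * M + 4 * E.K ^ 2 * R ^ 2 / E.c * (τ - s)) with hC₁
  have hC₁0 : 0 ≤ C₁ := by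
    have : 0 ≤ τ - s := by linarith
    positivity
  have h1 := hpd.tendsto_slope_zero_right
  simp only [intervalIntegral.integral_same, sub_zero, smul_eq_mul] at h1
  obtain ⟨h₀, hh₀, h2⟩ := mem_nhdsGT_iff_exists_Ioo_subset.1
    (h1.eventually (gt_mem_nhds (lt_add_one _)))
  refine ⟨p, Real.sqrt ((C₁ + R ^ 2) / E.c), h₀, hp, Real.sqrt_nonneg _, hh₀,
    fun h q hh hhh hpq hq => ?_⟩
  have h3 : h⁻¹ * ∫ t in p..p + h, ‖U t‖ ^ 2 < ‖U p‖ ^ 2 + 1 := h2 ⟨hh, hhh⟩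
  rw [inv_mul_lt_iff₀ hh] at h3
  have h4 := hw.integral_increment_le hs hτ hR hh hp.1 hpq hq
  have hqI : q ∈ Ioo 0 T := ⟨by linarith [hp.1], by linarith⟩
  have h5 := E.a_nonneg q hqI (∫ r in q..q + h, U r)
  have h6 : E.K * h * (∫ r in p..p + h, ‖U r‖ ^ 2) ≤ E.K * h * (h * (‖U p‖ ^ 2 + 1)) := by
    gcongr
  have h7 : E.c * (∫ t in p..q, ‖x (t + h) - x t‖ ^ 2)
      + E.a q (∫ r in q..q + h, U r) (∫ r in q..q + h, U r) ≤ C₁ * h ^ 2 := by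
    rw [hC₁]; linarith
  have hδ0 : 0 ≤ ∫ t in p..q, ‖x (t + h) - x t‖ ^ 2 :=
    intervalIntegral.integral_nonneg hpq fun _ _ => sq_nonneg _
  rw [Real.sq_sqrt (by positivity)]
  have h8 : (C₁ + R ^ 2) / E.c * h ^ 2 = ((C₁ + R ^ 2) * h ^ 2) / E.c := by ring
  have hRh : 0 ≤ R ^ 2 * h ^ 2 := by positivity
  constructor
  · rw [h8, le_div_iff₀' hc]
    linarith
  · have hUi : IntervalIntegrable U volume q (q + h) :=
      intervalIntegrable_sub hw.integrableOn (by linarith [hp.1]) (by linarith) hq.le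
    have h9 : ‖E.ι (∫ r in q..q + h, U r)‖ ≤ R * h := by
      have e1 := E.ι.intervalIntegral_comp_comm hUi
      rw [← e1]
      have e2 : ∀ᵐ t, t ∈ Ioc q (q + h) → ‖E.ι (U t)‖ ≤ R := by
        filter_upwards [hw.ae_eq] with t ht htq
        have hts : t ∈ Ioo s τ := ⟨by linarith [htq.1, hp.1], by linarith [htq.2]⟩
        rw [ht hts]
        exact hR t (Ioo_subset_Icc_self hts)
      have e3 := intervalIntegral.norm_integral_le_of_norm_le_const_ae (a := q) (b := q + h)
        (f := fun t => E.ι (U t)) (C := R) (by rwa [uIoc_of_le (by linarith)])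
      rwa [add_sub_cancel_left, abs_of_pos hh] at e3
    have h10 := E.a_coercive q hqI (∫ r in q..q + h, U r)
    have h11 : ‖E.ι (∫ r in q..q + h, U r)‖ ^ 2 ≤ R ^ 2 * h ^ 2 := by
      rw [← mul_pow]; exact pow_le_pow_left₀ (norm_nonneg _) h9 2
    refine (sq_le_sq₀ (norm_nonneg _) (by positivity)).1 ?_
    rw [mul_pow, Real.sq_sqrt (by positivity), h8, le_div_iff₀' hc]
    have := mul_nonneg hc.le hδ0
    linarith

/-- Weak solutions take values in `F`, locally boundedly away from the initial time. -/
theorem exists_bound (hw : E.IsWeakSol x U U' s τ) (hs : 0 ≤ s) (hτ : τ ≤ T)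
    [CompleteSpace F] [CompleteSpace H] {p₀ : ℝ} (hp₀ : s < p₀) (hp₀τ : p₀ < τ) :
    ∃ C, ∀ t ∈ Ico p₀ τ, ∃ u, E.ι u = x t ∧ ‖u‖ ≤ C := by
  obtain ⟨p, C, h₀, hp, hC, hh₀, key⟩ := hw.exists_integral_increment_le hs hτ hp₀ hp₀τ
  refine ⟨C, fun t ht => ?_⟩
  have hts : t ∈ Ioo s τ := ⟨hp₀.trans_le ht.1, ht.2⟩
  have hδ0 : 0 < min h₀ (τ - t) := lt_min hh₀ (sub_pos.2 ht.2)
  let h : ℕ → ℝ := fun n => min h₀ (τ - t) / (n + 2)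
  have hh : ∀ n, 0 < h n ∧ h n < h₀ ∧ t + h n < τ := fun n => by
    have h1 : h n < min h₀ (τ - t) := div_lt_self hδ0 (by linarith [n.cast_nonneg (α := ℝ)])
    exact ⟨by positivity, h1.trans_le (min_le_left _ _), by linarith [min_le_right h₀ (τ - t)]⟩
  have hlim : Tendsto h atTop (𝓝[>] 0) := tendsto_nhdsWithin_iff.2
    ⟨tendsto_const_nhds.div_atTop (tendsto_natCast_atTop_atTop.atTop_add tendsto_const_nhds),
      Eventually.of_forall fun n => (hh n).1⟩
  -- The averages of `U` over `[t, t + h]` are bounded in `F` and converge to `x t` in `H`. This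
  -- works at every `t`, whereas `ι (U t) = x t` is known only almost everywhere.
  refine exists_of_tendsto_of_norm_le (u := fun n => (h n)⁻¹ • ∫ r in t..t + h n, U r)
    (fun n => ?_) ?_
  · have h1 := (key (h n) t (hh n).1 (hh n).2.1 (hp.2.le.trans ht.1) (hh n).2.2).2
    rw [norm_smul, norm_inv, Real.norm_of_nonneg (hh n).1.le, inv_mul_le_iff₀ (hh n).1]
    linarith
  · refine ((tendsto_inv_smul_integral (hw.continuousOn.mono Ioo_subset_Icc_self) hts).comp
      hlim).congr fun n => ?_
    have hUi : IntervalIntegrable U volume t (t + h n) :=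
      intervalIntegrable_sub hw.integrableOn hts.1.le (by linarith [(hh n).1]) (hh n).2.2.le
    rw [map_smul, ← E.ι.intervalIntegral_comp_comm hUi, Function.comp_apply]
    congr 1
    refine intervalIntegral.integral_congr_ae ?_
    filter_upwards [hw.ae_eq] with r hr hrt
    rw [uIoc_of_le (by linarith [(hh n).1])] at hrt
    exact (hr ⟨hts.1.trans hrt.1, hrt.2.trans_lt (hh n).2.2⟩).symm

/-- Weak solutions are strong solutions. -/
theorem isStrongSol (hw : E.IsWeakSol x U U' s τ) (hs : 0 ≤ s) (hτ : τ ≤ T)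
    [CompleteSpace F] [CompleteSpace H] : E.IsStrongSol x U s τ := by
  refine ⟨fun p q hp hpq hq => ?_, hw.ae_tendsto hs hτ⟩
  obtain ⟨p', C, h₀, hp', hC, hh₀, key⟩ := hw.exists_integral_increment_le hs hτ hp (hpq.trans_lt hq)
  obtain ⟨k, hk⟩ := exists_hasACDensity_of_integral_increment_le hp'.1 (hp'.2.le.trans hpq) hq
    (hw.continuousOn.mono Ioo_subset_Icc_self) hh₀
    fun h h1 h2 h3 => (key h q h1 h2 (hp'.2.le.trans hpq) h3).1
  exact ⟨k, hk.mono hp'.2.le hpq le_rfl⟩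

end IsWeakSol
end FormFlow

/-! ### The dynamic distance -/

/-- No integrability is needed, since the integral of a non-integrable function is `0` by
convention. -/
theorem ofReal_integral_le_lintegral {α : Type*} [MeasurableSpace α] {μ : Measure α} (f : α → ℝ) :
    ENNReal.ofReal (∫ a, f a ∂μ) ≤ ∫⁻ a, ENNReal.ofReal (f a) ∂μ := by
  by_cases hf : Integrable f μ
  · rw [integral_eq_lintegral_pos_part_sub_lintegral_neg_part hf]
    exact (ENNReal.ofReal_le_ofReal (sub_le_self _ ENNReal.toReal_nonneg)).trans
      ENNReal.ofReal_toReal_le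
  · rw [integral_undef hf, ENNReal.ofReal_zero]
    exact zero_le

/-- The mean of `1 - a` is `1/2`: this is the origin of the factor `L/2`, rather than `L`, in the
comparison of the dynamic distance with the distance at time `t`. -/
theorem integral_one_add_mul_sub (c : ℝ) :
    ∫ a in (0 : ℝ)..1, (1 + c * (1 - a) + c ^ 2) = 1 + c / 2 + c ^ 2 := by
  have h : ∀ a : ℝ, 1 + c * (1 - a) + c ^ 2 = (1 + c + c ^ 2) - c * a := fun a => by ring
  simp only [h]
  rw [intervalIntegral.integral_sub intervalIntegrable_const
      (Continuous.intervalIntegrable (by fun_prop) _ _),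
    intervalIntegral.integral_const_mul, integral_id, intervalIntegral.integral_const]
  simp
  ring

theorem exp_le_one_add {c a : ℝ} (hc : 0 ≤ c) (hc1 : c ≤ 1) (ha : a ∈ Ioo (0 : ℝ) 1) :
    Real.exp (c * (1 - a)) ≤ 1 + c * (1 - a) + c ^ 2 := by
  have h0 : 0 ≤ c * (1 - a) := mul_nonneg hc (by linarith [ha.2])
  have h1 : c * (1 - a) ≤ c := mul_le_of_le_one_right hc (by linarith [ha.1])
  have h2 := Real.abs_exp_sub_one_sub_id_le (x := c * (1 - a)) (by
    rw [abs_of_nonneg h0]; linarith)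
  have h3 := pow_le_pow_left₀ h0 h1 2
  linarith [(abs_le.1 h2).2]

namespace FormFlow

open DynEVI

variable {F H : Type*} [NormedAddCommGroup F] [InnerProductSpace ℝ F]
    [NormedAddCommGroup H] [InnerProductSpace ℝ H] {T L : ℝ} {E : FormFlow F H T L}

theorem abs_b_le_sqrt {t : ℝ} (ht : t ∈ Ioo 0 T) (u v : H) :
    |E.b t u v| ≤ Real.sqrt (E.b t u u) * Real.sqrt (E.b t v v) := by
  have h : E.b t u v ^ 2 ≤ E.b t u u * E.b t v v := by
    have := discrim_le_zero (a := E.b t v v) (b := 2 * E.b t u v) (c := E.b t u u) fun r => by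
      have h1 := b_nonneg (E := E) ht (u + r • v)
      simp only [map_add, map_smul, add_apply, smul_apply, smul_eq_mul, E.b_symm t ht v u] at h1
      linarith
    rw [discrim] at this
    linarith
  rw [← Real.sqrt_mul (b_nonneg ht u)]
  exact Real.abs_le_sqrt h

theorem b_self_sub_comm (t : ℝ) (u v : H) : E.b t (u - v) (u - v) = E.b t (v - u) (v - u) := by
  have h : u - v = -(v - u) := by abel
  rw [h]
  simp only [map_neg, neg_apply, neg_neg]

/-- `d` is the family of distances given by the scalar products `b t`. -/
def IsDist (E : FormFlow F H T L) (d : ℝ → H → H → ℝ) : Prop :=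
  ∀ t ∈ Ioo 0 T, ∀ v w, d t v w = Real.sqrt (E.b t (v - w) (v - w))

namespace IsDist

variable {d : ℝ → H → H → ℝ}

theorem sq_eq (hd : E.IsDist d) {t : ℝ} (ht : t ∈ Ioo 0 T) (v w : H) :
    d t v w ^ 2 = E.b t (v - w) (v - w) := by
  rw [hd t ht, Real.sq_sqrt (b_nonneg ht _)]

theorem mul_norm_le (hd : E.IsDist d) {t : ℝ} (ht : t ∈ Ioo 0 T) (v w : H) :
    Real.sqrt E.c * ‖v - w‖ ≤ d t v w := by
  rw [hd t ht, ← Real.sqrt_sq (norm_nonneg (v - w)), ← Real.sqrt_mul E.c_pos.le]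
  exact Real.sqrt_le_sqrt (E.b_coercive t ht _)

theorem le_mul_norm (hd : E.IsDist d) {t : ℝ} (ht : t ∈ Ioo 0 T) (v w : H) :
    d t v w ≤ Real.sqrt E.K * ‖v - w‖ := by
  rw [hd t ht, ← Real.sqrt_sq (norm_nonneg (v - w)), ← Real.sqrt_mul E.K_nonneg]
  refine Real.sqrt_le_sqrt ((le_abs_self _).trans ((abs_b_le ht _ _).trans_eq ?_))
  ring

theorem le_exp_mul (hd : E.IsDist d) {t r : ℝ} (ht : t ∈ Ioo 0 T) (hr : r ∈ Ioo 0 T) (v w : H) :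
    d t v w ≤ Real.exp (L * |t - r| / 2) * d r v w := by
  have h : Real.exp (L * |t - r| / 2) = Real.sqrt (Real.exp (L * |t - r|)) := Real.exp_half _
  rw [hd t ht, hd r hr, h, ← Real.sqrt_mul (Real.exp_pos _).le]
  exact Real.sqrt_le_sqrt (E.b_le_exp t ht r hr _)

theorem abs_interpolation_sub {s t a : ℝ} (ha : a ∈ Ioo (0 : ℝ) 1) :
    |s + a * (t - s) - t| = (1 - a) * |t - s| := by
  have : s + a * (t - s) - t = -((1 - a) * (t - s)) := by ring
  rw [this, abs_neg, abs_mul, abs_of_pos (by linarith [ha.2])]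

theorem interpolation_mem {s t a : ℝ} (hs : s ∈ Ioo 0 T) (ht : t ∈ Ioo 0 T)
    (ha : a ∈ Ioo (0 : ℝ) 1) : s + a * (t - s) ∈ Ioo 0 T := by
  have h := (convex_Ioo (0 : ℝ) T) hs ht (by linarith [ha.2] : 0 ≤ 1 - a) ha.1.le (by ring)
  simp only [smul_eq_mul] at h
  convert h using 1
  ring

/-- The straight segment is the competitor; its speed with respect to time `r` is the constant `b
r`-length of `x - y`. -/
theorem iInf_action_le (hd : E.IsDist d) {s t : ℝ} (hs : s ∈ Ioo 0 T) (ht : t ∈ Ioo 0 T)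
    (hL : L * |t - s| ≤ 1) (x y : H) :
    ⨅ γ ∈ curves T d x y, action d s t γ
      ≤ ENNReal.ofReal ((1 + L * |t - s| / 2 + (L * |t - s|) ^ 2) * E.b t (x - y) (x - y)) := by
  have hL0 : 0 ≤ L * |t - s| := mul_nonneg E.L_nonneg (abs_nonneg _)
  set D := E.b t (x - y) (x - y) with hD
  have hD0 : 0 ≤ D := b_nonneg ht _
  let γ : ℝ → H := fun a => x + a • (y - x)
  have hγ : ∀ a b, γ a - γ b = (b - a) • (x - y) := fun a b => by
    simp only [γ]; module
  have hdγ : ∀ r ∈ Ioo 0 T, ∀ a b, d r (γ a) (γ b) = |b - a| * Real.sqrt (E.b r (x - y) (x - y)) := by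
    intro r hr a b
    rw [hd r hr, hγ]
    simp only [map_smul, smul_apply, smul_eq_mul]
    rw [← mul_assoc, ← sq, Real.sqrt_mul (sq_nonneg _), Real.sqrt_sq_eq_abs]
  have hmem : γ ∈ curves T d x y := by
    refine ⟨fun r hr => ⟨fun _ => Real.sqrt (E.b r (x - y) (x - y)), by simp, fun p q _ hpq _ => ?_⟩,
      by simp [γ], by simp [γ]⟩
    rw [hdγ r hr, intervalIntegral.integral_const, smul_eq_mul, abs_of_nonneg (sub_nonneg.2 hpq)]
  refine (iInf₂_le γ hmem).trans ?_
  have hbound : ∀ a ∈ Ioo (0 : ℝ) 1, metricSpeed (d (s + a * (t - s))) γ a ^ 2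
      ≤ ENNReal.ofReal (D * (1 + L * |t - s| * (1 - a) + (L * |t - s|) ^ 2)) := by
    intro a ha
    have hr := interpolation_mem hs ht ha
    have h1 : metricSpeed (d (s + a * (t - s))) γ a
        = ENNReal.ofReal (Real.sqrt (E.b (s + a * (t - s)) (x - y) (x - y))) := by
      have h2 : (fun b => ENNReal.ofReal (d (s + a * (t - s)) (γ b) (γ a) / |b - a|)) =ᶠ[𝓝[≠] a]
          fun _ => ENNReal.ofReal (Real.sqrt (E.b (s + a * (t - s)) (x - y) (x - y))) := by
        filter_upwards [self_mem_nhdsWithin] with b hb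
        rw [hdγ _ hr, abs_sub_comm a b, mul_div_cancel_left₀]
        exact abs_ne_zero.2 (sub_ne_zero.2 hb)
      rw [metricSpeed, limsup_congr h2, limsup_const]
    rw [h1, ← ENNReal.ofReal_pow (Real.sqrt_nonneg _), Real.sq_sqrt (b_nonneg hr _)]
    refine ENNReal.ofReal_le_ofReal ?_
    have h3 := E.b_le_exp _ hr t ht (x - y)
    rw [abs_interpolation_sub ha] at h3
    have h4 := exp_le_one_add hL0 hL ha
    have h5 : L * ((1 - a) * |t - s|) = L * |t - s| * (1 - a) := by ring
    rw [h5] at h3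
    rw [mul_comm D]
    exact h3.trans (mul_le_mul_of_nonneg_right h4 hD0)
  have hi : IntervalIntegrable (fun a => D * (1 + L * |t - s| * (1 - a) + (L * |t - s|) ^ 2))
      volume 0 1 := Continuous.intervalIntegrable (by fun_prop) _ _
  calc action d s t γ
      ≤ ∫⁻ a in Ioo (0 : ℝ) 1, ENNReal.ofReal (D * (1 + L * |t - s| * (1 - a) + (L * |t - s|) ^ 2)) :=
        setLIntegral_mono' measurableSet_Ioo hbound
    _ = ENNReal.ofReal (∫ a in Ioo (0 : ℝ) 1, D * (1 + L * |t - s| * (1 - a) + (L * |t - s|) ^ 2)) := by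
        rw [ofReal_integral_eq_lintegral_ofReal]
        · exact (intervalIntegrable_iff_integrableOn_Ioo_of_le zero_le_one).1 hi
        · refine (ae_restrict_iff' measurableSet_Ioo).2 (Eventually.of_forall fun a ha => ?_)
          have : 0 ≤ 1 - a := by linarith [ha.2]
          simp only [Pi.zero_apply]
          positivity
    _ = _ := by
        rw [← integral_Ioc_eq_integral_Ioo, ← intervalIntegral.integral_of_le zero_le_one,
          intervalIntegral.integral_const_mul, integral_one_add_mul_sub, mul_comm]

/-- Only the component of `γ` along `v = y - x` matters: `ψ = b t γ v` is a real absolutely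
continuous function with total increment `D`, and by Cauchy–Schwarz and `b_le_exp` its derivative is
controlled by the metric speed at the intermediate time. No differentiability of `γ` in `H` is
needed. -/
theorem le_action (hd : E.IsDist d) {s t : ℝ} (hs : s ∈ Ioo 0 T) (ht : t ∈ Ioo 0 T)
    (hL : L * |t - s| ≤ 1) {x y : H} {γ : ℝ → H} (hγ : γ ∈ curves T d x y) :
    ENNReal.ofReal ((1 - L * |t - s| / 2 - (L * |t - s|) ^ 2) * E.b t (x - y) (x - y))
      ≤ action d s t γ := by
  have hL0 : 0 ≤ L * |t - s| := mul_nonneg E.L_nonneg (abs_nonneg _)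
  rw [b_self_sub_comm]
  set D := E.b t (y - x) (y - x) with hD
  rcases (b_nonneg (E := E) ht (y - x)).eq_or_lt with hD0 | hD0
  · rw [hD, ← hD0, mul_zero, ENNReal.ofReal_zero]; exact zero_le
  rw [← hD] at hD0
  have hsD : 0 < Real.sqrt D := Real.sqrt_pos.2 hD0
  obtain ⟨hac, rfl, rfl⟩ := hγ
  obtain ⟨g, hgi, hg⟩ := hac t ht
  set v := γ 1 - γ 0 with hv
  set ψ : ℝ → ℝ := fun a => E.b t (γ a) v with hψ
  have hψd : ∀ a b, |ψ b - ψ a| ≤ d t (γ b) (γ a) * Real.sqrt D := fun a b => by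
    rw [hψ, ← sub_apply, ← map_sub, hd t ht]
    exact abs_b_le_sqrt ht _ _
  have hdsymm : ∀ a b, d t (γ a) (γ b) = d t (γ b) (γ a) := fun a b => by
    rw [hd t ht, hd t ht, b_self_sub_comm]
  have hψac : HasACDensity ψ (fun r => g r * Real.sqrt D) 0 1 := by
    have hgi' : IntervalIntegrable g volume 0 1 :=
      (intervalIntegrable_iff_integrableOn_Icc_of_le zero_le_one).2 hgi
    refine ⟨hgi'.mul_const _, fun a b ha hab hb => ?_⟩
    rw [intervalIntegral.integral_mul_const]
    refine (hψd a b).trans (mul_le_mul_of_nonneg_right ?_ hsD.le)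
    rw [hdsymm]
    exact hg a b ha hab hb
  have hψAC := hψac.absolutelyContinuousOnInterval zero_le_one
  have hint : ∫ a in (0 : ℝ)..1, deriv ψ a = D := by
    rw [hψAC.integral_deriv_eq_sub, hψ, ← sub_apply, ← map_sub]
  have hdi := hψAC.intervalIntegrable_deriv
  have hbound : ∀ᵐ a, a ∈ Ioo (0 : ℝ) 1 →
      ENNReal.ofReal (2 * deriv ψ a - D * (1 + L * |t - s| * (1 - a) + (L * |t - s|) ^ 2))
        ≤ metricSpeed (d (s + a * (t - s))) γ a ^ 2 := by
    filter_upwards [hψAC.ae_differentiableAt] with a hda ha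
    have hda := (hda (by rw [uIcc_of_le zero_le_one]; exact Ioo_subset_Icc_self ha)).hasDerivAt
    set r := s + a * (t - s) with hrdef
    have hr : r ∈ Ioo 0 T := interpolation_mem hs ht ha
    set e := Real.exp (L * |t - r| / 2) with he
    have he0 : 0 < e := Real.exp_pos _
    have h1 : Tendsto (fun b => ENNReal.ofReal ((e * Real.sqrt D)⁻¹ * |slope ψ a b|)) (𝓝[≠] a)
        (𝓝 (ENNReal.ofReal ((e * Real.sqrt D)⁻¹ * |deriv ψ a|))) :=
      ENNReal.tendsto_ofReal ((hasDerivAt_iff_tendsto_slope.1 hda).abs.const_mul _)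
    have h2 : ENNReal.ofReal ((e * Real.sqrt D)⁻¹ * |deriv ψ a|) ≤ metricSpeed (d r) γ a := by
      rw [← h1.limsup_eq]
      refine limsup_le_limsup (Eventually.of_forall fun b => ENNReal.ofReal_le_ofReal ?_)
      rw [slope_def_field, abs_div, ← mul_div_assoc]
      refine div_le_div_of_nonneg_right ?_ (abs_nonneg _)
      rw [inv_mul_le_iff₀ (by positivity)]
      calc |ψ b - ψ a| ≤ d t (γ b) (γ a) * Real.sqrt D := hψd a b
        _ ≤ (e * d r (γ b) (γ a)) * Real.sqrt D := by gcongr; exact hd.le_exp_mul ht hr _ _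
        _ = _ := by ring
    refine le_trans ?_ (pow_le_pow_left₀ zero_le h2 2)
    rw [← ENNReal.ofReal_pow (by positivity)]
    refine ENNReal.ofReal_le_ofReal ?_
    have h3 : e ^ 2 ≤ 1 + L * |t - s| * (1 - a) + (L * |t - s|) ^ 2 := by
      rw [he, sq, ← Real.exp_add, add_halves, abs_sub_comm, hrdef, abs_interpolation_sub ha]
      refine le_trans (le_of_eq ?_) (exp_le_one_add hL0 hL ha)
      ring_nf
    have h4 : ((e * Real.sqrt D)⁻¹ * |deriv ψ a|) ^ 2 = deriv ψ a ^ 2 / (e ^ 2 * D) := by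
      rw [mul_pow, inv_pow, mul_pow, Real.sq_sqrt hD0.le, sq_abs]
      ring
    -- A tangent line bound in place of Cauchy–Schwarz for the integral: it is linear in `ψ'`, whose
    -- integral is known, and linear in `e ^ 2`, for which an upper bound is at hand.
    have h5 : 2 * deriv ψ a - D * e ^ 2 ≤ deriv ψ a ^ 2 / (e ^ 2 * D) := by
      rw [le_div_iff₀ (by positivity)]
      nlinarith [sq_nonneg (deriv ψ a - D * e ^ 2)]
    rw [h4]
    have h6 := mul_le_mul_of_nonneg_left h3 hD0.le
    linarith
  have hi : IntervalIntegrable (fun a => D * (1 + L * |t - s| * (1 - a) + (L * |t - s|) ^ 2))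
      volume 0 1 := Continuous.intervalIntegrable (by fun_prop) _ _
  have hval : ∫ a in Ioo (0 : ℝ) 1,
      (2 * deriv ψ a - D * (1 + L * |t - s| * (1 - a) + (L * |t - s|) ^ 2))
      = (1 - L * |t - s| / 2 - (L * |t - s|) ^ 2) * D := by
    rw [← integral_Ioc_eq_integral_Ioo, ← intervalIntegral.integral_of_le zero_le_one,
      intervalIntegral.integral_sub (hdi.const_mul 2) hi, intervalIntegral.integral_const_mul,
      intervalIntegral.integral_const_mul, integral_one_add_mul_sub, hint]
    ring
  rw [← hval]
  refine (ofReal_integral_le_lintegral _).trans (lintegral_mono_ae ?_)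
  exact (ae_restrict_iff' measurableSet_Ioo).2 hbound

/-- The dynamic distance is comparable to the distance at a fixed time up to second order terms
in time. -/
theorem dynDist_sq_bounds (hd : E.IsDist d) {s t : ℝ} (hs : s ∈ Ioo 0 T) (ht : t ∈ Ioo 0 T)
    (hL : L * |t - s| ≤ 1) (x y : H) :
    (1 - L * |t - s| / 2 - (L * |t - s|) ^ 2) * E.b t (x - y) (x - y) ≤ dynDist T d s t x y ^ 2 ∧
    dynDist T d s t x y ^ 2 ≤ (1 + L * |t - s| / 2 + (L * |t - s|) ^ 2) * E.b t (x - y) (x - y) := by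
  have hL0 : 0 ≤ L * |t - s| := mul_nonneg E.L_nonneg (abs_nonneg _)
  have h1 := hd.iInf_action_le hs ht hL x y
  rw [dynDist, Real.sq_sqrt ENNReal.toReal_nonneg]
  refine ⟨?_, ENNReal.toReal_le_of_le_ofReal ?_ h1⟩
  · refine (ENNReal.ofReal_le_iff_le_toReal (ne_top_of_le_ne_top ENNReal.ofReal_ne_top h1)).1 ?_
    exact le_iInf₂ fun γ hγ => hd.le_action hs ht hL hγ
  · have := b_nonneg (E := E) ht (x - y)
    positivity

theorem dynDist_self_sq (hd : E.IsDist d) {t : ℝ} (ht : t ∈ Ioo 0 T) (x y : H) :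
    dynDist T d t t x y ^ 2 = E.b t (x - y) (x - y) := by
  have := hd.dynDist_sq_bounds ht ht (by simp) x y
  simp only [sub_self, abs_zero, mul_zero, zero_div, ne_eq, OfNat.ofNat_ne_zero, not_false_eq_true,
    zero_pow, sub_zero, add_zero, one_mul] at this
  exact le_antisymm this.2 this.1

end IsDist
end FormFlow

/-! ### Strong solutions are EVI flows -/

namespace FormFlow

open DynEVI

variable {F H : Type*} [NormedAddCommGroup F] [InnerProductSpace ℝ F]
    [NormedAddCommGroup H] [InnerProductSpace ℝ H] {T L : ℝ} {E : FormFlow F H T L}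

theorem IsDist.abs_slope_sub_le {d : ℝ → H → H → ℝ} (hd : E.IsDist d) {r t : ℝ} (hr : r ∈ Ioo 0 T)
    (ht : t ∈ Ioo 0 T) (hrt : r ≠ t) (hL : L * |t - r| ≤ 1) (x : ℝ → H) (z : H) :
    |(dynDist T d t t (x t) z ^ 2 - dynDist T d r t (x r) z ^ 2) / (t - r)
        - (E.b t (x t - z) (x t - z) - E.b t (x r - z) (x r - z)) / (t - r)|
      ≤ (L / 2 + L ^ 2 * |t - r|) * E.b t (x r - z) (x r - z) := by
  have h := hd.dynDist_sq_bounds hr ht hL (x r) z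
  have h0 : 0 < |t - r| := abs_pos.2 (sub_ne_zero.2 hrt.symm)
  rw [hd.dynDist_self_sq ht, ← sub_div, abs_div, div_le_iff₀ h0, abs_le]
  constructor <;> nlinarith [h.1, h.2]

namespace IsStrongSol

variable {x : ℝ → H} {U : ℝ → F} {s τ : ℝ}

variable [CompleteSpace F] [CompleteSpace H]

/-- The energy is only weakly lower semicontinuous, but an expression linear in `V r` passes to the
limit along a family bounded in `F` that converges in `H`. -/
theorem tendsto_energy_bound {t C : ℝ} (ht : t ∈ Ioo 0 T) {l : Filter ℝ} (hl : l ≤ 𝓝 t)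
    {V : ℝ → F} {u : F} (hV : ∀ᶠ r in l, ‖V r‖ ≤ C) (hVu : Tendsto (fun r => E.ι (V r)) l (𝓝 (E.ι u)))
    (w : F) :
    Tendsto (fun r => E.a r w w - 2 * E.a r (V r) u + E.a r u u) l
      (𝓝 (E.a t w w - E.a t u u)) := by
  have hc : ∀ v : F, Tendsto (fun r => E.a r v v) l (𝓝 (E.a t v v)) := fun v => by
    have h1 : ContinuousAt E.a t := continuousOn_a.continuousAt (Ioo_mem_nhds ht.1 ht.2)
    have h2 : ContinuousAt (fun r => E.a r v v) t :=
      (h1.clm_apply continuousAt_const).clm_apply continuousAt_const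
    exact h2.tendsto.mono_left hl
  have h1 : Tendsto (fun r => E.a t (V r) u) l (𝓝 (E.a t u u)) :=
    tendsto_apply_of_norm_le E.ι_inj hV hVu ((E.a t).flip u)
  have h2 : Tendsto (fun r => E.a r (V r) u - E.a t (V r) u) l (𝓝 0) := by
    have h3 : Tendsto (fun r => E.K * |r - t| * C * ‖u‖) l (𝓝 0) := by
      have : Tendsto (fun r => E.K * |r - t| * C * ‖u‖) (𝓝 t) (𝓝 (E.K * |t - t| * C * ‖u‖)) := by
        refine Continuous.tendsto ?_ t
        fun_prop
      simp only [sub_self, abs_zero, mul_zero, zero_mul] at this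
      exact this.mono_left hl
    refine squeeze_zero_norm' ?_ h3
    filter_upwards [hV, hl (Ioo_mem_nhds ht.1 ht.2)] with r h4 h5
    refine (abs_a_sub_le (E := E) h5 ht _ _).trans ?_
    have := E.K_nonneg
    gcongr
  have h3 := ((hc w).sub ((h1.add h2).const_mul 2)).add (hc u)
  convert h3 using 2
  · ring
  · ring

/-- Upper bound for the increments of the distance to a fixed point, measured at a fixed time. -/
theorem eventually_increment_le (hx : E.IsStrongSol x U s τ) (hs : 0 ≤ s) (hτ : τ ≤ T)
    {p C : ℝ} (hC : ∀ r ∈ Ico p τ, ∃ u, E.ι u = x r ∧ ‖u‖ ≤ C) {t : ℝ} (hsp : s < p) (hpt : p < t)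
    (htτ : t < τ) {u : F} (hu : E.ι u = x t) (w : F) {ε : ℝ} (hε : 0 < ε) :
    ∃ δ > 0, ∀ p' q', t - δ < p' → p' ≤ t → t ≤ q' → q' < t + δ →
      E.b t (x q' - E.ι w) (x q' - E.ι w) - E.b t (x p' - E.ι w) (x p' - E.ι w)
        ≤ (E.a t w w - E.a t u u + ε) * (q' - p') := by
  obtain ⟨q, hq⟩ := exists_between htτ
  obtain ⟨k, hk⟩ := hx.hasACDensity p q hsp (hpt.trans hq.1).le hq.2
  have hpq : p ≤ q := (hpt.trans hq.1).le
  have hI : ∀ r ∈ Icc p q, r ∈ Ioo 0 T := fun r hr =>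
    ⟨by linarith [hr.1], by linarith [hr.2, hq.2]⟩
  have htI := hI t ⟨hpt.le, hq.1.le⟩
  have hK := E.K_nonneg
  set z := E.ι w with hz
  have hxz : ContinuousOn (fun r => x r - z) (Icc p q) := (hk.continuousOn hpq).sub continuousOn_const
  obtain ⟨R, hR : ∀ r ∈ Icc p q, ‖x r - z‖ ≤ R⟩ := isCompact_Icc.exists_bound_of_continuousOn hxz
  have hR0 : 0 ≤ R := (norm_nonneg _).trans (hR p ⟨le_rfl, hpq⟩)
  choose! V hV using hC
  have hnhds : Icc p q ∈ 𝓝 t := Icc_mem_nhds hpt hq.1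
  have hVn : ∀ᶠ r in 𝓝 t, ‖V r‖ ≤ C := by
    filter_upwards [hnhds] with r hr using (hV r ⟨hr.1, hr.2.trans_lt hq.2⟩).2
  have hVt : Tendsto (fun r => E.ι (V r)) (𝓝 t) (𝓝 (E.ι u)) := by
    rw [hu]
    refine Tendsto.congr' ?_ ((hk.continuousOn hpq).continuousAt hnhds)
    filter_upwards [hnhds] with r hr using (hV r ⟨hr.1, hr.2.trans_lt hq.2⟩).1.symm
  have h1 := (tendsto_energy_bound (E := E) htI le_rfl hVn hVt w).eventually
    (gt_mem_nhds (lt_add_of_pos_right _ (half_pos hε)))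
  set D := 2 * E.K * R with hD
  -- Replacing `b r` by `b t` costs at most `D (q' - p') |k r|`, up to small terms. Integrated over
  -- `[p', q']` this is `q' - p'` times a small number, since `k` is integrable.
  have h2 : ∀ᶠ δ in 𝓝[>] (0 : ℝ), D * ∫ r in (t - δ)..(t + δ), (|k r| + 1) < ε / 2 := by
    have hki' : IntervalIntegrable (fun r => |k r| + 1) volume p q :=
      hk.integrable.abs.add intervalIntegrable_const
    have hcont := intervalIntegral.continuousOn_primitive_interval' hki' (left_mem_uIcc)
    rw [uIcc_of_le hpq] at hcont
    have hct := (hcont.continuousAt hnhds).tendsto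
    have e1 : Tendsto (fun δ : ℝ => t + δ) (𝓝[>] 0) (𝓝 t) := by
      have : Tendsto (fun δ : ℝ => t + δ) (𝓝 0) (𝓝 (t + 0)) := Continuous.tendsto (by fun_prop) 0
      rw [add_zero] at this; exact this.mono_left nhdsWithin_le_nhds
    have e2 : Tendsto (fun δ : ℝ => t - δ) (𝓝[>] 0) (𝓝 t) := by
      have : Tendsto (fun δ : ℝ => t - δ) (𝓝 0) (𝓝 (t - 0)) := Continuous.tendsto (by fun_prop) 0
      rw [sub_zero] at this; exact this.mono_left nhdsWithin_le_nhds
    have e3 := ((hct.comp e1).sub (hct.comp e2)).const_mul D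
    rw [sub_self, mul_zero] at e3
    have e4 := e3.eventually (gt_mem_nhds (half_pos hε))
    filter_upwards [e4, e1.eventually hnhds, e2.eventually hnhds] with δ h3 h4 h5
    refine lt_of_eq_of_lt ?_ h3
    simp only [Function.comp]
    rw [intervalIntegral.integral_interval_sub_left]
    · exact hki'.mono_set (by rw [uIcc_of_le h4.1, uIcc_of_le hpq]; exact Icc_subset_Icc le_rfl h4.2)
    · exact hki'.mono_set (by rw [uIcc_of_le h5.1, uIcc_of_le hpq]; exact Icc_subset_Icc le_rfl h5.2)
  obtain ⟨δ₁, hδ₁, h3⟩ := Metric.eventually_nhds_iff.1 h1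
  obtain ⟨δ, h4, h5⟩ := (h2.and (Ioo_mem_nhdsGT (lt_min hδ₁ (lt_min (sub_pos.2 hpt)
    (sub_pos.2 hq.1))))).exists
  have h51 : δ < δ₁ := h5.2.trans_le (min_le_left _ _)
  have h52 : δ < t - p := h5.2.trans_le ((min_le_right _ _).trans (min_le_left _ _))
  have h53 : δ < q - t := h5.2.trans_le ((min_le_right _ _).trans (min_le_right _ _))
  refine ⟨δ, h5.1, fun p' q' hp' hp't htq' hq' => ?_⟩
  have hp'q' : p' ≤ q' := hp't.trans htq'
  have hk' := hk.mono (by linarith : p ≤ p') hp'q' (by linarith : q' ≤ q)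
  have hsub : ∀ r ∈ Icc p' q', r ∈ Icc p q := fun r hr => ⟨by linarith [hr.1], by linarith [hr.2]⟩
  set A := E.a t w w - E.a t u u with hA
  have hac : HasACDensity (fun r => E.b t (x r - z) (x r - z)) (fun r => (2 * E.K * R) * k r + 0)
      p' q' := by
    refine hk'.of_norm_sub_le (by positivity) fun a b ha hab hb => ?_
    have := abs_b_self_sub_le (E := E) htI (hR b (hsub b ⟨ha.trans hab, hb⟩))
      (hR a (hsub a ⟨ha, hab.trans hb⟩))
    rw [sub_sub_sub_cancel_right] at this
    rw [zero_mul, add_zero]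
    exact this
  have hGi : IntervalIntegrable (fun r => (A + ε / 2) + D * (q' - p') * (|k r| + 1)) volume p' q' :=
    intervalIntegrable_const.add ((hk'.integrable.abs.add intervalIntegrable_const).const_mul _)
  have key := hac.sub_le_integral hp'q' hGi ?_
  · refine key.trans ?_
    rw [intervalIntegral.integral_add intervalIntegrable_const
      ((hk'.integrable.abs.add intervalIntegrable_const).const_mul _),
      intervalIntegral.integral_const, intervalIntegral.integral_const_mul, smul_eq_mul]
    have h6 : ∫ r in p'..q', (|k r| + 1) ≤ ∫ r in (t - δ)..(t + δ), (|k r| + 1) := by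
      refine intervalIntegral.integral_mono_interval hp'.le hp'q' hq'.le
        (Eventually.of_forall fun r => by simp only [Pi.zero_apply]; positivity) ?_
      exact (hk.mono (by linarith : p ≤ t - δ) (by linarith [h5.1] : t - δ ≤ t + δ)
        (by linarith)).integrable.abs.add intervalIntegrable_const
    have h7 : D * ∫ r in p'..q', (|k r| + 1) ≤ ε / 2 :=
      (mul_le_mul_of_nonneg_left h6 (by positivity)).trans h4.le
    have h8 := mul_le_mul_of_nonneg_left h7 (sub_nonneg.2 hp'q')
    linarith
  · filter_upwards [hx.tendsto, hk'.ae_norm_sub_le hp'q'] with r h6 h7 hr η hη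
    have hrpq := hsub r (Ioo_subset_Icc_self hr)
    have hrI := hI r hrpq
    obtain ⟨hU, h6⟩ := h6 ⟨by linarith [hrpq.1], by linarith [hrpq.2, hq.2]⟩
    have hUV : U r = V r := E.ι_inj (by rw [hU, (hV r ⟨hrpq.1, hrpq.2.trans_lt hq.2⟩).1])
    have hΦ : E.a r w w - 2 * E.a r (U r) u + E.a r u u < A + ε / 2 := by
      rw [hUV]
      exact h3 (by rw [Real.dist_eq, abs_lt]; constructor <;> linarith [hr.1, hr.2])
    have h8 := (h6 (U r - w)).mono_left
      (nhdsWithin_mono r (fun r' (hr' : r < r') => hr'.ne') : 𝓝[>] r ≤ 𝓝[≠] r)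
    -- Convexity gives `a r w w - a r (U r) (U r)`, and positivity of `a r` at `U r - u` replaces
    -- the energy of `U r` by its linearization at `u`, which converges as `r → t`.
    have h9 : -2 * E.a r (U r) (U r - w) < A + ε / 2 := by
      have e1 := E.a_nonneg r hrI (U r - w)
      have e2 := E.a_nonneg r hrI (U r - u)
      have e3 := E.a_symm r hrI (U r) w
      have e4 := E.a_symm r hrI (U r) u
      simp only [map_sub, sub_apply] at e1 e2 ⊢
      linarith
    have hlim : Tendsto (fun r' => E.K * (|k r| + 1) ^ 2 * (r' - r)) (𝓝[>] r) (𝓝 0) := by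
      have : Tendsto (fun r' => E.K * (|k r| + 1) ^ 2 * (r' - r)) (𝓝 r)
          (𝓝 (E.K * (|k r| + 1) ^ 2 * (r - r))) := by
        refine Continuous.tendsto ?_ r
        fun_prop
      rw [sub_self, mul_zero] at this
      exact this.mono_left nhdsWithin_le_nhds
    filter_upwards [(h7 hr 1 one_pos).filter_mono (nhdsWithin_le_nhds (s := Ioi r)),
      h8.eventually (gt_mem_nhds (by linarith : -E.a r (U r) (U r - w) < (A + ε / 2) / 2)),
      hlim.eventually (gt_mem_nhds hη), self_mem_nhdsWithin] with r' f1 f2 f3 f4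
    have hr0 : 0 < r' - r := sub_pos.2 f4
    rw [div_lt_iff₀ hr0, map_sub E.ι, hU, ← hz] at f2
    rw [abs_of_pos hr0] at f1
    have f1' : ‖x r' - x r‖ ≤ (|k r| + 1) * (r' - r) :=
      f1.trans (by gcongr; exact le_abs_self _)
    have g1 := b_self_sub (E := E) htI (x r' - z) (x r - z)
    rw [sub_sub_sub_cancel_right] at g1
    have g2 := (le_abs_self _).trans (abs_b_sub_le (E := E) htI hrI (x r' - x r) (x r - z))
    have g3 := (le_abs_self _).trans (abs_b_le (E := E) htI (x r' - x r) (x r' - x r))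
    have g4 : E.K * |t - r| * ‖x r' - x r‖ * ‖x r - z‖
        ≤ E.K * (q' - p') * ((|k r| + 1) * (r' - r)) * R := by
      have : |t - r| ≤ q' - p' := by rw [abs_le]; constructor <;> linarith [hr.1, hr.2]
      have := hR r hrpq
      gcongr
    have g5 : E.K * ‖x r' - x r‖ * ‖x r' - x r‖
        ≤ E.K * ((|k r| + 1) * (r' - r)) * ((|k r| + 1) * (r' - r)) := by
      gcongr
    have g6 := mul_le_mul_of_nonneg_right f3.le hr0.le
    rw [g1, hD]
    linarith

/-- The upper derivative of the dynamic distance along a strong solution. -/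
theorem upperDeriv_le (hx : E.IsStrongSol x U s τ) (hs : 0 ≤ s) (hτ : τ ≤ T)
    {p C : ℝ} (hC : ∀ r ∈ Ico p τ, ∃ u, E.ι u = x r ∧ ‖u‖ ≤ C) {t : ℝ} (hsp : s < p) (hpt : p < t)
    (htτ : t < τ) {u : F} (hu : E.ι u = x t) (w : F) {d : ℝ → H → H → ℝ} (hd : E.IsDist d) :
    upperDeriv (fun r => dynDist T d r t (x r) (E.ι w) ^ 2) t
      ≤ ((E.a t w w - E.a t u u + L / 2 * E.b t (x t - E.ι w) (x t - E.ι w) : ℝ) : EReal) := by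
  have htI : t ∈ Ioo 0 T := ⟨by linarith, by linarith⟩
  refine EReal.le_of_forall_lt_iff_le.1 fun B hB => ?_
  rw [EReal.coe_lt_coe_iff] at hB
  set z := E.ι w
  set κ : ℝ → ℝ := fun r => E.b t (x r - z) (x r - z) with hκ
  obtain ⟨ε, hε, hεB⟩ : ∃ ε > 0, E.a t w w - E.a t u u + ε + (L / 2 * κ t) < B :=
    ⟨(B - (E.a t w w - E.a t u u + L / 2 * κ t)) / 2, by linarith, by linarith⟩
  obtain ⟨δ, hδ, h1⟩ := hx.eventually_increment_le hs hτ hC hsp hpt htτ hu w hε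
  have hxc : ContinuousAt x t := hx.continuousOn.continuousAt (Ioo_mem_nhds (hsp.trans hpt) htτ)
  have hκc : ContinuousAt κ t := by
    have : ContinuousAt (fun r => x r - z) t := hxc.sub continuousAt_const
    exact ((E.b t).continuous.continuousAt.comp this).clm_apply this
  have h2 : Tendsto (fun r => E.a t w w - E.a t u u + ε + (L / 2 + L ^ 2 * |t - r|) * κ r) (𝓝[≠] t)
      (𝓝 (E.a t w w - E.a t u u + ε + (L / 2 + L ^ 2 * |t - t|) * κ t)) := by
    have : ContinuousAt (fun r => E.a t w w - E.a t u u + ε + (L / 2 + L ^ 2 * |t - r|) * κ r) t :=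
      continuousAt_const.add ((Continuous.continuousAt (by fun_prop)).mul hκc)
    exact this.tendsto.mono_left nhdsWithin_le_nhds
  rw [sub_self, abs_zero, mul_zero, add_zero] at h2
  have h3 : ∀ᶠ r in 𝓝 t, L * |t - r| ≤ 1 := by
    have : Tendsto (fun r => L * |t - r|) (𝓝 t) (𝓝 (L * |t - t|)) :=
      Continuous.tendsto (by fun_prop) t
    rw [sub_self, abs_zero, mul_zero] at this
    filter_upwards [this.eventually (gt_mem_nhds zero_lt_one)] with r hr using hr.le
  refine limsup_le_of_le (by isBoundedDefault) ?_
  filter_upwards [h2.eventually (gt_mem_nhds hεB), nhdsWithin_le_nhds h3,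
    nhdsWithin_le_nhds (Ioo_mem_nhds htI.1 htI.2), self_mem_nhdsWithin,
    nhdsWithin_le_nhds (Ioo_mem_nhds (sub_lt_self t hδ) (lt_add_of_pos_right t hδ))] with r f1 f2 f3 f4 f5
  rw [EReal.coe_le_coe_iff]
  have f4 : r ≠ t := f4
  have g1 := (abs_le.1 (hd.abs_slope_sub_le f3 htI f4 f2 x z)).2
  have g2 : (κ t - κ r) / (t - r) ≤ E.a t w w - E.a t u u + ε := by
    rcases f4.lt_or_gt with h | h
    · rw [div_le_iff₀ (sub_pos.2 h)]
      exact h1 r t f5.1 h.le le_rfl (by linarith)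
    · rw [← neg_div_neg_eq, neg_sub, neg_sub, div_le_iff₀ (sub_pos.2 h)]
      exact h1 t r (by linarith) le_rfl h.le f5.2
  simp only [hκ] at g2 f1
  linarith

/-- Strong solutions that are locally bounded in `F` are EVI flows. -/
theorem isForwardEVI (hx : E.IsStrongSol x U s τ) (hs : 0 ≤ s) (hτ : τ ≤ T)
    (hC : ∀ p, s < p → p < τ → ∃ C, ∀ r ∈ Ico p τ, ∃ u, E.ι u = x r ∧ ‖u‖ ≤ C)
    {d : ℝ → H → H → ℝ} (hd : E.IsDist d) {V : ℝ → H → EReal}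
    (hV : ∀ t ∈ Ioo 0 T, ∀ u, V t (E.ι u) = ((1 / 2 * E.a t u u : ℝ) : EReal))
    (hV' : ∀ t ∈ Ioo 0 T, ∀ z, V t z ≠ ⊤ → ∃ u, E.ι u = z) :
    IsForwardEVI T d V (-L / 2) s τ x := by
  refine ⟨fun a b ha hab hb r hr => ?_, fun t ht z hz => ?_⟩
  · obtain ⟨k, hk⟩ := hx.hasACDensity a b ha hab hb
    refine ⟨fun ρ => Real.sqrt E.K * k ρ, ?_, fun p q hp hpq hq => ?_⟩
    · exact ((intervalIntegrable_iff_integrableOn_Icc_of_le hab).1 hk.integrable).const_mul _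
    · refine (hd.le_mul_norm hr _ _).trans ?_
      rw [intervalIntegral.integral_const_mul, norm_sub_rev]
      exact mul_le_mul_of_nonneg_left (hk.norm_sub_le p q hp hpq hq) (Real.sqrt_nonneg _)
  · have htI : t ∈ Ioo 0 T := ⟨hs.trans_lt ht.1, ht.2.trans_le hτ⟩
    obtain ⟨w, rfl⟩ := hV' t htI z hz
    obtain ⟨p, hp⟩ := exists_between ht.1
    obtain ⟨C, hC⟩ := hC p hp.1 (hp.2.trans ht.2)
    obtain ⟨u, hu, -⟩ := hC t ⟨hp.2.le, ht.2⟩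
    have h1 := hx.upperDeriv_le hs hτ hC hp.1 hp.2 ht.2 hu w hd
    rw [← hu, hV t htI, hV t htI, hd.sq_eq htI, hu]
    set D := upperDeriv (fun r => dynDist T d r t (x r) (E.ι w) ^ 2) t
    have h2 := EReal.neg_le_neg_iff.2 (mul_le_mul_of_nonneg_left h1
      (EReal.coe_nonneg.2 (by norm_num : (0 : ℝ) ≤ 1 / 2)))
    refine le_trans ?_ (EReal.sub_le_sub h2 le_rfl)
    rw [← EReal.coe_sub, ← EReal.coe_mul, ← EReal.coe_neg, ← EReal.coe_sub, EReal.coe_le_coe_iff]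
    linarith

end IsStrongSol
end FormFlow

/-! ### EVI flows are strong solutions -/

namespace FormFlow

open DynEVI

variable {F H : Type*} [NormedAddCommGroup F] [InnerProductSpace ℝ F]
    [NormedAddCommGroup H] [InnerProductSpace ℝ H] {T L : ℝ} {E : FormFlow F H T L}
    {x : ℝ → H} {s τ : ℝ} {d : ℝ → H → H → ℝ} {V : ℝ → H → EReal}

/-- If the upper derivative of the dynamic distance is bounded above, so are the difference
quotients of the distance at a fixed time. -/
theorem IsDist.eventually_slope_le (hd : E.IsDist d) {t A : ℝ} (ht : t ∈ Ioo 0 T)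
    (hx : ContinuousAt x t) (z : H)
    (hA : upperDeriv (fun r => dynDist T d r t (x r) z ^ 2) t ≤ (A : EReal)) {ε : ℝ} (hε : 0 < ε) :
    ∀ᶠ r in 𝓝[≠] t, (E.b t (x t - z) (x t - z) - E.b t (x r - z) (x r - z)) / (t - r)
      ≤ A + L / 2 * E.b t (x t - z) (x t - z) + ε := by
  set κ : ℝ → ℝ := fun r => E.b t (x r - z) (x r - z) with hκ
  have hκc : ContinuousAt κ t := by
    have : ContinuousAt (fun r => x r - z) t := hx.sub continuousAt_const
    exact ((E.b t).continuous.continuousAt.comp this).clm_apply this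
  have h2 : Tendsto (fun r => (L / 2 + L ^ 2 * |t - r|) * κ r) (𝓝[≠] t)
      (𝓝 ((L / 2 + L ^ 2 * |t - t|) * κ t)) := by
    have : ContinuousAt (fun r => (L / 2 + L ^ 2 * |t - r|) * κ r) t :=
      (Continuous.continuousAt (by fun_prop)).mul hκc
    exact this.tendsto.mono_left nhdsWithin_le_nhds
  rw [sub_self, abs_zero, mul_zero, add_zero] at h2
  have h3 : ∀ᶠ r in 𝓝 t, L * |t - r| ≤ 1 := by
    have : Tendsto (fun r => L * |t - r|) (𝓝 t) (𝓝 (L * |t - t|)) :=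
      Continuous.tendsto (by fun_prop) t
    rw [sub_self, abs_zero, mul_zero] at this
    filter_upwards [this.eventually (gt_mem_nhds zero_lt_one)] with r hr using hr.le
  have h4 : upperDeriv (fun r => dynDist T d r t (x r) z ^ 2) t < ((A + ε / 2 : ℝ) : EReal) :=
    hA.trans_lt (EReal.coe_lt_coe_iff.2 (by linarith))
  filter_upwards [eventually_lt_of_limsup_lt h4, h2.eventually (gt_mem_nhds
    (lt_add_of_pos_right _ (half_pos hε))), nhdsWithin_le_nhds h3,
    nhdsWithin_le_nhds (Ioo_mem_nhds ht.1 ht.2), self_mem_nhdsWithin] with r f1 f2 f3 f4 f5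
  rw [EReal.coe_lt_coe_iff] at f1
  have g1 := (abs_le.1 (hd.abs_slope_sub_le f4 ht f5 f3 x z)).1
  simp only [hκ] at f2
  linarith

/-- An upper derivative `-∞` would make the EVI void. A pointwise Lipschitz bound at `t` keeps the
difference quotients bounded and excludes it. -/
theorem IsDist.neg_le_upperDeriv (hd : E.IsDist d) {t M : ℝ} (ht : t ∈ Ioo 0 T)
    (hx : ContinuousAt x t) (hM : ∀ᶠ r in 𝓝 t, ‖x r - x t‖ ≤ M * |r - t|) (z : H) :
    ⊥ < upperDeriv (fun r => dynDist T d r t (x r) z ^ 2) t := by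
  by_contra h
  rw [not_bot_lt_iff] at h
  obtain ⟨R, hR⟩ : ∃ R, ∀ᶠ r in 𝓝 t, ‖x r - z‖ ≤ R := by
    refine ⟨‖x t - z‖ + 1, ?_⟩
    have h1 : ContinuousAt (fun r => ‖x r - z‖) t := (hx.sub continuousAt_const).norm
    filter_upwards [h1.eventually (gt_mem_nhds (lt_add_one _))] with r hr using hr.le
  have hRt := hR.self_of_nhds
  have hK := E.K_nonneg
  -- Chosen so that the resulting upper bound for the quotients is `-2 K R M - 1`, below the lower
  -- bound `-2 K R M` given by the Lipschitz estimate.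
  set A := -(L / 2 * E.b t (x t - z) (x t - z)) - 2 * E.K * R * M - 2 with hA
  have h1 := hd.eventually_slope_le (A := A) ht hx z (by rw [h]; exact bot_le) one_pos
  obtain ⟨r, f1, f2, f3, f4⟩ := (h1.and ((hM.filter_mono nhdsWithin_le_nhds).and
    ((hR.filter_mono nhdsWithin_le_nhds).and
      (self_mem_nhdsWithin : ∀ᶠ r in 𝓝[≠] t, r ∈ ({t}ᶜ : Set ℝ))))).exists
  have h0 : 0 < |t - r| := abs_pos.2 (sub_ne_zero.2 (Ne.symm f4))
  have hR0 : 0 ≤ R := (norm_nonneg _).trans f3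
  have g1 := abs_b_self_sub_le (E := E) ht hRt f3
  rw [sub_sub_sub_cancel_right, norm_sub_rev] at g1
  have g2 : |(E.b t (x t - z) (x t - z) - E.b t (x r - z) (x r - z)) / (t - r)|
      ≤ 2 * E.K * R * M := by
    rw [abs_div, div_le_iff₀ h0]
    refine g1.trans ?_
    rw [abs_sub_comm t r, mul_assoc _ M]
    gcongr
  have := (abs_le.1 g2).1
  linarith

/-- The EVI at `w = 0` bounds the energy of `x t` by a quantity that is not `+∞`, so `x t` lies in
`F`; after that all terms but the upper derivative are real and the inequality can be rearranged. -/
theorem exists_energy_le_of_evi (hd : E.IsDist d)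
    (hV : ∀ t ∈ Ioo 0 T, ∀ u, V t (E.ι u) = ((1 / 2 * E.a t u u : ℝ) : EReal))
    (hV' : ∀ t ∈ Ioo 0 T, ∀ z, V t z ≠ ⊤ → ∃ u, E.ι u = z)
    (hx : IsForwardEVI T d V (-L / 2) s τ x) {t M : ℝ} (ht : t ∈ Ioo 0 T) (hts : t ∈ Ioo s τ)
    (hxc : ContinuousAt x t) (hM : ∀ᶠ r in 𝓝 t, ‖x r - x t‖ ≤ M * |r - t|) :
    ∃ u, E.ι u = x t ∧ ∀ w, upperDeriv (fun r => dynDist T d r t (x r) (E.ι w) ^ 2) t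
      ≤ ((E.a t w w - E.a t u u + L / 2 * E.b t (x t - E.ι w) (x t - E.ι w) : ℝ) : EReal) := by
  have hevi : ∀ w, V t (x t) - V t (E.ι w) ≤ -(((1 / 2 : ℝ) : EReal) *
      upperDeriv (fun r => dynDist T d r t (x r) (E.ι w) ^ 2) t)
        - ((-L / 2 / 2 * d t (x t) (E.ι w) ^ 2 : ℝ) : EReal) := fun w =>
    hx.evi t hts (E.ι w) (by rw [hV t ht]; exact EReal.coe_ne_top _)
  have hbot := fun w => hd.neg_le_upperDeriv ht hxc hM (E.ι w)
  obtain ⟨u, hu⟩ : ∃ u, E.ι u = x t := by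
    refine hV' t ht _ fun htop => ?_
    have h1 := hevi 0
    have h2 := hbot 0
    rw [htop, hV t ht] at h1
    rw [EReal.top_sub_coe, top_le_iff] at h1
    induction h3 : upperDeriv (fun r => dynDist T d r t (x r) (E.ι 0) ^ 2) t with
    | bot => rw [h3] at h2; exact lt_irrefl _ h2
    | coe D =>
      rw [h3, ← EReal.coe_mul, ← EReal.coe_neg, ← EReal.coe_sub] at h1
      exact EReal.coe_ne_top _ h1
    | top =>
      rw [h3, EReal.coe_mul_top_of_pos (by norm_num), EReal.neg_top, EReal.bot_sub] at h1
      exact bot_ne_top h1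
  refine ⟨u, hu, fun w => ?_⟩
  have h1 := hevi w
  have h2 := hbot w
  rw [← hu, hV t ht, hV t ht, hd.sq_eq ht, hu] at h1
  induction h3 : upperDeriv (fun r => dynDist T d r t (x r) (E.ι w) ^ 2) t with
  | bot => exact bot_le
  | coe D =>
    rw [h3, ← EReal.coe_mul, ← EReal.coe_neg, ← EReal.coe_sub, ← EReal.coe_sub,
      EReal.coe_le_coe_iff] at h1
    rw [EReal.coe_le_coe_iff]
    linarith
  | top =>
    rw [h3, EReal.coe_mul_top_of_pos (by norm_num), EReal.neg_top, EReal.bot_sub, ← EReal.coe_sub,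
      le_bot_iff] at h1
    exact absurd h1 (EReal.coe_ne_bot _)

/-- The upper bound in the first variation of an EVI flow. -/
theorem eventually_div_le_of_evi (hd : E.IsDist d) {t M : ℝ} (ht : t ∈ Ioo 0 T)
    (hxc : ContinuousAt x t) (hM : ∀ᶠ r in 𝓝 t, ‖x r - x t‖ ≤ M * |r - t|) {u : F}
    (hu : E.ι u = x t) (h : ∀ w, upperDeriv (fun r => dynDist T d r t (x r) (E.ι w) ^ 2) t
      ≤ ((E.a t w w - E.a t u u + L / 2 * E.b t (x t - E.ι w) (x t - E.ι w) : ℝ) : EReal))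
    (v : F) {ε : ℝ} (hε : 0 < ε) :
    ∀ᶠ r in 𝓝[≠] t, E.b t (x r - x t) (E.ι v) / (r - t) ≤ -E.a t u v + ε := by
  have hK := E.K_nonneg
  have hB := b_nonneg (E := E) ht (E.ι v)
  have hA := E.a_nonneg t ht v
  have hL := E.L_nonneg
  set A := E.a t v v + L * E.b t (E.ι v) (E.ι v) with hAdef
  have hA0 : 0 ≤ A := by positivity
  obtain ⟨η, hη, hηA⟩ : ∃ η > 0, η * A ≤ ε := ⟨ε / (A + 1), by positivity, by
    rw [div_mul_eq_mul_div, div_le_iff₀ (by positivity)]; nlinarith⟩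
  -- First variation: with the competitor `u - η v` the linear terms carry a factor `2 η`, while `a
  -- t v v` and `b t v v` enter only with `η²`; the choice `η A ≤ ε` makes these negligible after
  -- division by `2 η`.
  have h1 := hd.eventually_slope_le ht hxc _ (h (u - η • v)) (mul_pos hη (half_pos hε))
  have hlim : Tendsto (fun r => E.K * M ^ 2 * |r - t|) (𝓝[≠] t) (𝓝 0) := by
    have : Tendsto (fun r => E.K * M ^ 2 * |r - t|) (𝓝 t) (𝓝 (E.K * M ^ 2 * |t - t|)) := by
      refine Continuous.tendsto ?_ t
      fun_prop
    rw [sub_self, abs_zero, mul_zero] at this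
    exact this.mono_left nhdsWithin_le_nhds
  filter_upwards [h1, nhdsWithin_le_nhds hM, hlim.eventually (gt_mem_nhds
    (mul_pos hη (half_pos hε))), self_mem_nhdsWithin] with r f1 f2 f3 f4
  have h0 : 0 < |r - t| := abs_pos.2 (sub_ne_zero.2 f4)
  have e1 : x t - E.ι (u - η • v) = η • E.ι v := by rw [map_sub, hu, map_smul]; abel
  have e2 : x r - E.ι (u - η • v) - (x t - E.ι (u - η • v)) = x r - x t := by abel
  have e3 := b_self_sub (E := E) ht (x r - E.ι (u - η • v)) (x t - E.ι (u - η • v))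
  rw [e2, e1] at e3
  rw [← neg_div_neg_eq, neg_sub, neg_sub, e1, e3] at f1
  have e4 : E.a t (u - η • v) (u - η • v) = E.a t u u - 2 * η * E.a t u v + η ^ 2 * E.a t v v := by
    have := E.a_symm t ht u v
    simp only [map_sub, map_smul, sub_apply, smul_apply, smul_eq_mul]
    rw [this]; ring
  have e5 : |E.b t (x r - x t) (x r - x t) / (r - t)| ≤ E.K * M ^ 2 * |r - t| := by
    rw [abs_div, div_le_iff₀ h0]
    refine (abs_b_le ht _ _).trans ?_
    calc E.K * ‖x r - x t‖ * ‖x r - x t‖ ≤ E.K * (M * |r - t|) * (M * |r - t|) := by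
          have := (norm_nonneg _).trans f2
          gcongr
      _ = _ := by ring
  have e6 := (abs_le.1 e5).1
  rw [e4, add_div] at f1
  simp only [map_smul, smul_apply, smul_eq_mul] at f1
  rw [mul_div_assoc, mul_div_assoc] at f1
  set Q := E.b t (x r - x t) (E.ι v) / (r - t)
  have key : 2 * η * Q ≤ 2 * η * (-E.a t u v + ε) := by
    have e7 := mul_le_mul_of_nonneg_left hηA hη.le
    rw [hAdef] at e7
    nlinarith
  exact le_of_mul_le_mul_left key (by positivity)

/-- EVI flows are strong solutions. -/
theorem exists_isStrongSol_of_evi (hd : E.IsDist d)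
    (hV : ∀ t ∈ Ioo 0 T, ∀ u, V t (E.ι u) = ((1 / 2 * E.a t u u : ℝ) : EReal))
    (hV' : ∀ t ∈ Ioo 0 T, ∀ z, V t z ≠ ⊤ → ∃ u, E.ι u = z)
    (hs : 0 ≤ s) (hτ : τ ≤ T) (hT : 0 < T)
    (hx : IsForwardEVI T d V (-L / 2) s τ x) : ∃ U, E.IsStrongSol x U s τ := by
  have hT2 : T / 2 ∈ Ioo 0 T := ⟨by linarith, by linarith⟩
  have hc := Real.sqrt_pos.2 E.c_pos
  have hac : ∀ p q, s < p → p ≤ q → q < τ → ∃ k, HasACDensity x k p q := by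
    intro p q hp hpq hq
    obtain ⟨g, hgi, hg⟩ := hx.absCont p q hp hpq hq _ hT2
    refine ⟨fun r => (Real.sqrt E.c)⁻¹ * g r,
      ((intervalIntegrable_iff_integrableOn_Icc_of_le hpq).2 hgi).const_mul _,
      fun a b ha hab hb => ?_⟩
    rw [intervalIntegral.integral_const_mul, ← div_eq_inv_mul, le_div_iff₀ hc, mul_comm, norm_sub_rev]
    exact (hd.mul_norm_le hT2 _ _).trans (hg a b ha hab hb)
  have key : ∀ᵐ t, t ∈ Ioo s τ → ∃ u, E.ι u = x t ∧
      ∀ v, Tendsto (fun r => E.b t (x r - x t) (E.ι v) / (r - t)) (𝓝[≠] t) (𝓝 (-E.a t u v)) := by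
    -- Rational end points give one null set for all compact subintervals.
    have h1 : ∀ p q : ℚ, ∀ᵐ t : ℝ, s < p → (p : ℝ) ≤ q → q < τ → t ∈ Ioo (p : ℝ) q →
        ∃ M, ∀ᶠ r in 𝓝 t, ‖x r - x t‖ ≤ M * |r - t| := by
      intro p q
      by_cases h : s < p ∧ (p : ℝ) ≤ q ∧ q < τ
      · obtain ⟨k, hk⟩ := hac p q h.1 h.2.1 h.2.2
        filter_upwards [hk.ae_norm_sub_le h.2.1] with t ht _ _ _ htpq
        exact ⟨_, ht htpq 1 one_pos⟩
      · exact Eventually.of_forall fun t h1 h2 h3 => absurd ⟨h1, h2, h3⟩ h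
    have h2 := ae_all_iff.2 fun p => ae_all_iff.2 (h1 p)
    filter_upwards [h2] with t ht hts
    obtain ⟨p, hp⟩ := exists_rat_btwn hts.1
    obtain ⟨q, hq⟩ := exists_rat_btwn hts.2
    obtain ⟨M, hM⟩ := ht p q hp.1 (hp.2.trans hq.1).le hq.2 ⟨hp.2, hq.1⟩
    have htI : t ∈ Ioo 0 T := ⟨hs.trans_lt hts.1, hts.2.trans_le hτ⟩
    obtain ⟨k, hk⟩ := hac p q hp.1 (hp.2.trans hq.1).le hq.2
    have hxc : ContinuousAt x t :=
      (hk.continuousOn (hp.2.trans hq.1).le).continuousAt (Icc_mem_nhds hp.2 hq.1)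
    obtain ⟨u, hu, h⟩ := exists_energy_le_of_evi hd hV hV' hx htI hts hxc hM
    refine ⟨u, hu, fun v => ?_⟩
    rw [Metric.tendsto_nhds]
    intro ε hε
    filter_upwards [eventually_div_le_of_evi hd htI hxc hM hu h v (half_pos hε),
      eventually_div_le_of_evi hd htI hxc hM hu h (-v) (half_pos hε)] with r f1 f2
    simp only [map_neg, neg_div, neg_neg] at f2
    rw [Real.dist_eq, abs_lt]
    constructor <;> linarith
  choose! U hU using fun t (ht : t ∈ Ioo s τ ∧ ∃ u, E.ι u = x t ∧
      ∀ v, Tendsto (fun r => E.b t (x r - x t) (E.ι v) / (r - t)) (𝓝[≠] t) (𝓝 (-E.a t u v))) => ht.2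
  refine ⟨U, hac, ?_⟩
  filter_upwards [key] with t ht hts using hU t ⟨hts, ht hts⟩

end FormFlow

/-! ### Bounded symmetric bilinear maps -/

section Polarization

variable {F G : Type*} [NormedAddCommGroup F] [InnerProductSpace ℝ F] [NormedAddCommGroup G]
  [NormedSpace ℝ G]

/-- A symmetric bilinear map on an inner product space is bounded by its quadratic form. -/
theorem norm_apply_le_of_norm_self_le (B : F →ₗ[ℝ] F →ₗ[ℝ] G) (hB : ∀ u v, B u v = B v u) {K : ℝ}
    (hK : ∀ u, ‖B u u‖ ≤ K * ‖u‖ ^ 2) (u v : F) : ‖B u v‖ ≤ K * ‖u‖ * ‖v‖ := by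
  have h1 : ∀ u v, ‖u‖ = 1 → ‖v‖ = 1 → ‖B u v‖ ≤ K := by
    intro u v hu hv
    -- Polarization combined with the parallelogram law on unit vectors preserves the constant `K`.
    have h2 : (4 : ℝ) • B u v = B (u + v) (u + v) - B (u - v) (u - v) := by
      simp only [map_add, map_sub, LinearMap.add_apply, LinearMap.sub_apply, hB v u]
      module
    have h3 := parallelogram_law_with_norm ℝ u v
    have h4 : ‖(4 : ℝ) • B u v‖ ≤ 4 * K := by
      rw [h2]
      refine (norm_sub_le _ _).trans ((add_le_add (hK _) (hK _)).trans_eq ?_)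
      rw [← mul_add]
      have : ‖u + v‖ ^ 2 + ‖u - v‖ ^ 2 = 4 := by rw [hu, hv] at h3; linarith
      rw [this, mul_comm]
    rw [norm_smul, Real.norm_of_nonneg (by norm_num)] at h4
    linarith
  rcases eq_or_ne u 0 with rfl | hu
  · simp
  rcases eq_or_ne v 0 with rfl | hv
  · simp
  have hu' := norm_pos_iff.2 hu
  have hv' := norm_pos_iff.2 hv
  have h2 := h1 (‖u‖⁻¹ • u) (‖v‖⁻¹ • v) (norm_smul_inv_norm (𝕜 := ℝ) hu)
    (norm_smul_inv_norm (𝕜 := ℝ) hv)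
  simp only [map_smul, LinearMap.smul_apply, norm_smul, norm_inv, norm_norm] at h2
  rw [← mul_assoc, ← mul_inv, inv_mul_le_iff₀ (by positivity)] at h2
  linarith

/-- A continuous bilinear map with a given linear one. -/
theorem exists_continuous_of_norm_self_le (B : F →ₗ[ℝ] F →ₗ[ℝ] G) (hB : ∀ u v, B u v = B v u)
    {K : ℝ} (hK0 : 0 ≤ K) (hK : ∀ u, ‖B u u‖ ≤ K * ‖u‖ ^ 2) :
    ∃ A : F →L[ℝ] F →L[ℝ] G, (∀ u v, A u v = B u v) ∧ ‖A‖ ≤ K :=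
  ⟨B.mkContinuous₂ K (norm_apply_le_of_norm_self_le B hB hK), fun _ _ => rfl,
    LinearMap.mkContinuous₂_norm_le _ hK0 _⟩

theorem norm_le_of_norm_self_le (A : F →L[ℝ] F →L[ℝ] G) (hA : ∀ u v, A u v = A v u)
    {K : ℝ} (hK0 : 0 ≤ K) (hK : ∀ u, ‖A u u‖ ≤ K * ‖u‖ ^ 2) : ‖A‖ ≤ K := by
  let B : F →ₗ[ℝ] F →ₗ[ℝ] G := LinearMap.mk₂ ℝ (fun u v => A u v) (by simp) (by simp) (by simp)
    (by simp)
  exact ContinuousLinearMap.opNorm_le_bound₂ A hK0 (norm_apply_le_of_norm_self_le B hA hK)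

end Polarization

/-! ### The form domain -/

namespace DirichletForm

variable {X : Type*} [MeasurableSpace X] {m : Measure X} (E : DirichletForm m)

theorem incl_injective : Function.Injective E.incl := Subtype.val_injective

theorem norm_sq_dom (u : E.Dom) : ‖u‖ ^ 2 = E.formDom u u + ‖E.incl u‖ ^ 2 := by
  rw [← real_inner_self_eq_norm_sq, ← real_inner_self_eq_norm_sq]
  exact E.inner_dom u u

theorem formDom_self_nonneg (u : E.Dom) : 0 ≤ E.formDom u u := E.nonneg u

theorem norm_incl_le (u : E.Dom) : ‖E.incl u‖ ≤ ‖u‖ := by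
  have h1 := E.norm_sq_dom u
  have h2 := E.formDom_self_nonneg u
  exact (sq_le_sq₀ (norm_nonneg _) (norm_nonneg _)).1 (by linarith)

/-- Completeness is the closedness of the form: a Cauchy sequence has a limit in `L²`, and `closed`
puts that limit into the domain with convergence of the energy. -/
instance completeSpace_dom : CompleteSpace E.Dom := by
  refine Metric.complete_of_cauchySeq_tendsto fun u hu => ?_
  obtain ⟨v, hv⟩ := cauchySeq_tendsto_of_complete (E.incl.uniformContinuous.comp_cauchySeq hu)
  obtain ⟨hvd, h⟩ := E.closed u v hv fun ε hε => by
    obtain ⟨N, hN⟩ := Metric.cauchySeq_iff.1 hu (Real.sqrt ε) (Real.sqrt_pos.2 hε)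
    refine ⟨N, fun n hn k hk => ?_⟩
    have h1 := hN n hn k hk
    rw [dist_eq_norm] at h1
    have h2 : ‖u n - u k‖ ^ 2 < ε := (Real.lt_sqrt (norm_nonneg _)).1 h1
    rw [norm_sq_dom] at h2
    have h3 : E.formDom (u n - u k) (u n - u k) < ε := by
      linarith [sq_nonneg ‖E.incl (u n - u k)‖]
    exact h3
  let v' : E.Dom := ⟨v, hvd⟩
  refine ⟨v', ?_⟩
  have h1 : Tendsto (fun n => E.formDom (u n - v') (u n - v') + ‖E.incl (u n) - v‖ ^ 2) atTop
      (𝓝 (0 + 0 ^ 2)) := by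
    refine Tendsto.add h ?_
    exact ((tendsto_iff_norm_sub_tendsto_zero.1 hv)).pow 2
  rw [tendsto_iff_norm_sub_tendsto_zero]
  have h2 : Tendsto (fun n => Real.sqrt (‖u n - v'‖ ^ 2)) atTop (𝓝 (Real.sqrt 0)) := by
    refine (Real.continuous_sqrt.tendsto 0).comp ?_
    rw [zero_pow two_ne_zero, add_zero] at h1
    refine h1.congr fun n => ?_
    rw [norm_sq_dom, map_sub]
    rfl
  simpa [Real.sqrt_sq (norm_nonneg _)] using h2

theorem ae_eq_of_incl_eq {u v : E.Dom} (h : ∀ᵐ x ∂m, E.incl u x = E.incl v x) : u = v :=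
  E.incl_injective (Lp.ext h)

/-- Lipschitz functions operate on the form domain. -/
theorem exists_lipschitz_comp {ξ : ℝ → ℝ} {C : ℝ} (hC : 0 < C) (hξ : ∀ x y, |ξ x - ξ y| ≤ C * |x - y|)
    (h0 : ξ 0 = 0) (u : E.Dom) :
    ∃ v : E.Dom, (∀ᵐ x ∂m, E.incl v x = ξ (E.incl u x)) ∧ E.formDom v v ≤ C ^ 2 * E.formDom u u := by
  have h1 : LipschitzWith 1 (fun x => C⁻¹ * ξ x) := LipschitzWith.of_dist_le_mul fun x y => by
    rw [Real.dist_eq, Real.dist_eq, ← mul_sub, abs_mul, abs_of_pos (inv_pos.2 hC), NNReal.coe_one,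
      one_mul, inv_mul_le_iff₀ hC]
    exact hξ x y
  obtain ⟨hu, h2⟩ := E.markov _ h1 (by simp [h0]) u
  let w : E.Dom := ⟨_, hu⟩
  refine ⟨C • w, ?_, ?_⟩
  · have e1 : E.incl (C • w) = C • E.incl w := map_smul _ _ _
    have e2 : (E.incl w : X → ℝ) =ᵐ[m] (fun x => C⁻¹ * ξ x) ∘ (E.incl u) :=
      LipschitzWith.coeFn_compLp h1 (by simp [h0]) (E.incl u)
    rw [e1]
    filter_upwards [Lp.coeFn_smul C (E.incl w), e2] with x h3 h4
    rw [h3, Pi.smul_apply, h4, smul_eq_mul, Function.comp_apply, mul_inv_cancel_left₀ hC.ne']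
  · simp only [map_smul, LinearMap.smul_apply, smul_eq_mul]
    rw [← mul_assoc, ← sq]
    exact mul_le_mul_of_nonneg_left h2 (sq_nonneg C)

theorem bddDom_iff (u : E.Dom) : E.BddDom u ↔ ∃ C, ∀ᵐ x ∂m, |E.incl u x| ≤ C := by
  constructor
  · intro h
    refine ⟨(eLpNormEssSup (E.incl u) m).toReal, ?_⟩
    have h1 := ae_le_eLpNormEssSup (f := E.incl u) (μ := m)
    have h2 : eLpNorm (E.incl u) (⊤ : ℝ≥0∞) m ≠ (⊤ : ℝ≥0∞) := h.2.ne
    rw [eLpNorm_exponent_top] at h2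
    filter_upwards [h1] with x hx
    rw [← Real.norm_eq_abs, ← toReal_enorm]
    exact ENNReal.toReal_mono h2 hx
  · rintro ⟨C, hC⟩
    exact memLp_top_of_bound (Lp.aestronglyMeasurable _) C hC

/-- The bounded elements of the form domain form an algebra. -/
theorem exists_mul {u v : E.Dom} (hu : E.BddDom u) (hv : E.BddDom v) :
    ∃ w : E.Dom, ∀ᵐ x ∂m, E.incl w x = E.incl u x * E.incl v x := by
  have hsq : ∀ u : E.Dom, E.BddDom u → ∃ w : E.Dom, ∀ᵐ x ∂m, E.incl w x = E.incl u x ^ 2 := by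
    intro u hu
    obtain ⟨C, hC⟩ := (E.bddDom_iff u).1 hu
    obtain ⟨D, hD⟩ : ∃ D, D = |C| + 1 := ⟨_, rfl⟩
    have hD0 : 0 < D := by rw [hD]; positivity
    -- The square is not Lipschitz, but truncated at `±D` it is, and `D` exceeds the bound of `u`.
    -- Products then follow by polarization.
    have hLip : ∀ x y : ℝ, |max (-D) (min x D) ^ 2 - max (-D) (min y D) ^ 2| ≤ 2 * D * |x - y| := by
      intro x y
      have h1 : |max (-D) (min x D) - max (-D) (min y D)| ≤ |x - y| := by
        refine (abs_max_sub_max_le_max _ _ _ _).trans ?_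
        rw [sub_self, abs_zero]
        refine max_le (abs_nonneg _) ((abs_min_sub_min_le_max _ _ _ _).trans ?_)
        rw [sub_self, abs_zero]
        exact max_le le_rfl (abs_nonneg _)
      have h2 : ∀ z, |max (-D) (min z D)| ≤ D := fun z => abs_le.2 ⟨le_max_left _ _,
        max_le (by linarith) (min_le_right _ _)⟩
      rw [sq_sub_sq, abs_mul]
      refine mul_le_mul ((abs_add_le _ _).trans (by linarith [h2 x, h2 y])) h1 (abs_nonneg _)
        (by positivity)
    obtain ⟨w, hw, -⟩ := E.exists_lipschitz_comp (by positivity) hLip (by simp [hD0.le]) u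
    refine ⟨w, ?_⟩
    filter_upwards [hw, hC] with x h1 h2
    have h3 : |E.incl u x| ≤ D := h2.trans (by rw [hD]; linarith [le_abs_self C])
    rw [h1, min_eq_left (abs_le.1 h3).2, max_eq_right (abs_le.1 h3).1]
  have huv : E.BddDom (u + v) := by
    rw [BddDom, map_add]
    exact (MemLp.add hu hv).ae_eq (Lp.coeFn_add _ _).symm
  obtain ⟨w₁, h₁⟩ := hsq _ huv
  obtain ⟨w₂, h₂⟩ := hsq _ hu
  obtain ⟨w₃, h₃⟩ := hsq _ hv
  refine ⟨(1 / 2 : ℝ) • (w₁ - w₂ - w₃), ?_⟩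
  rw [map_smul, map_sub, map_sub]
  rw [map_add] at h₁
  filter_upwards [h₁, h₂, h₃, Lp.coeFn_add (E.incl u) (E.incl v),
    Lp.coeFn_smul (1 / 2 : ℝ) (E.incl w₁ - E.incl w₂ - E.incl w₃),
    Lp.coeFn_sub (E.incl w₁ - E.incl w₂) (E.incl w₃),
    Lp.coeFn_sub (E.incl w₁) (E.incl w₂)] with x f1 f2 f3 f4 f5 f6 f7
  rw [f5, Pi.smul_apply, f6, Pi.sub_apply, f7, Pi.sub_apply, f1, f2, f3, f4, Pi.add_apply, smul_eq_mul]
  ring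

end DirichletForm

/-! ### Multiplication by exponentials on the form domain -/

namespace DirichletForm

variable {X : Type*} [MeasurableSpace X] {m : Measure X} {E : DirichletForm m}

section Gamma

variable {Γ : E.Dom →ₗ[ℝ] E.Dom →ₗ[ℝ] Lp ℝ 1 m}

/-- A pointwise form of the Cauchy–Schwarz inequality. -/
theorem ae_two_mul_le (hs : ∀ u v, Γ u v = Γ v u) (h0 : ∀ u, ∀ᵐ x ∂m, 0 ≤ Γ u u x) (u v : E.Dom) :
    ∀ᵐ x ∂m, ∀ q : ℝ, 2 * q * Γ u v x ≤ q ^ 2 * Γ u u x + Γ v v x := by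
  -- Rational `q` first, so that the exceptional null set does not depend on `q`; afterwards `q` may
  -- be a function of `x`.
  have h1 : ∀ q : ℚ, ∀ᵐ x ∂m, 2 * (q : ℝ) * Γ u v x ≤ (q : ℝ) ^ 2 * Γ u u x + Γ v v x := by
    intro q
    have e : Γ (v - (q : ℝ) • u) (v - (q : ℝ) • u)
        = Γ v v - ((2 * (q : ℝ)) • Γ u v - (q : ℝ) ^ 2 • Γ u u) := by
      simp only [map_sub, map_smul, LinearMap.sub_apply, LinearMap.smul_apply, hs v u]
      module
    filter_upwards [h0 (v - (q : ℝ) • u), Lp.coeFn_sub (Γ v v) ((2 * (q : ℝ)) • Γ u v - (q : ℝ) ^ 2 • Γ u u),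
      Lp.coeFn_sub ((2 * (q : ℝ)) • Γ u v) ((q : ℝ) ^ 2 • Γ u u), Lp.coeFn_smul (2 * (q : ℝ)) (Γ u v),
      Lp.coeFn_smul ((q : ℝ) ^ 2) (Γ u u)] with x f1 f2 f3 f4 f5
    rw [e, f2, Pi.sub_apply, f3, Pi.sub_apply, f4, f5, Pi.smul_apply, Pi.smul_apply, smul_eq_mul,
      smul_eq_mul] at f1
    linarith
  filter_upwards [ae_all_iff.2 h1] with x hx q
  refine Rat.denseRange_cast.induction_on (p := fun q : ℝ => 2 * q * Γ u v x ≤ q ^ 2 * Γ u u x + Γ v v x)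
    q ?_ hx
  exact isClosed_le (by fun_prop) (by fun_prop)

/-- The diffusion property for `Ψ(p) = exp (p 0) * p 1`, which vanishes at the origin as required.
-/
theorem ae_apply_mul_exp (hΓ : E.IsDiffusion Γ) {f w z v : E.Dom} (hf : E.BddDom f) (hw : E.BddDom w)
    (hv : E.BddDom v) (hz : ∀ᵐ x ∂m, E.incl z x = Real.exp (E.incl f x) * E.incl w x) :
    ∀ᵐ x ∂m, Γ z v x
      = Real.exp (E.incl f x) * (E.incl w x * Γ f v x + Γ w v x) := by
  let Ψ : (Fin 2 → ℝ) → ℝ := fun p => Real.exp (p 0) * p 1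
  have hΨ : ∀ p, HasFDerivAt Ψ (Real.exp (p 0) • ContinuousLinearMap.proj (R := ℝ) (φ := fun _ : Fin 2 => ℝ) 1
      + p 1 • (Real.exp (p 0) • ContinuousLinearMap.proj (R := ℝ) (φ := fun _ : Fin 2 => ℝ) 0)) p := fun p =>
    ((hasFDerivAt_apply (𝕜 := ℝ) (0 : Fin 2) p).exp).mul (hasFDerivAt_apply (𝕜 := ℝ) (1 : Fin 2) p)
  have h1 := hΓ 2 ![f, w] v z Ψ (by intro i; fin_cases i <;> simpa) hv
    (by fun_prop) (by simp [Ψ]) (by filter_upwards [hz] with x hx; simp [Ψ, hx])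
  filter_upwards [h1] with x hx
  rw [hx, Fin.sum_univ_two, (hΨ _).fderiv]
  simp
  ring

/-- The chain rule in both arguments gives `Γ(e^f w) = e^{2f} (w² Γ(f) + 2 w Γ(f, w) + Γ(w))`, and
the mixed term is absorbed by the other two. The chain rule is available for `Γ` and the bound on
`f` for `Γr`, so comparability is used in both directions, which costs `D²`. -/
theorem formDom_mul_exp_le {Γr : E.Dom →ₗ[ℝ] E.Dom →ₗ[ℝ] Lp ℝ 1 m} (hr : E.IsSquareField Γr)
    (hs : ∀ u v, Γ u v = Γ v u) (h0 : ∀ u, ∀ᵐ x ∂m, 0 ≤ Γ u u x) (hΓ : E.IsDiffusion Γ) {D : ℝ}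
    (hD : 0 < D) (hc : ∀ u, ∀ᵐ x ∂m, 1 / D * Γr u u x ≤ Γ u u x ∧ Γ u u x ≤ D * Γr u u x)
    {f w z : E.Dom} {C C₂ : ℝ} (hC₂ : 1 ≤ C₂) (hf : ∀ᵐ x ∂m, |E.incl f x| ≤ C)
    (hf₂ : ∀ᵐ x ∂m, Γr f f x ≤ C₂) (hw : E.BddDom w) (hz₀ : E.BddDom z)
    (hz : ∀ᵐ x ∂m, E.incl z x = Real.exp (E.incl f x) * E.incl w x) :
    E.formDom z z ≤ 2 * Real.exp (2 * C) * D ^ 2 * C₂ * ‖w‖ ^ 2 := by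
  have hf₀ : E.BddDom f := (E.bddDom_iff f).2 ⟨C, hf⟩
  have hwi : Integrable (fun x => E.incl w x ^ 2) m := (Lp.memLp (E.incl w)).integrable_sq
  have hwn : ∫ x, E.incl w x ^ 2 ∂m = ‖E.incl w‖ ^ 2 := by
    rw [← real_inner_self_eq_norm_sq, L2.inner_def]
    simp [sq]
  rw [E.norm_sq_dom w, ← hr.integral_eq z z, ← hr.integral_eq w w, ← hwn]
  have key : ∀ᵐ x ∂m, Γr z z x
      ≤ 2 * Real.exp (2 * C) * D ^ 2 * C₂ * (Γr w w x + E.incl w x ^ 2) := by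
    filter_upwards [ae_apply_mul_exp hΓ hf₀ hw hz₀ hz, ae_apply_mul_exp hΓ hf₀ hw hf₀ hz,
      ae_apply_mul_exp hΓ hf₀ hw hw hz, ae_two_mul_le hs h0 f w, hc z, hc f, hc w, hf, hf₂,
      hr.nonneg w, h0 f, h0 w]
      with x f1 f2 f3 f4 f5 f6 f7 f8 f9 f10 f11 f12
    rw [hs f z, hs w z, f2, f3] at f1
    rw [hs w f] at f1
    -- The pointwise inequality with `q` equal to the value of `w` at `x`.
    have g1 := f4 (E.incl w x)
    set W := E.incl w x
    set e := Real.exp (E.incl f x) with he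
    have g2 : e ^ 2 ≤ Real.exp (2 * C) := by
      rw [he, sq, ← Real.exp_add]
      exact Real.exp_le_exp.2 (by linarith [(abs_le.1 f8).2])
    have g3 : Γ z z x ≤ 2 * e ^ 2 * (W ^ 2 * Γ f f x + Γ w w x) := by
      rw [f1]
      have := mul_le_mul_of_nonneg_left g1 (sq_nonneg e)
      linarith
    have g4 : W ^ 2 * Γ f f x + Γ w w x ≤ D * C₂ * (Γr w w x + W ^ 2) := by
      have g5 : Γ f f x ≤ D * C₂ := f6.2.trans (by gcongr)
      have g6 : D * Γr w w x ≤ D * C₂ * Γr w w x := by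
        rw [mul_assoc]; gcongr; exact le_mul_of_one_le_left f10 hC₂
      have g7 := mul_le_mul_of_nonneg_left g5 (sq_nonneg W)
      linarith [f7.2]
    have g5 : Γr z z x ≤ D * Γ z z x := by
      have := f5.1
      rw [div_mul_eq_mul_div, one_mul, div_le_iff₀ hD] at this
      linarith
    calc Γr z z x ≤ D * (2 * e ^ 2 * (W ^ 2 * Γ f f x + Γ w w x)) := g5.trans (by gcongr)
      _ ≤ D * (2 * Real.exp (2 * C) * (D * C₂ * (Γr w w x + W ^ 2))) := by gcongr
      _ = _ := by ring
  have hwΓ := L1.integrable_coeFn (Γr w w)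
  refine (integral_mono_ae (L1.integrable_coeFn (Γr z z)) ((hwΓ.add hwi).const_mul _) key).trans_eq ?_
  rw [integral_const_mul]
  congr 1
  exact integral_add hwΓ hwi

/-- Multiplication of bounded elements of the form domain by the exponential of another one. -/
theorem exists_mul_exp_of_bddDom {f w : E.Dom} {C : ℝ} (hf : ∀ᵐ x ∂m, |E.incl f x| ≤ C)
    (hw : E.BddDom w) :
    ∃ z : E.Dom, (∀ᵐ x ∂m, E.incl z x = Real.exp (E.incl f x) * E.incl w x) ∧ E.BddDom z := by
  obtain ⟨D, hCD, hD⟩ : ∃ D, C ≤ D ∧ 0 ≤ D := ⟨max C 0, le_max_left _ _, le_max_right _ _⟩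
  -- The product is written as `(e^f - 1) w + w`: only `e^f - 1` vanishes where `f` does, so it is
  -- the factor that lies in the form domain.
  have hLip : ∀ x y : ℝ, |(Real.exp (max (-D) (min x D)) - 1) - (Real.exp (max (-D) (min y D)) - 1)|
      ≤ Real.exp D * |x - y| := by
    intro x y
    have h1 : |max (-D) (min x D) - max (-D) (min y D)| ≤ |x - y| := by
      refine (abs_max_sub_max_le_max _ _ _ _).trans ?_
      rw [sub_self, abs_zero]
      refine max_le (abs_nonneg _) ((abs_min_sub_min_le_max _ _ _ _).trans ?_)
      rw [sub_self, abs_zero]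
      exact max_le le_rfl (abs_nonneg _)
    have h2 : ∀ z, max (-D) (min z D) ≤ D := fun z => max_le (by linarith) (min_le_right _ _)
    rw [sub_sub_sub_cancel_right]
    refine le_trans ?_ (mul_le_mul_of_nonneg_left h1 (Real.exp_pos D).le)
    exact (convex_Iic D).norm_image_sub_le_of_norm_deriv_le (f := Real.exp)
      (fun z _ => Real.differentiableAt_exp)
      (fun z hz => by
        rw [Real.deriv_exp, Real.norm_of_nonneg (Real.exp_pos z).le]; exact Real.exp_le_exp.2 hz)
      (h2 y) (h2 x)
  obtain ⟨g, hg, -⟩ := E.exists_lipschitz_comp (Real.exp_pos D) hLip (by simp [hD]) f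
  have hg' : ∀ᵐ x ∂m, E.incl g x = Real.exp (E.incl f x) - 1 := by
    filter_upwards [hg, hf] with x h1 h2
    have h3 := abs_le.1 (h2.trans hCD)
    rw [h1, min_eq_left h3.2, max_eq_right h3.1]
  have hfb : ∀ᵐ x ∂m, Real.exp (E.incl f x) ≤ Real.exp D := by
    filter_upwards [hf] with x hx
    exact Real.exp_le_exp.2 ((abs_le.1 (hx.trans hCD)).2)
  have hgb : E.BddDom g := (E.bddDom_iff g).2 ⟨Real.exp D + 1, by
    filter_upwards [hg', hfb] with x h1 h2
    rw [h1, abs_le]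
    constructor <;> linarith [Real.exp_pos (E.incl f x)]⟩
  obtain ⟨y, hy⟩ := E.exists_mul hgb hw
  have hz : ∀ᵐ x ∂m, E.incl (y + w) x = Real.exp (E.incl f x) * E.incl w x := by
    rw [map_add]
    filter_upwards [hy, hg', Lp.coeFn_add (E.incl y) (E.incl w)] with x h1 h2 h3
    rw [h3, Pi.add_apply, h1, h2]
    ring
  refine ⟨y + w, hz, (E.bddDom_iff _).2 ?_⟩
  obtain ⟨B, hB⟩ := (E.bddDom_iff w).1 hw
  refine ⟨Real.exp D * B, ?_⟩
  filter_upwards [hz, hfb, hB] with x h1 h2 h3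
  rw [h1, abs_mul, abs_of_pos (Real.exp_pos _)]
  gcongr

end Gamma

/-- Truncations approximate in the form domain. -/
theorem exists_truncation (w : E.Dom) : ∃ W : ℕ → E.Dom, (∀ n, E.BddDom (W n)) ∧
    (∀ n, ‖W n‖ ≤ ‖w‖) ∧ Tendsto (fun n => E.incl (W n)) atTop (𝓝 (E.incl w)) := by
  have hLip : ∀ (n : ℕ) (x y : ℝ), |max (-(n : ℝ)) (min x n) - max (-(n : ℝ)) (min y n)| ≤ 1 * |x - y| := by
    intro n x y
    rw [one_mul]
    refine (abs_max_sub_max_le_max _ _ _ _).trans ?_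
    rw [sub_self, abs_zero]
    refine max_le (abs_nonneg _) ((abs_min_sub_min_le_max _ _ _ _).trans ?_)
    rw [sub_self, abs_zero]
    exact max_le le_rfl (abs_nonneg _)
  choose W hW hW' using fun n : ℕ => E.exists_lipschitz_comp one_pos (hLip n) (by simp) w
  have habs : ∀ (n : ℕ) (x : ℝ), |max (-(n : ℝ)) (min x n)| ≤ |x| := fun n x => by
    have := hLip n x 0
    simpa using this
  have hle : ∀ n, ‖E.incl (W n)‖ ≤ ‖E.incl w‖ := fun n => Lp.norm_le_norm_of_ae_le (by
    filter_upwards [hW n] with x hx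
    rw [hx]
    exact habs n _)
  refine ⟨W, fun n => (E.bddDom_iff _).2 ⟨n, ?_⟩, fun n => ?_, ?_⟩
  · filter_upwards [hW n] with x hx
    rw [hx]
    exact abs_le.2 ⟨le_max_left _ _, max_le (by linarith [(Nat.cast_nonneg n : (0 : ℝ) ≤ n)]) (min_le_right _ _)⟩
  · refine (sq_le_sq₀ (norm_nonneg _) (norm_nonneg _)).1 ?_
    rw [norm_sq_dom, norm_sq_dom]
    have h1 := hW' n
    rw [one_pow, one_mul] at h1
    exact add_le_add h1 (pow_le_pow_left₀ (norm_nonneg _) (hle n) 2)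
  · rw [tendsto_iff_norm_sub_tendsto_zero]
    have hn : ∀ n, ‖E.incl (W n) - E.incl w‖ ^ 2
        = ∫ x, (max (-(n : ℝ)) (min (E.incl w x) n) - E.incl w x) ^ 2 ∂m := fun n => by
      rw [← real_inner_self_eq_norm_sq, L2.inner_def]
      refine integral_congr_ae ?_
      filter_upwards [hW n, Lp.coeFn_sub (E.incl (W n)) (E.incl w)] with x h1 h2
      simp only [h2, Pi.sub_apply, h1, RCLike.inner_apply, conj_trivial, sq]
    have h1 : Tendsto (fun n => ‖E.incl (W n) - E.incl w‖ ^ 2) atTop (𝓝 0) := by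
      simp only [hn]
      have h2 : (0 : ℝ) = ∫ x, (0 : ℝ) ∂m := by simp
      rw [h2]
      refine tendsto_integral_of_dominated_convergence (fun x => 4 * E.incl w x ^ 2) (fun n => ?_)
        ((Lp.memLp (E.incl w)).integrable_sq.const_mul 4) (fun n => ?_) ?_
      · have hw := Lp.aestronglyMeasurable (E.incl w)
        exact ((aestronglyMeasurable_const.sup (hw.inf aestronglyMeasurable_const)).sub hw).pow 2
      · refine Eventually.of_forall fun x => ?_
        rw [Real.norm_of_nonneg (sq_nonneg _), ← sq_abs]
        have h3 : |max (-(n : ℝ)) (min (E.incl w x) n) - E.incl w x| ≤ 2 * |E.incl w x| := by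
          refine (abs_sub _ _).trans ?_
          linarith [habs n (E.incl w x)]
        refine (pow_le_pow_left₀ (abs_nonneg _) h3 2).trans_eq ?_
        rw [mul_pow, sq_abs]
        norm_num
      · refine Eventually.of_forall fun x => tendsto_const_nhds.congr' ?_
        obtain ⟨N, hN⟩ := exists_nat_ge |E.incl w x|
        filter_upwards [eventually_ge_atTop N] with n hn
        have h4 := abs_le.1 (hN.trans (Nat.cast_le.2 hn))
        rw [min_eq_left h4.2, max_eq_right h4.1]
        simp
    have h2 := h1.sqrt
    simpa [Real.sqrt_sq (norm_nonneg _)] using h2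

/-- Multiplication by a bounded function as a bounded operator on `L²`. -/
theorem exists_Lp_mul {ρ : X → ℝ} {C : ℝ} (hρ : AEStronglyMeasurable ρ m) (hC : ∀ᵐ x ∂m, |ρ x| ≤ C) :
    ∃ A : Lp ℝ 2 m →L[ℝ] Lp ℝ 2 m, ∀ v, ∀ᵐ x ∂m, A v x = ρ x * v x := by
  have hmem : ∀ v : Lp ℝ 2 m, MemLp (fun x => ρ x * v x) 2 m := fun v =>
    MemLp.of_le_mul (c := C) (Lp.memLp v) (hρ.mul (Lp.aestronglyMeasurable v)) (by
      filter_upwards [hC] with x hx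
      rw [norm_mul]
      gcongr
      exact hx)
  let A : Lp ℝ 2 m →ₗ[ℝ] Lp ℝ 2 m :=
    { toFun := fun v => (hmem v).toLp
      map_add' := fun v w => by
        refine Lp.ext ?_
        filter_upwards [(hmem (v + w)).coeFn_toLp, (hmem v).coeFn_toLp, (hmem w).coeFn_toLp,
          Lp.coeFn_add v w, Lp.coeFn_add (hmem v).toLp (hmem w).toLp] with x h1 h2 h3 h4 h5
        rw [h1, h5, Pi.add_apply, h2, h3, h4, Pi.add_apply, mul_add]
      map_smul' := fun r v => by
        refine Lp.ext ?_
        filter_upwards [(hmem (r • v)).coeFn_toLp, (hmem v).coeFn_toLp,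
          Lp.coeFn_smul r v, Lp.coeFn_smul r (hmem v).toLp] with x h1 h2 h3 h4
        rw [h1, RingHom.id_apply, h4, Pi.smul_apply, h2, h3, Pi.smul_apply, smul_eq_mul, smul_eq_mul]
        ring }
  refine ⟨A.mkContinuous C fun v => Lp.norm_le_mul_norm_of_ae_le_mul ?_, fun v => (hmem v).coeFn_toLp⟩
  filter_upwards [(hmem v).coeFn_toLp, hC] with x h1 h2
  have h3 : A v x = ρ x * v x := h1
  change ‖A v x‖ ≤ _
  rw [h3, norm_mul]
  gcongr
  exact h2

/-- Multiplication by the exponential of a bounded element of the form domain with bounded square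
field is a bounded operator on the form domain. -/
theorem exists_mulExp {Γ Γr : E.Dom →ₗ[ℝ] E.Dom →ₗ[ℝ] Lp ℝ 1 m} (hr : E.IsSquareField Γr)
    (hs : ∀ u v, Γ u v = Γ v u) (h0 : ∀ u, ∀ᵐ x ∂m, 0 ≤ Γ u u x) (hΓ : E.IsDiffusion Γ) {D : ℝ}
    (hD : 0 < D) (hc : ∀ u, ∀ᵐ x ∂m, 1 / D * Γr u u x ≤ Γ u u x ∧ Γ u u x ≤ D * Γr u u x)
    {f : E.Dom} {C C₂ : ℝ} (hC₂ : 1 ≤ C₂) (hf : ∀ᵐ x ∂m, |E.incl f x| ≤ C)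
    (hf₂ : ∀ᵐ x ∂m, Γr f f x ≤ C₂) :
    ∃ N : E.Dom →L[ℝ] E.Dom, (∀ w, ∀ᵐ x ∂m, E.incl (N w) x = Real.exp (E.incl f x) * E.incl w x) ∧
      ‖N‖ ≤ Real.sqrt (2 * Real.exp (2 * C) * D ^ 2 * C₂ + Real.exp (2 * C)) := by
  set K := Real.sqrt (2 * Real.exp (2 * C) * D ^ 2 * C₂ + Real.exp (2 * C)) with hK
  have hexp : ∀ᵐ x ∂m, |Real.exp (E.incl f x)| ≤ Real.exp C := by
    filter_upwards [hf] with x hx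
    rw [abs_of_pos (Real.exp_pos _)]
    exact Real.exp_le_exp.2 (abs_le.1 hx).2
  obtain ⟨A, hA⟩ := exists_Lp_mul (Real.continuous_exp.comp_aestronglyMeasurable
    (Lp.aestronglyMeasurable (E.incl f))) hexp
  have hex : ∀ w : E.Dom, ∃ z : E.Dom, E.incl z = A (E.incl w) ∧ ‖z‖ ≤ K * ‖w‖ := by
    intro w
    -- The bound for truncated `w` is uniform in `n`, and balls of the form domain are closed in
    -- `L²`.
    obtain ⟨W, hW, hW', hlim⟩ := exists_truncation w
    choose Z hZ hZ' using fun n => exists_mul_exp_of_bddDom hf (hW n)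
    have hZA : ∀ n, E.incl (Z n) = A (E.incl (W n)) := fun n => Lp.ext (by
      filter_upwards [hZ n, hA (E.incl (W n))] with x h1 h2
      rw [h1, h2])
    have hZn : ∀ n, ‖Z n‖ ≤ K * ‖w‖ := by
      intro n
      have h1 := formDom_mul_exp_le hr hs h0 hΓ hD hc hC₂ hf hf₂ (hW n) (hZ' n) (hZ n)
      have h2 : ‖E.incl (Z n)‖ ≤ Real.exp C * ‖E.incl (W n)‖ := by
        refine Lp.norm_le_mul_norm_of_ae_le_mul ?_
        filter_upwards [hZ n, hexp] with x h1 h2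
        rw [h1, norm_mul]
        gcongr
        exact h2
      have h3 : ‖E.incl (Z n)‖ ^ 2 ≤ Real.exp (2 * C) * ‖W n‖ ^ 2 := by
        refine (pow_le_pow_left₀ (norm_nonneg _) h2 2).trans ?_
        rw [mul_pow, ← Real.exp_nat_mul]
        push_cast
        gcongr
        exact E.norm_incl_le _
      refine le_trans ?_ (mul_le_mul_of_nonneg_left (hW' n) (Real.sqrt_nonneg _))
      refine (sq_le_sq₀ (norm_nonneg _) (by positivity)).1 ?_
      rw [mul_pow, hK, Real.sq_sqrt (by positivity), norm_sq_dom]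
      linarith
    obtain ⟨z, hz, hz'⟩ := exists_of_tendsto_of_norm_le (ι := E.incl) hZn (h := A (E.incl w)) (by
      simp only [hZA]
      exact (A.continuous.tendsto _).comp hlim)
    exact ⟨z, hz, hz'⟩
  choose N hN hN' using hex
  let N' : E.Dom →ₗ[ℝ] E.Dom :=
    { toFun := N
      map_add' := fun v w => E.incl_injective (by simp only [map_add, hN])
      map_smul' := fun r v => E.incl_injective (by simp only [map_smul, hN, RingHom.id_apply]) }
  refine ⟨N'.mkContinuous K hN', fun w => ?_, LinearMap.mkContinuous_norm_le _ (Real.sqrt_nonneg _) _⟩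
  have h1 : E.incl ((N'.mkContinuous K hN') w) = A (E.incl w) := hN w
  rw [h1]
  exact hA _

end DirichletForm

/-! ### The form flow of a time-dependent Dirichlet form -/

instance DirichletForm.normedSpaceDom {X : Type*} [MeasurableSpace X] {m : Measure X}
    (E : DirichletForm m) : NormedSpace ℝ E.Dom := InnerProductSpace.toNormedSpace

namespace TimeDepForm

variable {X : Type*} [MeasurableSpace X] {m : Measure X} {T L : ℝ} (S : TimeDepForm m T)

theorem exists_L1_functional {ρ : X → ℝ} {C : ℝ} (hρ : AEStronglyMeasurable ρ m)
    (hC : ∀ x, |ρ x| ≤ C) :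
    ∃ J : Lp ℝ 1 m →ₗ[ℝ] ℝ, (∀ g, J g = ∫ x, ρ x * g x ∂m) ∧ ∀ g, |J g| ≤ C * ‖g‖ := by
  have hi : ∀ g : Lp ℝ 1 m, Integrable (fun x => ρ x * g x) m := fun g =>
    (L1.integrable_coeFn g).bdd_mul hρ (Eventually.of_forall hC)
  refine ⟨{ toFun := fun g => ∫ x, ρ x * g x ∂m
            map_add' := fun g h => ?_
            map_smul' := fun r g => ?_ }, fun _ => rfl, fun g => ?_⟩
  · rw [← integral_add (hi g) (hi h)]
    refine integral_congr_ae ?_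
    filter_upwards [Lp.coeFn_add g h] with x hx
    rw [hx, Pi.add_apply, mul_add]
  · rw [RingHom.id_apply, smul_eq_mul, ← integral_const_mul]
    refine integral_congr_ae ?_
    filter_upwards [Lp.coeFn_smul r g] with x hx
    rw [hx, Pi.smul_apply, smul_eq_mul]
    ring
  · change |∫ x, ρ x * g x ∂m| ≤ _
    rw [L1.norm_eq_integral_norm, ← integral_const_mul, ← Real.norm_eq_abs]
    refine norm_integral_le_of_norm_le ((L1.integrable_coeFn g).norm.const_mul _)
      (Eventually.of_forall fun x => ?_)
    rw [norm_mul]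
    gcongr
    exact hC x

section Weight

variable {t : ℝ}

theorem measurable_f (ht : t ∈ Ioo 0 T) : Measurable (S.f t) :=
  S.f_meas.comp (measurable_const.prodMk measurable_id : Measurable fun x : X =>
    ((⟨t, ht⟩ : Ioo (0 : ℝ) T), x))

theorem measurable_weight (ht : t ∈ Ioo 0 T) : Measurable fun x => Real.exp (-S.f t x) :=
  (S.measurable_f ht).neg.exp

theorem integral_meas (ht : t ∈ Ioo 0 T) (g : X → ℝ) :
    ∫ x, g x ∂(S.meas t) = ∫ x, Real.exp (-S.f t x) * g x ∂m := by
  rw [meas, integral_withDensity_eq_integral_toReal_smul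
    (S.measurable_weight ht).ennreal_ofReal (Eventually.of_forall fun _ => ENNReal.ofReal_lt_top)]
  simp only [ENNReal.toReal_ofReal (Real.exp_pos _).le, smul_eq_mul]

variable {S}

theorem WeightLipschitz.abs_weight_sub_le (hf : S.WeightLipschitz L) {C : ℝ}
    (hC : ∀ t ∈ Ioo 0 T, ∀ x, |S.f t x| ≤ C) {r : ℝ} (ht : t ∈ Ioo 0 T) (hr : r ∈ Ioo 0 T) (x : X) :
    |Real.exp (-S.f t x) - Real.exp (-S.f r x)| ≤ Real.exp C * (L * |t - r|) := by
  have h1 : |Real.exp (-S.f t x) - Real.exp (-S.f r x)| ≤ Real.exp C * |-S.f t x - -S.f r x| :=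
    (convex_Iic C).norm_image_sub_le_of_norm_deriv_le (f := Real.exp)
      (fun z _ => Real.differentiableAt_exp)
      (fun z hz => by
        rw [Real.deriv_exp, Real.norm_of_nonneg (Real.exp_pos z).le]; exact Real.exp_le_exp.2 hz)
      (neg_le_of_abs_le (hC r hr x) |> fun h => by simpa using neg_le.1 h)
      (neg_le_of_abs_le (hC t ht x) |> fun h => by simpa using neg_le.1 h)
  refine h1.trans (mul_le_mul_of_nonneg_left ?_ (Real.exp_pos C).le)
  rw [neg_sub_neg, abs_sub_comm]
  exact hf r hr t ht x

theorem WeightLipschitz.weight_le (hf : S.WeightLipschitz L) {r : ℝ} (ht : t ∈ Ioo 0 T)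
    (hr : r ∈ Ioo 0 T) (x : X) :
    Real.exp (-S.f t x) ≤ Real.exp (L * |t - r|) * Real.exp (-S.f r x) := by
  rw [← Real.exp_add]
  refine Real.exp_le_exp.2 ?_
  linarith [(abs_le.1 (hf r hr t ht x)).1]

end Weight

theorem norm_Γ_self_le {t D : ℝ} (h0 : ∀ u, ∀ᵐ x ∂m, 0 ≤ S.Γ t u u x)
    (hD : ∀ u, ∀ᵐ x ∂m, S.Γ t u u x ≤ D * S.Γref u u x) (hD0 : 0 ≤ D) (u : S.ref.Dom) :
    ‖S.Γ t u u‖ ≤ D * ‖u‖ ^ 2 := by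
  rw [L1.norm_eq_integral_norm, S.ref.norm_sq_dom]
  have h1 : ∫ x, ‖S.Γ t u u x‖ ∂m ≤ ∫ x, D * S.Γref u u x ∂m := by
    refine integral_mono_ae (L1.integrable_coeFn _).norm ((L1.integrable_coeFn _).const_mul D) ?_
    filter_upwards [h0 u, hD u] with x h2 h3
    rw [Real.norm_of_nonneg h2]
    exact h3
  rw [integral_const_mul, S.ref_squareField.integral_eq] at h1
  refine h1.trans (mul_le_mul_of_nonneg_left ?_ hD0)
  linarith [sq_nonneg ‖S.ref.incl u‖]

variable {S}

/-- The pointwise bound is integrated over `X`, and the norm of the time integral is at most the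
length of the interval times the uniform bound on `‖Γ r u u‖`. -/
theorem GammaLogLipschitz.norm_sub_le (hΓ : S.GammaLogLipschitz L) (hL : 0 ≤ L) {D : ℝ}
    {u : S.ref.Dom} (hD : ∀ t ∈ Ioo 0 T, ‖S.Γ t u u‖ ≤ D * ‖u‖ ^ 2) {t r : ℝ} (ht : t ∈ Ioo 0 T)
    (hr : r ∈ Ioo 0 T) : ‖S.Γ t u u - S.Γ r u u‖ ≤ 2 * L * (D * ‖u‖ ^ 2 * |t - r|) := by
  have key : ∀ s t, s ∈ Ioo 0 T → t ∈ Ioo 0 T → s < t →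
      ‖S.Γ t u u - S.Γ s u u‖ ≤ 2 * L * (D * ‖u‖ ^ 2 * |t - s|) := by
    intro s t hs ht hst
    have h1 : ‖∫ r in s..t, S.Γ r u u‖ ≤ D * ‖u‖ ^ 2 * |t - s| :=
      intervalIntegral.norm_integral_le_of_norm_le_const fun r hr => by
        rw [uIoc_of_le hst.le] at hr
        exact hD r ⟨hs.1.trans hr.1, hr.2.trans_lt ht.2⟩
    refine le_trans ?_ (mul_le_mul_of_nonneg_left h1 (by positivity))
    refine Lp.norm_le_mul_norm_of_ae_le_mul ?_
    filter_upwards [hΓ u s hs t ht hst, Lp.coeFn_sub (S.Γ t u u) (S.Γ s u u)] with x h2 h3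
    rw [h3, Pi.sub_apply, Real.norm_eq_abs, Real.norm_eq_abs]
    exact h2.trans (mul_le_mul_of_nonneg_left (le_abs_self _) (by positivity))
  rcases lt_trichotomy t r with h | rfl | h
  · rw [norm_sub_rev, abs_sub_comm]
    exact key t r ht hr h
  · simp
  · exact key r t hr ht h

theorem integrable_weight_mul (ht : t ∈ Ioo 0 T) {C : ℝ} (hC : ∀ t ∈ Ioo 0 T, ∀ x, |S.f t x| ≤ C)
    {g : X → ℝ} (hg : Integrable g m) : Integrable (fun x => Real.exp (-S.f t x) * g x) m := by
  refine hg.bdd_mul (c := Real.exp C) (S.measurable_weight ht).aestronglyMeasurable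
    (Eventually.of_forall fun x => ?_)
  rw [Real.norm_of_nonneg (Real.exp_pos _).le]
  exact Real.exp_le_exp.2 (by linarith [(abs_le.1 (hC t ht x)).1])

theorem Lp_integrable_sq (v : Lp ℝ 2 m) : Integrable (fun x => v x * v x) m := by
  simpa [sq] using (Lp.memLp v).integrable_sq

theorem Lp_integral_sq (v : Lp ℝ 2 m) : ∫ x, v x * v x ∂m = ‖v‖ ^ 2 := by
  rw [← real_inner_self_eq_norm_sq, L2.inner_def]
  simp [sq]

/-- The abstract form flow of a time-dependent Dirichlet form. -/
theorem exists_formFlow (hf : S.WeightLipschitz L) (hΓ : S.GammaLogLipschitz L) (hL : 0 ≤ L) :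
    ∃ E : FormFlow S.ref.Dom (Lp ℝ 2 m) T L, E.ι = S.ref.incl ∧
      (∀ t ∈ Ioo 0 T, ∀ u v, E.a t u v = S.energy t u v) ∧
      (∀ t ∈ Ioo 0 T, ∀ u v, E.b t u v = ∫ x, Real.exp (-S.f t x) * (u x * v x) ∂m) ∧
      (∀ t ∈ Ioo 0 T, ∀ w, ∀ᵐ x ∂m,
        S.ref.incl (E.N t w) x = S.ref.incl w x * Real.exp (-S.f t x)) := by
  obtain ⟨C, hC⟩ := S.f_bdd
  obtain ⟨C₁, hC₁⟩ := S.f_dom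
  obtain ⟨D, hD, hcomp⟩ := S.Γ_comparable
  set C₂ := max C₁ 1
  have hC₂ : 1 ≤ C₂ := le_max_right _ _
  have hρ : ∀ t ∈ Ioo 0 T, ∀ x, |Real.exp (-S.f t x)| ≤ Real.exp C := fun t ht x => by
    rw [abs_of_pos (Real.exp_pos _)]
    exact Real.exp_le_exp.2 (by linarith [(abs_le.1 (hC t ht x)).1])
  have hρ' : ∀ t ∈ Ioo 0 T, ∀ x, Real.exp (-C) ≤ Real.exp (-S.f t x) := fun t ht x =>
    Real.exp_le_exp.2 (by linarith [(abs_le.1 (hC t ht x)).2])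
  have hΓn : ∀ t ∈ Ioo 0 T, ∀ u, ‖S.Γ t u u‖ ≤ D * ‖u‖ ^ 2 := fun t ht u =>
    S.norm_Γ_self_le (S.Γ_nonneg t ht) (fun u => (hcomp t ht u).mono fun x hx => hx.2) hD.le u
  have hsymm : ∀ t ∈ Ioo 0 T, ∀ u v, S.energy t u v = S.energy t v u := fun t ht u v => by
    rw [energy, S.Γ_symm t ht, energy]
  have henergy : ∀ t ∈ Ioo 0 T, ∀ u v, S.energy t u v = ∫ x, Real.exp (-S.f t x) * S.Γ t u v x ∂m :=
    fun t ht u v => S.integral_meas ht _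
  -- the energy forms
  have ha : ∀ t ∈ Ioo 0 T, ∃ a : S.ref.Dom →L[ℝ] S.ref.Dom →L[ℝ] ℝ,
      (∀ u v, a u v = S.energy t u v) ∧ ‖a‖ ≤ Real.exp C * D := by
    intro t ht
    obtain ⟨J, hJ, hJn⟩ := exists_L1_functional (m := m)
      (S.measurable_weight ht).aestronglyMeasurable (hρ t ht)
    have hB : ∀ u v, (S.Γ t).compr₂ J u v = S.energy t u v := fun u v => by
      rw [henergy t ht, ← hJ]; rfl
    obtain ⟨a, ha, hn⟩ := exists_continuous_of_norm_self_le ((S.Γ t).compr₂ J)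
      (fun u v => by rw [hB, hB, hsymm t ht]) (K := Real.exp C * D) (by positivity) (fun u => by
        rw [LinearMap.compr₂_apply, mul_assoc]
        exact (hJn _).trans (mul_le_mul_of_nonneg_left (hΓn t ht u) (Real.exp_pos _).le))
    exact ⟨a, fun u v => by rw [ha, hB], hn⟩
  choose! a ha hna using ha
  -- The constant `3 L` is `2 L` from the variation of `Γ` plus `L` from the variation of the
  -- weight.
  have hasub : ∀ t ∈ Ioo 0 T, ∀ r ∈ Ioo 0 T, ‖a t - a r‖ ≤ 3 * L * D * Real.exp C * |t - r| := by
    intro t ht r hr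
    refine norm_le_of_norm_self_le _ (fun u v => ?_) (by positivity) fun u => ?_
    · rw [sub_apply, sub_apply, sub_apply, sub_apply, ha t ht, ha t ht, ha r hr, ha r hr,
        hsymm t ht, hsymm r hr]
    · rw [sub_apply, sub_apply, ha t ht, ha r hr, henergy t ht, henergy r hr]
      obtain ⟨J, hJ, hJn⟩ := exists_L1_functional (m := m)
        (S.measurable_weight ht).aestronglyMeasurable (hρ t ht)
      obtain ⟨J', hJ', hJn'⟩ := exists_L1_functional (m := m) (ρ := fun x => Real.exp (-S.f t x)
        - Real.exp (-S.f r x)) ((S.measurable_weight ht).sub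
          (S.measurable_weight hr)).aestronglyMeasurable (hf.abs_weight_sub_le hC ht hr)
      have e1 : ∫ x, Real.exp (-S.f t x) * S.Γ t u u x ∂m
          = J (S.Γ t u u - S.Γ r u u) + J (S.Γ r u u) := by rw [← map_add, sub_add_cancel, hJ]
      have e2 : J (S.Γ r u u) - ∫ x, Real.exp (-S.f r x) * S.Γ r u u x ∂m = J' (S.Γ r u u) := by
        rw [hJ, hJ', ← integral_sub (integrable_weight_mul ht hC (L1.integrable_coeFn _))
          (integrable_weight_mul hr hC (L1.integrable_coeFn _))]
        simp only [sub_mul]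
      rw [e1, add_sub_assoc, e2]
      refine (norm_add_le _ _).trans ((add_le_add (hJn _) (hJn' _)).trans ?_)
      have h1 := hΓ.norm_sub_le hL (fun t ht => hΓn t ht u) ht hr
      have h2 := hΓn r hr u
      have h3 : 0 ≤ Real.exp C * (L * |t - r|) := by positivity
      have h4 := mul_le_mul_of_nonneg_left h1 (Real.exp_pos C).le
      have h5 := mul_le_mul_of_nonneg_left h2 h3
      linarith
  -- the scalar products
  have hb : ∀ t ∈ Ioo 0 T, ∃ b : Lp ℝ 2 m →L[ℝ] Lp ℝ 2 m →L[ℝ] ℝ,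
      ∀ u v, b u v = ∫ x, Real.exp (-S.f t x) * (u x * v x) ∂m := by
    intro t ht
    obtain ⟨A, hA⟩ := DirichletForm.exists_Lp_mul (m := m)
      (S.measurable_weight ht).aestronglyMeasurable (Eventually.of_forall (hρ t ht))
    refine ⟨(innerSL ℝ).comp A, fun u v => ?_⟩
    rw [ContinuousLinearMap.comp_apply, innerSL_apply_apply, L2.inner_def]
    refine integral_congr_ae ?_
    filter_upwards [hA u] with x hx
    simp only [hx, RCLike.inner_apply, conj_trivial]
    ring
  choose! b hb using hb
  have hbsymm : ∀ t ∈ Ioo 0 T, ∀ u v, b t u v = b t v u := fun t ht u v => by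
    rw [hb t ht, hb t ht]
    simp only [mul_comm (u _)]
  have hbi : ∀ t ∈ Ioo 0 T, ∀ v : Lp ℝ 2 m,
      Integrable (fun x => Real.exp (-S.f t x) * (v x * v x)) m := fun t ht v =>
    integrable_weight_mul ht hC (Lp_integrable_sq v)
  have hnb : ∀ t ∈ Ioo 0 T, ‖b t‖ ≤ Real.exp C := fun t ht => by
    refine norm_le_of_norm_self_le _ (hbsymm t ht) (Real.exp_pos C).le fun v => ?_
    rw [hb t ht, ← Lp_integral_sq, ← integral_const_mul]
    refine norm_integral_le_of_norm_le ((Lp_integrable_sq v).const_mul _)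
      (Eventually.of_forall fun x => ?_)
    rw [norm_mul, Real.norm_of_nonneg (mul_self_nonneg _)]
    exact mul_le_mul_of_nonneg_right (hρ t ht x) (mul_self_nonneg _)
  have hbsub : ∀ t ∈ Ioo 0 T, ∀ r ∈ Ioo 0 T, ‖b t - b r‖ ≤ L * Real.exp C * |t - r| := by
    intro t ht r hr
    refine norm_le_of_norm_self_le _ (fun u v => ?_) (by positivity) fun v => ?_
    · rw [sub_apply, sub_apply, sub_apply, sub_apply, hbsymm t ht, hbsymm r hr]
    · rw [sub_apply, sub_apply, hb t ht, hb r hr, ← integral_sub (hbi t ht v) (hbi r hr v),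
        ← Lp_integral_sq, ← integral_const_mul]
      refine norm_integral_le_of_norm_le ((Lp_integrable_sq v).const_mul _)
        (Eventually.of_forall fun x => ?_)
      rw [← sub_mul, norm_mul, Real.norm_of_nonneg (mul_self_nonneg _)]
      refine mul_le_mul_of_nonneg_right ((hf.abs_weight_sub_le hC ht hr x).trans_eq ?_)
        (mul_self_nonneg _)
      ring
  -- multiplication by the weights
  have hN : ∀ t ∈ Ioo 0 T, ∃ N N' : S.ref.Dom →L[ℝ] S.ref.Dom,
      (∀ w, ∀ᵐ x ∂m, S.ref.incl (N w) x = S.ref.incl w x * Real.exp (-S.f t x)) ∧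
      (∀ w, ∀ᵐ x ∂m, S.ref.incl (N' w) x = S.ref.incl w x * Real.exp (S.f t x)) ∧
      ‖N‖ ≤ Real.sqrt (2 * Real.exp (2 * C) * D ^ 2 * C₂ + Real.exp (2 * C)) ∧
      ‖N'‖ ≤ Real.sqrt (2 * Real.exp (2 * C) * D ^ 2 * C₂ + Real.exp (2 * C)) := by
    intro t ht
    obtain ⟨f, hf1, hf2⟩ := hC₁ t ht
    have hf2' : ∀ᵐ x ∂m, S.Γref f f x ≤ C₂ := hf2.mono fun x hx => hx.trans (le_max_left _ _)
    have hneg : ∀ᵐ x ∂m, S.ref.incl (-f) x = -S.f t x := by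
      rw [map_neg]
      filter_upwards [hf1, Lp.coeFn_neg (S.ref.incl f)] with x h1 h2
      rw [h2, Pi.neg_apply, h1]
    -- Applied to `-f` for the weight and to `f` for its inverse; both satisfy the same bounds.
    obtain ⟨N, h1, h2⟩ := DirichletForm.exists_mulExp S.ref_squareField (S.Γ_symm t ht)
      (S.Γ_nonneg t ht) (S.Γ_diffusion t ht) hD (hcomp t ht) (f := -f) (C := C) hC₂
      (hneg.mono fun x hx => by rw [hx, abs_neg]; exact hC t ht x)
      (by simpa only [map_neg, LinearMap.neg_apply, neg_neg] using hf2')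
    obtain ⟨N', h1', h2'⟩ := DirichletForm.exists_mulExp S.ref_squareField (S.Γ_symm t ht)
      (S.Γ_nonneg t ht) (S.Γ_diffusion t ht) hD (hcomp t ht) (f := f) (C := C) hC₂
      (hf1.mono fun x hx => by rw [hx]; exact hC t ht x) hf2'
    refine ⟨N, N', fun w => ?_, fun w => ?_, h2, h2'⟩
    · filter_upwards [h1 w, hneg] with x h3 h4
      rw [h3, h4, mul_comm]
    · filter_upwards [h1' w, hf1] with x h3 h4
      rw [h3, h4, mul_comm]
  choose! N N' hN hN' hNn hNn' using hN
  set KN := Real.sqrt (2 * Real.exp (2 * C) * D ^ 2 * C₂ + Real.exp (2 * C)) with hKN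
  have hKN0 : 0 ≤ KN := Real.sqrt_nonneg _
  set K := Real.exp C * D + 3 * L * D * Real.exp C + Real.exp C + L * Real.exp C + KN with hK
  have p1 : 0 ≤ Real.exp C * D := by positivity
  have p2 : 0 ≤ 3 * L * D * Real.exp C := by positivity
  have p3 : 0 ≤ Real.exp C := by positivity
  have p4 : 0 ≤ L * Real.exp C := by positivity
  refine ⟨{ ι := S.ref.incl, ι_inj := S.ref.incl_injective, a := a, b := b, N := N, N' := N',
            c := min (min 1 (Real.exp (-C) / D)) (Real.exp (-C)), K := K,
            c_pos := by positivity
            K_nonneg := by positivity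
            L_nonneg := hL
            a_symm := fun t ht u v => by rw [ha t ht, ha t ht, hsymm t ht]
            a_nonneg := fun t ht u => ?_
            a_coercive := fun t ht u => ?_
            norm_a_le := fun t ht => (hna t ht).trans (by linarith)
            norm_a_sub_le := fun t ht r hr => (hasub t ht r hr).trans
              (mul_le_mul_of_nonneg_right (by linarith) (abs_nonneg _))
            b_symm := hbsymm
            b_coercive := fun t ht v => ?_
            norm_b_le := fun t ht => (hnb t ht).trans (by linarith)
            norm_b_sub_le := fun t ht r hr => (hbsub t ht r hr).trans
              (mul_le_mul_of_nonneg_right (by linarith) (abs_nonneg _))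
            b_le_exp := fun t ht r hr v => ?_
            b_apply_ι := fun t ht h w => ?_
            b_apply_ι' := fun t ht h w => ?_
            norm_N_le := fun t ht => (hNn t ht).trans (by linarith)
            norm_N'_le := fun t ht => (hNn' t ht).trans (by linarith) }, rfl, ha, hb, hN⟩
  · rw [ha t ht, henergy t ht]
    refine integral_nonneg_of_ae ?_
    filter_upwards [S.Γ_nonneg t ht u] with x hx
    exact mul_nonneg (Real.exp_pos _).le hx
  · set c := min (min 1 (Real.exp (-C) / D)) (Real.exp (-C))
    have hc1 : c ≤ 1 := (min_le_left _ _).trans (min_le_left _ _)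
    have hc2 : c ≤ Real.exp (-C) / D := (min_le_left _ _).trans (min_le_right _ _)
    rw [S.ref.norm_sq_dom, mul_add]
    refine add_le_add ?_ (mul_le_of_le_one_left (sq_nonneg _) hc1)
    refine (mul_le_mul_of_nonneg_right hc2 (S.ref.formDom_self_nonneg u)).trans ?_
    rw [← S.ref_squareField.integral_eq, ha t ht, henergy t ht, ← integral_const_mul]
    refine integral_mono_ae ((L1.integrable_coeFn _).const_mul _)
      (integrable_weight_mul ht hC (L1.integrable_coeFn _)) ?_
    filter_upwards [hcomp t ht u, S.Γ_nonneg t ht u] with x h1 h2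
    calc Real.exp (-C) / D * S.Γref u u x = Real.exp (-C) * (1 / D * S.Γref u u x) := by ring
      _ ≤ Real.exp (-C) * S.Γ t u u x := mul_le_mul_of_nonneg_left h1.1 (Real.exp_pos _).le
      _ ≤ Real.exp (-S.f t x) * S.Γ t u u x := mul_le_mul_of_nonneg_right (hρ' t ht x) h2
  · refine (mul_le_mul_of_nonneg_right (min_le_right _ _) (sq_nonneg _)).trans ?_
    rw [← Lp_integral_sq, hb t ht, ← integral_const_mul]
    refine integral_mono ((Lp_integrable_sq v).const_mul _) (hbi t ht v) fun x => ?_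
    exact mul_le_mul_of_nonneg_right (hρ' t ht x) (mul_self_nonneg _)
  · rw [hb t ht, hb r hr, ← integral_const_mul]
    refine integral_mono (hbi t ht v) ((hbi r hr v).const_mul _) fun x => ?_
    simp only [← mul_assoc]
    rw [mul_assoc, mul_assoc _ (v x)]
    exact mul_le_mul_of_nonneg_right (hf.weight_le ht hr x) (mul_self_nonneg _)
  · rw [hb t ht, L2.inner_def]
    refine integral_congr_ae ?_
    filter_upwards [hN t ht w] with x hx
    simp only [hx, RCLike.inner_apply, conj_trivial]
    ring
  · rw [hb t ht, L2.inner_def]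
    refine integral_congr_ae ?_
    filter_upwards [hN' t ht w] with x hx
    have h1 : Real.exp (-S.f t x) * Real.exp (S.f t x) = 1 := by rw [← Real.exp_add]; simp
    simp only [hx, RCLike.inner_apply, conj_trivial]
    linear_combination (S.ref.incl w x * h x) * h1

end TimeDepForm

/-! ### Weak solutions in terms of test functions -/

/-- Integration by parts: `φ' ℓ` is the weak derivative of `φ ℓ`, which makes products of a function
of time and a fixed vector admissible in the heat equation. -/
theorem integral_deriv_smul_smul_const {G : Type*} [NormedAddCommGroup G] [NormedSpace ℝ G]
    [CompleteSpace G] {s τ : ℝ} {φ ψ : ℝ → ℝ} (hφ : ContDiff ℝ ∞ φ) (hψ : ContDiff ℝ ∞ ψ)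
    (hψc : HasCompactSupport ψ) (hψs : tsupport ψ ⊆ Ioo s τ) (ℓ : G) :
    ∫ t in Ioo s τ, deriv ψ t • φ t • ℓ = -∫ t in Ioo s τ, ψ t • deriv φ t • ℓ := by
  have hφ1 : ContDiff ℝ 1 φ := hφ.of_le (by exact_mod_cast le_top)
  have hψ1 : ContDiff ℝ 1 ψ := hψ.of_le (by exact_mod_cast le_top)
  have e : ∀ f : ℝ → ℝ, Function.support f ⊆ Ioo s τ → ∫ t in Ioo s τ, f t = ∫ t, f t :=
    fun f hf => setIntegral_eq_integral_of_forall_compl_eq_zero fun x hx => by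
      by_contra h; exact hx (hf h)
  have h1 : Function.support (fun t => deriv ψ t * φ t) ⊆ Ioo s τ :=
    (Function.support_mul_subset_left _ _).trans (support_deriv_subset.trans hψs)
  have h2 : Function.support (fun t => ψ t * deriv φ t) ⊆ Ioo s τ :=
    (Function.support_mul_subset_left _ _).trans ((subset_tsupport ψ).trans hψs)
  simp only [smul_smul]
  rw [integral_smul_const, integral_smul_const, ← neg_smul, e _ h1, e _ h2]
  congr 1
  have h3 := integral_mul_deriv_eq_deriv_mul_of_integrable (u := ψ) (v := φ) (u' := deriv ψ)
    (v' := deriv φ) (fun x _ => (hψ1.differentiable one_ne_zero).differentiableAt.hasDerivAt)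
    (fun x _ => (hφ1.differentiable one_ne_zero).differentiableAt.hasDerivAt)
    ((hψ1.continuous.mul (hφ1.continuous_deriv le_rfl)).integrable_of_hasCompactSupport hψc.mul_right)
    (((hψ1.continuous_deriv le_rfl).mul hφ1.continuous).integrable_of_hasCompactSupport
      hψc.deriv.mul_right)
    ((hψ1.continuous.mul hφ1.continuous).integrable_of_hasCompactSupport hψc.mul_right)
  rw [h3, neg_neg]

namespace FormFlow

variable {F H : Type*} [NormedAddCommGroup F] [InnerProductSpace ℝ F] [CompleteSpace F]
    [NormedAddCommGroup H] [InnerProductSpace ℝ H] [CompleteSpace H] [SecondCountableTopology F]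
    {T L : ℝ} {E : FormFlow F H T L} {s τ : ℝ}

/-- Tested against `h`, the curve is `b t h (ι w)`, which is continuous in time. -/
theorem aestronglyMeasurable_N (hs : 0 ≤ s) (hτ : τ ≤ T) (w : F) :
    AEStronglyMeasurable (fun t => E.N t w) (volume.restrict (Ioo s τ)) := by
  have hI : Ioo s τ ⊆ Ioo 0 T := Ioo_subset_Ioo hs hτ
  refine aestronglyMeasurable_of_comp E.ι_inj fun h => ?_
  have h1 : ContinuousOn (fun t => E.b t h (E.ι w)) (Ioo s τ) :=
    ((continuousOn_b (E := E)).mono hI).clm_apply continuousOn_const |>.clm_apply continuousOn_const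
  refine (h1.aemeasurable measurableSet_Ioo).congr ((ae_restrict_iff' measurableSet_Ioo).2
    (Eventually.of_forall fun t ht => ?_))
  change E.b t h (E.ι w) = ⟪E.ι (E.N t w), h⟫
  rw [E.b_apply_ι t (hI ht), real_inner_comm]

/-- The equation tested with products of a function of time and a fixed element of `F`. -/
theorem ae_apply_N_of_integral (hs : 0 ≤ s) (hτ : τ ≤ T) {U : ℝ → F} {U' : ℝ → StrongDual ℝ F}
    (hU : MemLp U 2 (volume.restrict (Ioo s τ))) (hU' : MemLp U' 2 (volume.restrict (Ioo s τ)))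
    (h : ∀ (w : F) (φ : ℝ → ℝ), ContDiff ℝ ∞ φ → HasCompactSupport φ → tsupport φ ⊆ Ioo s τ →
      -∫ t in Ioo s τ, E.a t (U t) (φ t • w) = ∫ t in Ioo s τ, U' t (φ t • E.N t w)) :
    ∀ᵐ t, t ∈ Ioo s τ → ∀ v, U' t (E.N t v) = -E.a t (U t) v := by
  have hI : Ioo s τ ⊆ Ioo 0 T := Ioo_subset_Ioo hs hτ
  have hK := E.K_nonneg
  have hUi : IntegrableOn U (Ioo s τ) := hU.integrable one_le_two
  have hUi' : IntegrableOn U' (Ioo s τ) := hU'.integrable one_le_two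
  have key : ∀ w : F, ∀ᵐ t, t ∈ Ioo s τ → U' t (E.N t w) + E.a t (U t) w = 0 := by
    intro w
    have h1 : IntegrableOn (fun t => E.a t (U t) w) (Ioo s τ) := by
      refine Integrable.mono' (hUi.norm.const_mul (E.K * ‖w‖))
        (aestronglyMeasurable_a measurableSet_Ioo hI hU.1 aestronglyMeasurable_const) ?_
      refine (ae_restrict_iff' measurableSet_Ioo).2 (Eventually.of_forall fun t ht => ?_)
      exact (abs_a_le (hI ht) _ _).trans_eq (by ring)
    have h2 : IntegrableOn (fun t => U' t (E.N t w)) (Ioo s τ) := by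
      refine Integrable.mono' (hUi'.norm.const_mul (E.K * ‖w‖))
        (isBoundedBilinearMap_apply.continuous.comp_aestronglyMeasurable₂ hU'.1
          (aestronglyMeasurable_N hs hτ w)) ?_
      refine (ae_restrict_iff' measurableSet_Ioo).2 (Eventually.of_forall fun t ht => ?_)
      calc ‖U' t (E.N t w)‖ ≤ ‖U' t‖ * ‖E.N t w‖ := (U' t).le_opNorm _
        _ ≤ ‖U' t‖ * (E.K * ‖w‖) := by
          gcongr
          exact ((E.N t).le_opNorm w).trans (by gcongr; exact E.norm_N_le t (hI ht))
        _ = _ := by ring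
    refine isOpen_Ioo.ae_eq_zero_of_integral_contDiff_smul_eq_zero
      (h2.add h1).locallyIntegrableOn fun φ hφ hφc hφs => ?_
    have e : ∫ t, φ t • (U' t (E.N t w) + E.a t (U t) w)
        = ∫ t in Ioo s τ, φ t • (U' t (E.N t w) + E.a t (U t) w) := by
      refine (setIntegral_eq_integral_of_forall_compl_eq_zero fun t ht => ?_).symm
      rw [image_eq_zero_of_notMem_tsupport fun h => ht (hφs h), zero_smul]
    have hφb : ∃ C, ∀ t, ‖φ t‖ ≤ C := hφc.exists_bound_of_continuous hφ.continuous
    obtain ⟨C, hC⟩ := hφb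
    have h3 : IntegrableOn (fun t => φ t * U' t (E.N t w)) (Ioo s τ) :=
      h2.bdd_mul hφ.continuous.aestronglyMeasurable (Eventually.of_forall hC)
    have h4 : IntegrableOn (fun t => φ t * E.a t (U t) w) (Ioo s τ) :=
      h1.bdd_mul hφ.continuous.aestronglyMeasurable (Eventually.of_forall hC)
    have h5 := h w φ hφ hφc hφs
    simp only [map_smul, smul_eq_mul] at h5
    simp only [smul_eq_mul, mul_add] at e ⊢
    rw [e, integral_add h3 h4, ← h5, neg_add_cancel]
  -- The fundamental lemma gives a null set for each `w`; a dense sequence and continuity in `v`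
  -- make it independent of `v`.
  let e := TopologicalSpace.denseSeq F
  filter_upwards [ae_all_iff.2 fun n => key (e n)] with t ht hts v
  have h1 : (fun v => U' t (E.N t v)) = fun v => -E.a t (U t) v :=
    (TopologicalSpace.denseRange_denseSeq F).equalizer (by fun_prop) (by fun_prop)
      (funext fun n => eq_neg_of_add_eq_zero_left (ht n hts))
  exact congrFun h1 v

/-- The growth estimate up to the boundary of the time interval. -/
theorem IsStrongSol.b_self_le_exp_mul_of_continuousOn {x : ℝ → H} {U : ℝ → F}
    (hx : E.IsStrongSol x U s τ) (hs : 0 ≤ s) (hτ : τ ≤ T) (hc : ContinuousOn x (Icc s τ))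
    {r t : ℝ} (hr : r ∈ Icc s τ ∩ Ioo 0 T) (ht : t ∈ Icc s τ ∩ Ioo 0 T) (hrt : r < t) :
    E.b t (x t) (x t) ≤ Real.exp (L * (t - r)) * E.b r (x r) (x r) := by
  set g : ℝ → ℝ := fun q => E.b q (x q) (x q) with hg
  have hgc : ContinuousOn g (Icc s τ ∩ Ioo 0 T) :=
    (((continuousOn_b (E := E)).mono inter_subset_right).clm_apply
      (hc.mono inter_subset_left)).clm_apply (hc.mono inter_subset_left)
  have hsub : Ioo r t ⊆ Icc s τ ∩ Ioo 0 T := fun q hq =>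
    ⟨⟨hr.1.1.trans hq.1.le, hq.2.le.trans ht.1.2⟩, hr.2.1.trans hq.1, hq.2.trans ht.2.2⟩
  have hgr : Tendsto g (𝓝[>] r) (𝓝 (g r)) := by
    rw [← nhdsWithin_Ioo_eq_nhdsGT hrt]
    exact (hgc r hr).mono hsub
  have hgt : Tendsto g (𝓝[<] t) (𝓝 (g t)) := by
    rw [← nhdsWithin_Ioo_eq_nhdsLT hrt]
    exact (hgc t ht).mono hsub
  have h1 : ∀ q ∈ Ioo r t, g q ≤ Real.exp (L * (q - r)) * g r := by
    intro q hq
    have h2 : Tendsto (fun p => Real.exp (L * (q - p)) * g p) (𝓝[>] r)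
        (𝓝 (Real.exp (L * (q - r)) * g r)) := by
      refine Tendsto.mul ?_ hgr
      exact (Continuous.tendsto (by fun_prop) r : Tendsto (fun p => Real.exp (L * (q - p))) (𝓝 r)
        (𝓝 (Real.exp (L * (q - r))))).mono_left nhdsWithin_le_nhds
    refine ge_of_tendsto h2 ?_
    filter_upwards [Ioo_mem_nhdsGT hq.1] with p hp
    exact hx.b_self_le_exp_mul hs hτ (hr.1.1.trans_lt hp.1) hp.2.le (hq.2.trans_le ht.1.2)
  have h2 : Tendsto (fun q => Real.exp (L * (q - r)) * g r) (𝓝[<] t)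
      (𝓝 (Real.exp (L * (t - r)) * g r)) :=
    (Continuous.tendsto (by fun_prop) t : Tendsto (fun q => Real.exp (L * (q - r)) * g r) (𝓝 t)
      (𝓝 (Real.exp (L * (t - r)) * g r))).mono_left nhdsWithin_le_nhds
  refine le_of_tendsto_of_tendsto hgt h2 ?_
  filter_upwards [Ioo_mem_nhdsLT hrt] with q hq using h1 q hq

end FormFlow

/-! ### Heat solutions and weak solutions -/

namespace TimeDepForm

variable {X : Type*} [MeasurableSpace X] {m : Measure X} {T L : ℝ} {S : TimeDepForm m T}

/-- The abstract form flow `E` represents the time-dependent Dirichlet form `S`. -/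
structure Represents (E : FormFlow S.ref.Dom (Lp ℝ 2 m) T L) : Prop where
  ι_eq : E.ι = S.ref.incl
  a_eq : ∀ t ∈ Ioo 0 T, ∀ u v, E.a t u v = S.energy t u v
  b_eq : ∀ t ∈ Ioo 0 T, ∀ u v, E.b t u v = ∫ x, Real.exp (-S.f t x) * (u x * v x) ∂m
  N_eq : ∀ t ∈ Ioo 0 T, ∀ w, ∀ᵐ x ∂m,
    S.ref.incl (E.N t w) x = S.ref.incl w x * Real.exp (-S.f t x)

namespace Represents

variable {E : FormFlow S.ref.Dom (Lp ℝ 2 m) T L} {s τ : ℝ}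

theorem normAt_eq (hE : Represents E) {t : ℝ} (ht : t ∈ Ioo 0 T) (v : Lp ℝ 2 m) :
    S.normAt t v = Real.sqrt (E.b t v v) := by
  rw [normAt, S.integral_meas ht, hE.b_eq t ht]
  simp only [sq_abs]
  simp only [sq]

theorem isDist (hE : Represents E) : E.IsDist S.distAt := fun _ ht v w => hE.normAt_eq ht (v - w)

theorem halfEnergy_ι (hE : Represents E) {t : ℝ} (ht : t ∈ Ioo 0 T) (u : S.ref.Dom) :
    S.halfEnergy t (E.ι u) = ((1 / 2 * E.a t u u : ℝ) : EReal) := by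
  rw [hE.ι_eq, hE.a_eq t ht]
  exact dif_pos u.2

theorem exists_of_halfEnergy_ne_top (hE : Represents E) {t : ℝ} {z : Lp ℝ 2 m} (hz : S.halfEnergy t z ≠ ⊤) :
    ∃ u, E.ι u = z := by
  by_cases h : z ∈ S.ref.dom
  · exact ⟨⟨z, h⟩, by rw [hE.ι_eq]; rfl⟩
  · exact absurd (dif_neg h) hz

theorem toDual_eq (hE : Represents E) (u : S.ref.Dom) : E.toDual (E.ι u) = S.ref.toDual u := by
  refine ContinuousLinearMap.ext fun v => ?_
  rw [FormFlow.toDual_apply, hE.ι_eq]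
  rfl

theorem eq_N (hE : Represents E) {t : ℝ} (ht : t ∈ Ioo 0 T) {w v : S.ref.Dom}
    (h : ∀ᵐ x ∂m, S.ref.incl v x = S.ref.incl w x * Real.exp (-S.f t x)) : v = E.N t w := by
  refine S.ref.ae_eq_of_incl_eq ?_
  filter_upwards [h, hE.N_eq t ht w] with x h1 h2
  rw [h1, h2]

/-- The function `V t = W t e^{-f_t}` can only be `N t (W t)`, because an element of the form domain
is determined by its values; the equation then holds at almost every time, before integration. -/
theorem isHeatSolution_of_isWeakSol (hE : Represents E) (hs : 0 ≤ s) (hτ : τ ≤ T) {u : ℝ → Lp ℝ 2 m}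
    {U : ℝ → S.ref.Dom} {U' : ℝ → StrongDual ℝ S.ref.Dom} (hu : E.IsWeakSol u U U' s τ) :
    S.IsHeatSolution s τ u := by
  have hI : Ioo s τ ⊆ Ioo 0 T := Ioo_subset_Ioo hs hτ
  refine ⟨hu.continuousOn, U, U', ⟨hu.memLp, hu.memLp_deriv, fun φ hφ hφc hφs => ?_⟩, ?_, ?_⟩
  · rw [← hu.weak_deriv φ hφ hφc hφs]
    simp only [hE.toDual_eq]
  · rw [ae_restrict_iff' measurableSet_Ioo]
    filter_upwards [hu.ae_eq] with t ht hts
    rw [← ht hts, hE.ι_eq]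
  · intro W W' V _ hV
    rw [← integral_neg]
    rw [ae_restrict_iff' measurableSet_Ioo] at hV
    refine setIntegral_congr_ae measurableSet_Ioo ?_
    filter_upwards [hV, hu.apply_N] with t h1 h2 hts
    rw [hE.eq_N (hI hts) (h1 hts), h2 hts, hE.a_eq t (hI hts)]

/-- Test functions `φ(t) w` with `w` fixed suffice to recover the equation at almost every time. -/
theorem exists_isWeakSol (hE : Represents E) [SecondCountableTopology S.ref.Dom] (hs : 0 ≤ s) (hτ : τ ≤ T)
    {u : ℝ → Lp ℝ 2 m} (hu : S.IsHeatSolution s τ u) : ∃ U U', E.IsWeakSol u U U' s τ := by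
  have hI : Ioo s τ ⊆ Ioo 0 T := Ioo_subset_Ioo hs hτ
  obtain ⟨hc, U, U', hU, hae, htest⟩ := hu
  refine ⟨U, U', hc, hU.memLp, hU.memLp_deriv, fun φ hφ hφc hφs => ?_, ?_, ?_⟩
  · simp only [hE.toDual_eq]
    exact hU.weak_deriv φ hφ hφc hφs
  · rw [ae_restrict_iff' measurableSet_Ioo] at hae
    filter_upwards [hae] with t ht hts
    rw [ht hts, hE.ι_eq]
  · refine E.ae_apply_N_of_integral hs hτ hU.memLp hU.memLp_deriv fun w φ hφ hφc hφs => ?_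
    have hmem : ∀ {G : Type _} [NormedAddCommGroup G] [NormedSpace ℝ G] (ψ : ℝ → ℝ) (g : G),
        Continuous ψ → HasCompactSupport ψ →
          MemLp (fun t => ψ t • g) 2 (volume.restrict (Ioo s τ)) := by
      intro G _ _ ψ g hψ hψc
      obtain ⟨C, hC⟩ := hψc.exists_bound_of_continuous hψ
      refine MemLp.of_bound (hψ.aestronglyMeasurable.smul_const g) (C * ‖g‖)
        (Eventually.of_forall fun t => ?_)
      rw [norm_smul]
      exact mul_le_mul_of_nonneg_right (hC t) (norm_nonneg _)
    have h1 := htest (fun t => φ t • w) (fun t => deriv φ t • S.ref.toDual w)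
      (fun t => φ t • E.N t w) ⟨hmem φ w hφ.continuous hφc,
        hmem (deriv φ) (S.ref.toDual w) (hφ.continuous_deriv (by simp)) hφc.deriv,
        fun ψ hψ hψc hψs => ?_⟩ ?_
    · rw [← h1]
      congr 1
      refine setIntegral_congr_fun measurableSet_Ioo fun t ht => ?_
      exact hE.a_eq t (hI ht) _ _
    · simp only [map_smul]
      exact integral_deriv_smul_smul_const hφ hψ hψc hψs _
    · rw [ae_restrict_iff' measurableSet_Ioo]
      refine Eventually.of_forall fun t ht => ?_
      rw [map_smul, map_smul]
      filter_upwards [hE.N_eq t (hI ht) w, Lp.coeFn_smul (φ t) (S.ref.incl (E.N t w)),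
        Lp.coeFn_smul (φ t) (S.ref.incl w)] with x f1 f2 f3
      rw [f2, f3, Pi.smul_apply, Pi.smul_apply, f1, smul_eq_mul, smul_eq_mul, mul_assoc]

end Represents

variable [SecondCountableTopology S.ref.Dom]

/-- The characterization of heat flows as EVI flows for a nonnegative Lipschitz constant. -/
theorem heatFlow_evi_of_nonneg (hf : S.WeightLipschitz L) (hΓ : S.GammaLogLipschitz L)
    (hL : 0 ≤ L) {s τ : ℝ} (hT : 0 < T) (hs : 0 ≤ s) (hsτ : s < τ) (hτ : τ ≤ T) :
    (∀ u : ℝ → Lp ℝ 2 m, S.IsHeatSolution s τ u →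
      DynEVI.IsForwardEVI T S.distAt S.halfEnergy (-L / 2) s τ u ∧
      ∀ t ∈ Ioo s τ, u t ∈ S.ref.dom) ∧
    (∀ (h : Lp ℝ 2 m) (x : ℝ → Lp ℝ 2 m),
      DynEVI.IsForwardEVI T S.distAt S.halfEnergy (-L / 2) s τ x →
      Tendsto x (𝓝[>] s) (𝓝 h) →
      (∃ u, S.IsHeatSolution s τ u ∧ u s = h ∧ EqOn u x (Ioo s τ)) ∧
      ∀ u, S.IsHeatSolution s τ u → u s = h → EqOn u x (Ioo s τ)) ∧
    (∀ u : ℝ → Lp ℝ 2 m, S.IsHeatSolution s τ u →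
      ∀ r ∈ Icc s τ ∩ Ioo 0 T, ∀ t ∈ Icc s τ ∩ Ioo 0 T, r < t →
        S.normAt t (u t) ≤ Real.exp (L * (t - r) / 2) * S.normAt r (u r)) := by
  obtain ⟨E, h1, h2, h3, h4⟩ := exists_formFlow hf hΓ hL
  have hE : Represents E := ⟨h1, h2, h3, h4⟩
  refine ⟨fun u hu => ?_, fun h x hx hxh => ⟨?_, fun u hu hus => ?_⟩, fun u hu r hr t ht hrt => ?_⟩
  · obtain ⟨U, U', hw⟩ := hE.exists_isWeakSol hs hτ hu
    have hst := hw.isStrongSol hs hτ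
    have hbd := fun p hp hpτ => hw.exists_bound hs hτ (p₀ := p) hp hpτ
    refine ⟨hst.isForwardEVI hs hτ hbd hE.isDist (fun t ht => hE.halfEnergy_ι ht)
      fun t _ z => hE.exists_of_halfEnergy_ne_top, fun t ht => ?_⟩
    obtain ⟨p, hp⟩ := exists_between ht.1
    obtain ⟨C, hC⟩ := hbd p hp.1 (hp.2.trans ht.2)
    obtain ⟨v, hv, -⟩ := hC t ⟨hp.2.le, ht.2⟩
    rw [← hv, hE.ι_eq]
    exact v.2
  · obtain ⟨U, hst⟩ := FormFlow.exists_isStrongSol_of_evi hE.isDist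
      (fun t ht => hE.halfEnergy_ι ht) (fun t _ z => hE.exists_of_halfEnergy_ne_top) hs hτ hT hx
    obtain ⟨y, U', hy, hys, hyx⟩ := hst.exists_isWeakSol hs hsτ hτ hxh
    exact ⟨y, hE.isHeatSolution_of_isWeakSol hs hτ hy, hys, hyx⟩
  · obtain ⟨V, hst⟩ := FormFlow.exists_isStrongSol_of_evi hE.isDist
      (fun t ht => hE.halfEnergy_ι ht) (fun t _ z => hE.exists_of_halfEnergy_ne_top) hs hτ hT hx
    obtain ⟨U, U', hw⟩ := hE.exists_isWeakSol hs hτ hu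
    have huh : Tendsto u (𝓝[>] s) (𝓝 h) := by
      rw [← hus, ← nhdsWithin_Ioo_eq_nhdsGT hsτ]
      exact (hw.continuousOn s ⟨le_rfl, hsτ.le⟩).mono Ioo_subset_Icc_self
    -- The heat solution and the EVI flow are both strong, so their difference is strong with
    -- initial value zero.
    have h0 := ((hw.isStrongSol hs hτ).sub hst).eq_zero hs hτ (by simpa using huh.sub hxh)
    exact fun t ht => sub_eq_zero.1 (h0 t ht)
  · obtain ⟨U, U', hw⟩ := hE.exists_isWeakSol hs hτ hu
    have h5 := (hw.isStrongSol hs hτ).b_self_le_exp_mul_of_continuousOn hs hτ hw.continuousOn hr ht hrt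
    have h6 : Real.exp (L * (t - r) / 2) = Real.sqrt (Real.exp (L * (t - r))) := Real.exp_half _
    rw [hE.normAt_eq ht.2, hE.normAt_eq hr.2, h6, ← Real.sqrt_mul (Real.exp_pos _).le]
    exact Real.sqrt_le_sqrt h5

end TimeDepForm

end

/-! ### Conclusion: the sign of `L`. -/

theorem mainTheorem5 {X : Type*} [TopologicalSpace X] [PolishSpace X] [MeasurableSpace X]
    [BorelSpace X] (m : Measure X) [SigmaFinite m] [m.IsOpenPosMeasure]
    (T L : ℝ) (hT : 0 < T) (S : TimeDepForm m T)
    (hf : S.WeightLipschitz L) (hΓ : S.GammaLogLipschitz L)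
    (s τ : ℝ) (hs : 0 ≤ s) (hsτ : s < τ) (hτ : τ ≤ T) :
    -- every solution to the heat equation is an EVI flow with values in the form domain
    (∀ u : ℝ → Lp ℝ 2 m, S.IsHeatSolution s τ u →
      DynEVI.IsForwardEVI T S.distAt S.halfEnergy (-L / 2) s τ u ∧
      ∀ t ∈ Ioo s τ, u t ∈ S.ref.dom) ∧
    -- every EVI flow emanating in `h` is the heat flow with initial value `h`
    (∀ (h : Lp ℝ 2 m) (x : ℝ → Lp ℝ 2 m),
      DynEVI.IsForwardEVI T S.distAt S.halfEnergy (-L / 2) s τ x →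
      Tendsto x (𝓝[>] s) (𝓝 h) →
      (∃ u, S.IsHeatSolution s τ u ∧ u s = h ∧ EqOn u x (Ioo s τ)) ∧
      ∀ u, S.IsHeatSolution s τ u → u s = h → EqOn u x (Ioo s τ)) ∧
    -- growth estimate
    (∀ u : ℝ → Lp ℝ 2 m, S.IsHeatSolution s τ u →
      ∀ r ∈ Icc s τ ∩ Ioo 0 T, ∀ t ∈ Icc s τ ∩ Ioo 0 T, r < t →
        S.normAt t (u t) ≤ Real.exp (L * (t - r) / 2) * S.normAt r (u r)) := by
  have : Fact ((2 : ℝ≥0∞) ≠ (⊤ : ℝ≥0∞)) := ⟨ENNReal.ofNat_ne_top⟩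
  have : SecondCountableTopology S.ref.Dom :=
    secondCountableTopology_of_injective S.ref.incl_injective
  -- On the empty space nothing forces `0 ≤ L`, but all norms vanish there and the EVI does not
  -- depend on its constant, so the case `L = 0` applies.
  rcases isEmpty_or_nonempty X with hX | ⟨⟨x₀⟩⟩
  · have hsub : ∀ v w : Lp ℝ 2 m, v = w := fun v w => Lp.ext (Eventually.of_forall hX.elim)
    have hn : ∀ t v, S.normAt t v = 0 := fun t v => by
      have : S.meas t = 0 := Measure.eq_zero_of_isEmpty _
      rw [TimeDepForm.normAt, this, integral_zero_measure, Real.sqrt_zero]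
    have hevi : ∀ (K K' : ℝ) (x : ℝ → Lp ℝ 2 m),
        DynEVI.IsForwardEVI T S.distAt S.halfEnergy K s τ x →
        DynEVI.IsForwardEVI T S.distAt S.halfEnergy K' s τ x := fun K K' x hx =>
      ⟨hx.absCont, fun t ht z hz => by
        have := hx.evi t ht z hz
        rw [TimeDepForm.distAt, hn, zero_pow two_ne_zero, mul_zero] at this ⊢
        exact this⟩
    obtain ⟨h1, h2, -⟩ := TimeDepForm.heatFlow_evi_of_nonneg (L := 0) (S := S)
      (fun _ _ _ _ x => hX.elim x) (fun _ _ _ _ _ _ => Eventually.of_forall hX.elim) le_rfl hT hs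
      hsτ hτ
    exact ⟨fun u hu => ⟨hevi _ _ u (h1 u hu).1, (h1 u hu).2⟩,
      fun h x hx hxh => h2 h x (hevi _ _ x hx) hxh,
      fun u _ r _ t _ _ => by rw [hn, hn, mul_zero]⟩
  -- The Lipschitz bound on the weights at one point and two distinct times excludes negative `L`.
  · have hL : 0 ≤ L := by
      have h1 := (abs_nonneg _).trans
        (hf (T / 3) ⟨by linarith, by linarith⟩ (T / 2) ⟨by linarith, by linarith⟩ x₀)
      have h2 : 0 < |T / 2 - T / 3| := abs_pos.2 (by linarith)
      exact nonneg_of_mul_nonneg_left h1 h2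
    exact TimeDepForm.heatFlow_evi_of_nonneg hf hΓ hL hT hs hsτ hτ
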